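/- Write $\mathbb C\{x\}$ and $\mathbb C\{x,y\}$ for the rings of convergent complex power series. A fractional power series is an element of $\mathbb C\{x\}^*=\bigcup_{m\ge 1}\mathbb C\{x^{1/m}\}$. For $g\in\mathbb C\{x,y\}$ let $\operatorname{Zer} g$ be the set of Newton--Puiseux roots of $g$, that is, the fractional power series $\gamma$ of positive order with $g(x,\gamma(x))=0$. For a fractional power series $\alpha$ put $\operatorname{cont}(\alpha,g)=\max\{\operatorname{ord}_x(\alpha-\gamma):\gamma\in\operatorname{Zer} g\}$. Let $f\in\mathbb C\{x\}[y]$ be an irreducible Weierstrass polynomial, that is, an irreducible monic polynomial in $y$ whose non-leading coefficients vanish at $x=0$. Let $(b_0,b_1,\dots,b_g)$ be its Puiseux characteristic: $b_0=\deg_y f$, $b_1<\dots<b_g$, and $\{b_1/b_0,\dots,b_g/b_0\}$ is the set of the orders $\operatorname{ord}_x(\gamma-\gamma')$ for $\gamma\ne\gamma'$ in $\operatorname{Zer} f$. Put $l_i=\gcd(b_0,\dots,b_i)$ for $0\le i\le g$ and $n_i=l_{i-1}/l_i$ for $1\le i\le g$. Let $0\le k\le g-1$ and let $f^{(k)}$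 be the $k$-th characteristic approximate root of $f$, that is, the unique monic polynomial in $\mathbb C\{x\}[y]$ such that $\deg_y\bigl(f-(f^{(k)})^{l_k}\bigr)<b_0-b_0/l_k$ (where the zero polynomial has degree $-\infty$). Put $\operatorname{jac}(g,h)=\frac{\partial g}{\partial x}\frac{\partial h}{\partial y}-\frac{\partial g}{\partial y}\frac{\partial h}{\partial x}$, and let $(r,s)_0=\dim_{\mathbb C}\mathbb C\{x,y\}/(r,s)$ denote the intersection multiplicity at the origin. Then there are $\Gamma^{(k+1)},\dots,\Gamma^{(g)}\in\mathbb C\{x,y\}$, not necessarily irreducible, such that $$\operatorname{jac}(f^{(k)},f)=\Gamma^{(k+1)}\cdots\Gamma^{(g)},$$ $x$ is coprime to the product $\Gamma^{(k+2)}\cdots\Gamma^{(g)}$ in $\mathbb C\{x,y\}$, and 1. if $\alpha$ is a Newton--Puiseux root of $\Gamma^{(k+1)}$, then $\operatorname{cont}(\alpha,f)<b_{k+1}/b_0$; 2. if $\alpha$ is a Newton--Puiseux root of $\Gamma^{(i)}$ with $k+2\le i\le g$, then $\operatorname{cont}(\alpha,f)=b_i/b_0$; 3. $(\Gamma^{(i)},x)_0=n_1\cdots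 n_{i-1}(n_i-1)$ for $k+2\le i\le g$. -/

import Mathlib

/-! Plane branches over the ring of convergent complex power series: Newton-Puiseux roots, contact,
Puiseux characteristic, approximate roots, jacobian, intersection multiplicity. -/

namespace PlaneBranch

noncomputable section

/-- A formal power series converges if it converges absolutely on some polydisc of radius
`r > 0`. -/
def IsConvergent {σ : Type*} (φ : MvPowerSeries σ ℂ) : Prop :=
  ∃ r : ℝ, 0 < r ∧ Summable fun e : σ →₀ ℕ => ‖MvPowerSeries.coeff e φ‖ * r ^ e.degree

theorem IsConvergent.exists_lt {σ : Type*} {φ : MvPowerSeries σ ℂ} {r s : ℝ} (hs : 0 < s)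
    (hsr : s ≤ r) (h : Summable fun e : σ →₀ ℕ => ‖MvPowerSeries.coeff e φ‖ * r ^ e.degree) :
    Summable fun e : σ →₀ ℕ => ‖MvPowerSeries.coeff e φ‖ * s ^ e.degree := by
  refine h.of_nonneg_of_le (fun e => by positivity) (fun e => ?_)
  gcongr

theorem IsConvergent.monomial {σ : Type*} (d : σ →₀ ℕ) (c : ℂ) :
    IsConvergent (MvPowerSeries.monomial d c) := by
  classical
  refine ⟨1, one_pos, summable_of_ne_finset_zero (s := {d}) fun e he => ?_⟩
  rw [MvPowerSeries.coeff_monomial_ne (by simpa using he)]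
  simp

theorem IsConvergent.add {σ : Type*} {φ ψ : MvPowerSeries σ ℂ} (hφ : IsConvergent φ)
    (hψ : IsConvergent ψ) : IsConvergent (φ + ψ) := by
  obtain ⟨r, hr, h⟩ := hφ
  obtain ⟨s, hs, k⟩ := hψ
  have hm : 0 < min r s := lt_min hr hs
  refine ⟨min r s, hm, ((IsConvergent.exists_lt hm (min_le_left _ _) h).add
    (IsConvergent.exists_lt hm (min_le_right _ _) k)).of_nonneg_of_le
    (fun e => by positivity) (fun e => ?_)⟩
  rw [← add_mul, map_add]
  gcongr
  exact norm_add_le _ _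

theorem summable_antidiagonal {A : Type*} [AddCommMonoid A] [Finset.HasAntidiagonal A]
    {u v : A → ℝ} (hu : Summable u) (hv : Summable v) (hu0 : 0 ≤ u) (hv0 : 0 ≤ v) :
    Summable fun n => ∑ p ∈ Finset.HasAntidiagonal.antidiagonal n, u p.1 * v p.2 :=
  summable_sum_mul_antidiagonal_of_summable_mul (hu.mul_of_nonneg hv hu0 hv0)

theorem IsConvergent.mul {σ : Type*} {φ ψ : MvPowerSeries σ ℂ} (hφ : IsConvergent φ)
    (hψ : IsConvergent ψ) : IsConvergent (φ * ψ) := by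
  classical
  obtain ⟨r, hr, h⟩ := hφ
  obtain ⟨s, hs, k⟩ := hψ
  have hm : 0 < min r s := lt_min hr hs
  have h' := IsConvergent.exists_lt hm (min_le_left _ _) h
  have k' := IsConvergent.exists_lt hm (min_le_right _ _) k
  have hp := summable_antidiagonal h' k' (fun e => mul_nonneg (norm_nonneg _) (pow_nonneg hm.le _))
    (fun e => mul_nonneg (norm_nonneg _) (pow_nonneg hm.le _))
  refine ⟨min r s, hm, hp.of_nonneg_of_le
    (fun e => mul_nonneg (norm_nonneg _) (pow_nonneg hm.le _)) (fun e => ?_)⟩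
  rw [MvPowerSeries.coeff_mul]
  refine (mul_le_mul_of_nonneg_right (norm_sum_le _ _) (pow_nonneg hm.le _)).trans (le_of_eq ?_)
  rw [Finset.sum_mul]
  refine Finset.sum_congr rfl fun p hp => ?_
  rw [← Finset.HasAntidiagonal.mem_antidiagonal.1 hp, map_add, pow_add, norm_mul]
  ring

/-- The ring of convergent complex power series in the variables `σ`. -/
def convergentSeries (σ : Type*) : Subalgebra ℂ (MvPowerSeries σ ℂ) where
  carrier := {φ | IsConvergent φ}
  mul_mem' := IsConvergent.mul
  add_mem' := IsConvergent.add
  algebraMap_mem' c := IsConvergent.monomial 0 c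

/-- `ℂ{x}`. -/
def Cx : Type := convergentSeries Unit

instance : CommRing Cx := inferInstanceAs (CommRing (convergentSeries Unit))

/-- The inclusion of `ℂ{x}` in `ℂ⟦x⟧`; note that `PowerSeries ℂ` is `MvPowerSeries Unit ℂ`. -/
def Cx.incl : Cx →+* PowerSeries ℂ := (convergentSeries Unit).val.toRingHom

/-- `ℂ{x,y}`, with `x` the variable `0` and `y` the variable `1`. -/
def Cxy : Type := convergentSeries (Fin 2)

instance : CommRing Cxy := inferInstanceAs (CommRing (convergentSeries (Fin 2)))

instance : Algebra ℂ Cxy := inferInstanceAs (Algebra ℂ (convergentSeries (Fin 2)))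

/-- The inclusion of `ℂ{x,y}` in `ℂ⟦x,y⟧`. -/
def Cxy.incl : Cxy →ₐ[ℂ] MvPowerSeries (Fin 2) ℂ := (convergentSeries (Fin 2)).val

/-- The element `x` of `ℂ{x,y}`. -/
def xVar : Cxy :=
  (⟨MvPowerSeries.X 0, IsConvergent.monomial _ 1⟩ : convergentSeries (Fin 2))

/-- The series in `x, y` defined by a polynomial in `ℂ{x}[y]`. -/
def toSeries : Polynomial Cx →+* MvPowerSeries (Fin 2) ℂ :=
  Polynomial.eval₂RingHom
    ((MvPowerSeries.rename (R := ℂ) (fun _ : Unit => (0 : Fin 2))).toRingHom.comp Cx.incl)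
    (MvPowerSeries.X 1)

/-- `f ∈ ℂ{x}[y]` is a Weierstrass polynomial: `f = y ^ n + a₁(x) y ^ (n-1) + ⋯ + aₙ(x)` with
`aᵢ(0) = 0`. -/
def IsWeierstrass (f : Polynomial Cx) : Prop :=
  f.Monic ∧ ∀ i < f.natDegree, PowerSeries.constantCoeff (Cx.incl (f.coeff i)) = 0

/-- The order embedding `k ↦ k / m` of `ℕ` in `ℚ`. -/
def divEmb (m : ℕ+) : ℕ ↪o ℚ :=
  OrderEmbedding.ofStrictMono (fun k => (k : ℚ) / (m : ℕ)) fun a b hab => by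
    have hm : (0 : ℚ) < ((m : ℕ) : ℚ) := by exact_mod_cast m.pos
    have hab' : (a : ℚ) < b := by exact_mod_cast hab
    exact div_lt_div_of_pos_right hab' hm

/-- The fractional power series `φ(x ^ (1/m))`, as a Hahn series with rational exponents. -/
def fracSeries (m : ℕ+) (φ : PowerSeries ℂ) : HahnSeries ℚ ℂ :=
  HahnSeries.embDomain (divEmb m) (HahnSeries.toPowerSeries.symm φ)

/-- The set `Zer g` of Newton-Puiseux roots of `g`: the convergent fractional power series
`γ(x) = φ(x ^ (1/m))` of positive order with `g(x, γ(x)) = 0`, that is, `g(t ^ m, φ(t)) = 0`. -/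
def Zer (g : MvPowerSeries (Fin 2) ℂ) : Set (HahnSeries ℚ ℂ) :=
  {γ | ∃ (m : ℕ+) (φ : PowerSeries ℂ), IsConvergent φ ∧ PowerSeries.constantCoeff φ = 0 ∧
    γ = fracSeries m φ ∧
    MvPowerSeries.subst ![(PowerSeries.X : PowerSeries ℂ) ^ (m : ℕ), φ] g = 0}

/-- The contact order `O(δ, δ') = ord_x (δ - δ')`, which is `⊤` when `δ = δ'`. -/
def contactOrder (δ δ' : HahnSeries ℚ ℂ) : WithTop ℚ := (δ - δ').orderTop

/-- `cont(α, f) = c`: the number `c` is the maximum of `O(α, γ)` over the Newton-Puiseux roots `γ`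
of `f`. -/
def IsContact (α : HahnSeries ℚ ℂ) (f : MvPowerSeries (Fin 2) ℂ) (c : WithTop ℚ) : Prop :=
  IsGreatest (contactOrder α '' Zer f) c

/-- `(b 0, …, b g)` is the Puiseux characteristic of the irreducible Weierstrass polynomial `f`:
`b 0` is the degree of `f`, `b 1 < ⋯ < b g`, and the contact orders between different
Newton-Puiseux roots of `f` are the numbers `b 1 / b 0, …, b g / b 0`. (The values `b i` with
`i > g` are irrelevant.) -/
structure IsPuiseuxCharacteristic (f : Polynomial Cx) (g : ℕ) (b : ℕ → ℕ) : Prop where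
  zero : b 0 = f.natDegree
  strictMono : StrictMonoOn b (Set.Icc 1 g)
  contacts : {c : WithTop ℚ | ∃ γ ∈ Zer (toSeries f), ∃ γ' ∈ Zer (toSeries f),
      γ ≠ γ' ∧ c = contactOrder γ γ'} =
    (fun i : ℕ => (((b i : ℚ) / (b 0 : ℚ) : ℚ) : WithTop ℚ)) '' Set.Icc 1 g

/-- `l k = gcd (b 0, …, b k)`. -/
def charGcd (b : ℕ → ℕ) (k : ℕ) : ℕ := (Finset.range (k + 1)).gcd b

/-- `n i = l (i-1) / l i`, for `i ≥ 1`; the division is exact. -/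
def charQuot (b : ℕ → ℕ) (i : ℕ) : ℕ := charGcd b (i - 1) / charGcd b i

/-- `h` is the `p`-th approximate root of the monic polynomial `f` of degree `d`, where `p ∣ d`:
`h` is monic and `deg (f - h ^ p) < d - d / p`. -/
def IsApproximateRoot {A : Type*} [CommRing A] (p : ℕ) (f h : Polynomial A) : Prop :=
  h.Monic ∧ (f - h ^ p).degree < ((f.natDegree - f.natDegree / p : ℕ) : WithBot ℕ)

/-- The jacobian determinant `jac(g, f) = g_x f_y - g_y f_x`. -/
def jac (g f : MvPowerSeries (Fin 2) ℂ) : MvPowerSeries (Fin 2) ℂ :=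
  MvPowerSeries.pderiv ℂ 0 g * MvPowerSeries.pderiv ℂ 1 f -
    MvPowerSeries.pderiv ℂ 1 g * MvPowerSeries.pderiv ℂ 0 f

/-- The intersection multiplicity `(r, s)₀ = dim_ℂ ℂ{x,y} / (r, s)`. -/
def interMult (r s : Cxy) : ℕ∞ :=
  Cardinal.toENat (Module.rank ℂ (Cxy ⧸ Ideal.span {r, s}))

end

end PlaneBranch

/-!
The number of roots of a polynomial `P` over `ℂ((x))` in the ball `{α | h ≤ ord (α - u)}` is the
degree of the initial form of `P(u + x ^ h y)`, and the initial form of a jacobian is the jacobian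
of the initial forms when the latter does not vanish. These counts on the balls around one root `γ`
of `f` determine the contacts of all the roots of the jacobian, since the roots of `f` are the
conjugates of `γ`. The roots with a given contact are stable under conjugation and algebraic, hence
they are the roots of a Weierstrass polynomial over `ℂ{x}`.

Put `h = b (k + 1) / b 0`, `n = n (k + 1)`, and let `u` be `γ` cut off before `x ^ h`. On the ball
of `u` and `h` the initial form of `f` is `c (y ^ n - a ^ n) ^ l (k + 1)` of weight `B`, whereas
that of the minimal polynomial `q` of `u` is a multiple of `y` of weight `B / l k`. Newton's method
for `q ^ l k = f` starts at `q`, ends at the approximate root, and preserves this form, because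
a polynomial of degree less than `m * deg q` has fewer than `m` roots in the ball. As
`n * l (k + 1) = l k`, the terms `y ^ l k` cancel in the jacobian of the two initial forms, which
leaves `(y ^ n - a ^ n) ^ (l (k + 1) - 1)` up to a constant. On the smaller balls around `γ` the
approximate root has a constant initial form, and the initial form of the jacobian is the
derivative of that of `f`, up to a constant.
-/

namespace PlaneBranch

noncomputable section

/-! ## Hahn series -/

section HahnSeries

open HahnSeries

section Order

variable {Γ R : Type*}

theorem coe_le_orderTop_iff [LinearOrder Γ] [Zero R] {x : R⟦Γ⟧} {a : Γ} :
    (a : WithTop Γ) ≤ x.orderTop ↔ ∀ b < a, x.coeff b = 0 := by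
  simp only [le_orderTop_iff_forall, WithTop.coe_lt_coe]

theorem coeff_mul_add_of_le_orderTop [AddCommMonoid Γ] [LinearOrder Γ]
    [IsOrderedCancelAddMonoid Γ] [NonUnitalNonAssocSemiring R] {x y : R⟦Γ⟧} {a b : Γ}
    (hx : (a : WithTop Γ) ≤ x.orderTop) (hy : (b : WithTop Γ) ≤ y.orderTop) :
    (x * y).coeff (a + b) = x.coeff a * y.coeff b := by
  rw [coeff_mul, Finset.sum_eq_single (a, b)]
  · rintro ⟨i, j⟩ hij hne
    obtain ⟨hi, hj, hsum⟩ := Finset.mem_antidiagonal.1 hij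
    have hai : a ≤ i := WithTop.coe_le_coe.1 (hx.trans (orderTop_le_of_coeff_ne_zero hi))
    have hbj : b ≤ j := WithTop.coe_le_coe.1 (hy.trans (orderTop_le_of_coeff_ne_zero hj))
    obtain ⟨rfl, rfl⟩ := (add_eq_add_iff_eq_and_eq hai hbj).1 hsum.symm
    exact absurd rfl hne
  · intro hab
    by_contra h
    exact hab (Finset.mem_antidiagonal.2 ⟨left_ne_zero_of_mul h, right_ne_zero_of_mul h, rfl⟩)

theorem orderTop_sub_comm [LinearOrder Γ] [AddGroup R] (x y : R⟦Γ⟧) :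
    (x - y).orderTop = (y - x).orderTop := by
  rw [← orderTop_neg, neg_sub]

end Order

instance charZero_hahnSeries {Γ R : Type*} [AddCommMonoid Γ] [PartialOrder Γ]
    [IsOrderedCancelAddMonoid Γ] [Semiring R] [CharZero R] : CharZero R⟦Γ⟧ :=
  charZero_of_injective_ringHom (C_injective (Γ := Γ) (R := R))

section Weight

variable {Γ R : Type*}

/-- The series `∑ χ(a) x_a t^a`, for a function `χ` on exponents: an endomorphism of the ring of
Hahn series if `χ` is a character, and a derivation if `χ` is additive. -/
def coeffScale [PartialOrder Γ] [MulZeroClass R] (χ : Γ → R) (x : R⟦Γ⟧) : R⟦Γ⟧ where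
  coeff a := χ a * x.coeff a
  isPWO_support' := x.isPWO_support.mono fun _ h => right_ne_zero_of_mul h

theorem coeff_coeffScale [PartialOrder Γ] [MulZeroClass R] (χ : Γ → R) (x : R⟦Γ⟧) (a : Γ) :
    (coeffScale χ x).coeff a = χ a * x.coeff a := rfl

theorem support_coeffScale_subset [PartialOrder Γ] [MulZeroClass R] (χ : Γ → R) (x : R⟦Γ⟧) :
    (coeffScale χ x).support ⊆ x.support := fun _ h => right_ne_zero_of_mul h

variable [AddCommMonoid Γ] [PartialOrder Γ] [IsOrderedCancelAddMonoid Γ] [CommRing R]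

theorem coeff_mul_of_support_subset {x y : R⟦Γ⟧} {s t : Set Γ} (hs : s.IsPWO) (ht : t.IsPWO)
    (hx : x.support ⊆ s) (hy : y.support ⊆ t) (a : Γ) :
    (x * y).coeff a = ∑ p ∈ Finset.antidiagonal hs ht a, x.coeff p.1 * y.coeff p.2 := by
  rw [coeff_mul]
  refine Finset.sum_subset (fun p hp => ?_) fun p hp hp' => ?_
  · rw [Finset.mem_antidiagonal] at hp ⊢
    exact ⟨hx hp.1, hy hp.2.1, hp.2.2⟩
  · by_contra h
    exact hp' (Finset.mem_antidiagonal.2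
      ⟨left_ne_zero_of_mul h, right_ne_zero_of_mul h, (Finset.mem_antidiagonal.1 hp).2.2⟩)

/-- The ring endomorphism `∑ x_a t^a ↦ ∑ χ(a) x_a t^a` attached to a character `χ` of the monoid
of exponents. -/
def characterTwist (χ : AddChar Γ R) : R⟦Γ⟧ →+* R⟦Γ⟧ where
  toFun := coeffScale χ
  map_zero' := by ext; simp [coeff_coeffScale]
  map_add' x y := by ext; simp [coeff_coeffScale, mul_add]
  map_one' := by
    ext a
    rw [coeff_coeffScale, coeff_one]
    split_ifs with h
    · rw [h, AddChar.map_zero_eq_one, mul_one]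
    · rw [mul_zero]
  map_mul' x y := by
    ext a
    rw [coeff_coeffScale, coeff_mul, coeff_mul_of_support_subset x.isPWO_support y.isPWO_support
      (support_coeffScale_subset _ x) (support_coeffScale_subset _ y), Finset.mul_sum]
    refine Finset.sum_congr rfl fun p hp => ?_
    rw [← (Finset.mem_antidiagonal.1 hp).2.2, AddChar.map_add_eq_mul]
    exact mul_mul_mul_comm _ _ _ _

theorem coeff_characterTwist (χ : AddChar Γ R) (x : R⟦Γ⟧) (a : Γ) :
    (characterTwist χ x).coeff a = χ a * x.coeff a := rfl

/-- The derivation `∑ x_a t^a ↦ ∑ χ(a) x_a t^a` attached to an additive function `χ` of the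
exponents. -/
def weightDerivation (χ : Γ →+ R) : Derivation ℤ R⟦Γ⟧ R⟦Γ⟧ :=
  Derivation.mk'
    (AddMonoidHom.toIntLinearMap
      { toFun := coeffScale χ
        map_zero' := by ext; simp [coeff_coeffScale]
        map_add' := fun x y => by ext; simp [coeff_coeffScale, mul_add] })
    fun x y => by
      ext a
      change χ a * (x * y).coeff a = (x * coeffScale χ y + y * coeffScale χ x).coeff a
      rw [mul_comm y, HahnSeries.coeff_add, coeff_mul,
        coeff_mul_of_support_subset x.isPWO_support y.isPWO_support (subset_refl _)
          (support_coeffScale_subset χ y),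
        coeff_mul_of_support_subset x.isPWO_support y.isPWO_support
          (support_coeffScale_subset χ x) (subset_refl _), Finset.mul_sum,
        ← Finset.sum_add_distrib]
      refine Finset.sum_congr rfl fun p hp => ?_
      rw [← (Finset.mem_antidiagonal.1 hp).2.2, map_add, coeff_coeffScale, coeff_coeffScale]
      ring

theorem coeff_weightDerivation (χ : Γ →+ R) (x : R⟦Γ⟧) (a : Γ) :
    (weightDerivation χ x).coeff a = χ a * x.coeff a := rfl

end Weight

end HahnSeries

/-! ## Puiseux series -/

section PuiseuxSeries

open HahnSeries PowerSeries
open scoped LaurentSeries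

section Embeddings

variable {R : Type*} [Semiring R]

/-- The substitution `∑ aₙ t ^ n ↦ ∑ aₙ x ^ (n / m)` on Laurent series. -/
def laurentEmb (m : ℕ+) : R⸨X⸩ →+* HahnSeries ℚ R :=
  embDomainRingHom
    { toFun := fun n : ℤ => (n : ℚ) / (m : ℕ)
      map_zero' := by simp
      map_add' := fun a b => by push_cast; ring }
    (fun a b h => by
      have hm : ((m : ℕ) : ℚ) ≠ 0 := by positivity
      simpa [div_left_inj' hm] using h)
    fun a b => by
      have hm : (0 : ℚ) < ((m : ℕ) : ℚ) := by positivity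
      simp [div_le_div_iff_of_pos_right hm]

/-- The substitution `φ ↦ φ(x ^ (1/m))` on power series: the ring homomorphism which for complex
coefficients underlies `fracSeries m`. -/
def fracEmb (m : ℕ+) : R⟦X⟧ →+* HahnSeries ℚ R := (laurentEmb m).comp (ofPowerSeries ℤ R)

theorem coeff_laurentEmb_div (m : ℕ+) (x : R⸨X⸩) (n : ℤ) :
    (laurentEmb m x).coeff ((n : ℚ) / (m : ℕ)) = x.coeff n :=
  embDomain_coeff (a := n)

theorem coeff_laurentEmb_of_forall_ne (m : ℕ+) (x : R⸨X⸩) {q : ℚ}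
    (hq : ∀ n : ℤ, (n : ℚ) / (m : ℕ) ≠ q) : (laurentEmb m x).coeff q = 0 :=
  embDomain_of_notMem_range fun ⟨n, hn⟩ => hq n hn

theorem mem_range_laurentEmb {m : ℕ+} {x : HahnSeries ℚ R} :
    x ∈ (laurentEmb m).rangeS ↔ ∀ q, x.coeff q ≠ 0 → ∃ n : ℤ, (n : ℚ) / (m : ℕ) = q := by
  have hm : (0 : ℚ) < ((m : ℕ) : ℚ) := by positivity
  constructor
  · rintro ⟨y, rfl⟩ q hq
    by_contra! h
    exact hq (coeff_laurentEmb_of_forall_ne m y h)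
  · intro h
    have hfloor : Monotone fun q : ℚ => ⌊q * (m : ℕ)⌋ := fun a b hab =>
      Int.floor_mono (mul_le_mul_of_nonneg_right hab hm.le)
    let y : R⸨X⸩ :=
      { coeff := fun n => x.coeff ((n : ℚ) / (m : ℕ))
        isPWO_support' := (x.isPWO_support.image_of_monotone hfloor).mono fun n hn =>
          ⟨_, hn, by simp [div_mul_cancel₀ _ hm.ne']⟩ }
    refine ⟨y, HahnSeries.ext (funext fun q => ?_)⟩
    by_cases hq : ∃ n : ℤ, (n : ℚ) / (m : ℕ) = q
    · obtain ⟨n, rfl⟩ := hq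
      exact coeff_laurentEmb_div m y n
    · rw [coeff_laurentEmb_of_forall_ne m y (not_exists.1 hq)]
      by_contra hne
      exact hq (h q (Ne.symm hne))

theorem coeff_fracEmb_div (m : ℕ+) (φ : R⟦X⟧) (k : ℕ) :
    (fracEmb m φ).coeff ((k : ℚ) / (m : ℕ)) = coeff k φ :=
  (coeff_laurentEmb_div m (ofPowerSeries ℤ R φ) k).trans (ofPowerSeries_apply_coeff φ k)

theorem coeff_fracEmb_of_forall_ne (m : ℕ+) (φ : R⟦X⟧) {q : ℚ}
    (hq : ∀ k : ℕ, (k : ℚ) / (m : ℕ) ≠ q) : (fracEmb m φ).coeff q = 0 := by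
  by_cases h : ∃ n : ℤ, (n : ℚ) / (m : ℕ) = q
  · obtain ⟨n, rfl⟩ := h
    rw [fracEmb, RingHom.comp_apply, coeff_laurentEmb_div, ofPowerSeries_apply]
    exact embDomain_of_notMem_range fun ⟨k, hk⟩ => hq k (by rw [← hk]; rfl)
  · exact coeff_laurentEmb_of_forall_ne m _ (not_exists.1 h)

theorem fracEmb_injective (m : ℕ+) : Function.Injective (fracEmb m : R⟦X⟧ →+* _) := by
  intro φ ψ h
  ext k
  rw [← coeff_fracEmb_div m, h, coeff_fracEmb_div]

theorem coeff_zero_fracEmb (m : ℕ+) (φ : R⟦X⟧) :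
    (fracEmb m φ).coeff 0 = constantCoeff φ := by
  simpa using coeff_fracEmb_div m φ 0

theorem orderTop_fracEmb_nonneg (m : ℕ+) (φ : R⟦X⟧) : 0 ≤ (fracEmb m φ).orderTop := by
  rw [← WithTop.coe_zero, coe_le_orderTop_iff]
  exact fun q hq => coeff_fracEmb_of_forall_ne m φ fun k hk => by
    have : (0 : ℚ) ≤ (k : ℚ) / (m : ℕ) := by positivity
    linarith

theorem orderTop_fracEmb_pos_iff (m : ℕ+) (φ : R⟦X⟧) :
    0 < (fracEmb m φ).orderTop ↔ constantCoeff φ = 0 := by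
  rw [← coeff_zero_fracEmb m]
  refine ⟨fun h => coeff_eq_zero_of_lt_orderTop h, fun h => ?_⟩
  exact (orderTop_fracEmb_nonneg m φ).lt_of_ne fun h0 => coeff_orderTop_ne h0.symm h

theorem exists_fracEmb_eq {m : ℕ+} {x : HahnSeries ℚ R} (hx : x ∈ (laurentEmb m).rangeS)
    (h0 : 0 ≤ x.orderTop) : ∃ φ, fracEmb m φ = x := by
  have hm : (0 : ℚ) < ((m : ℕ) : ℚ) := by positivity
  refine ⟨mk fun k => x.coeff ((k : ℚ) / (m : ℕ)), HahnSeries.ext (funext fun q => ?_)⟩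
  by_cases hq : ∃ k : ℕ, (k : ℚ) / (m : ℕ) = q
  · obtain ⟨k, rfl⟩ := hq
    rw [coeff_fracEmb_div, coeff_mk]
  · rw [coeff_fracEmb_of_forall_ne m _ (not_exists.1 hq)]
    by_contra hne
    obtain ⟨n, rfl⟩ := mem_range_laurentEmb.1 hx q (Ne.symm hne)
    have hn : 0 ≤ (n : ℚ) / (m : ℕ) :=
      WithTop.coe_le_coe.1 (h0.trans (orderTop_le_of_coeff_ne_zero (Ne.symm hne)))
    rw [le_div_iff₀ hm, zero_mul, Int.cast_nonneg_iff] at hn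
    obtain ⟨k, rfl⟩ := Int.eq_ofNat_of_zero_le hn
    exact hq ⟨k, rfl⟩

theorem rangeS_laurentEmb_mono {m n : ℕ+} (h : m ∣ n) :
    (laurentEmb m : R⸨X⸩ →+* _).rangeS ≤ (laurentEmb n).rangeS := by
  intro x hx
  obtain ⟨k, rfl⟩ := h
  rw [mem_range_laurentEmb] at hx ⊢
  intro q hq
  obtain ⟨i, rfl⟩ := hx q hq
  exact ⟨i * k, by push_cast; field_simp⟩

theorem single_mem_rangeS_laurentEmb (q : ℚ) (r : R) :
    single q r ∈ (laurentEmb q.pnatDen).rangeS := by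
  rw [mem_range_laurentEmb]
  intro p hp
  obtain rfl : p = q := by
    by_contra h
    exact hp (coeff_single_of_ne h)
  exact ⟨p.num, by rw [Rat.coe_pnatDen, Rat.num_div_den]⟩

end Embeddings

theorem fracEmb_expand {R : Type*} [CommRing R] (m k : ℕ+) (φ : R⟦X⟧) :
    fracEmb (k * m) (φ.expand k k.ne_zero) = fracEmb m φ := by
  have hdiv (i : ℕ) : ((k * i : ℕ) : ℚ) / ((k * m : ℕ+) : ℕ) = (i : ℚ) / (m : ℕ) := by
    push_cast; field_simp
  ext q
  by_cases hq : ∃ i : ℕ, (i : ℚ) / (m : ℕ) = q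
  · obtain ⟨i, rfl⟩ := hq
    rw [← hdiv, coeff_fracEmb_div, coeff_expand_mul, hdiv, coeff_fracEmb_div]
  rw [coeff_fracEmb_of_forall_ne m φ (not_exists.1 hq)]
  by_cases hq' : ∃ j : ℕ, (j : ℚ) / ((k * m : ℕ+) : ℕ) = q
  · obtain ⟨j, rfl⟩ := hq'
    rw [coeff_fracEmb_div, coeff_expand_of_not_dvd]
    rintro ⟨i, rfl⟩
    exact hq ⟨i, (hdiv i).symm⟩
  · exact coeff_fracEmb_of_forall_ne _ _ (not_exists.1 hq')

theorem fracSeries_eq_fracEmb (m : ℕ+) (φ : ℂ⟦X⟧) : fracSeries m φ = fracEmb m φ := by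
  ext q
  by_cases hq : ∃ k : ℕ, (k : ℚ) / (m : ℕ) = q
  · obtain ⟨k, rfl⟩ := hq
    rw [coeff_fracEmb_div]
    exact (embDomain_coeff (f := divEmb m) (a := k)).trans coeff_toPowerSeries_symm
  · rw [coeff_fracEmb_of_forall_ne m φ (not_exists.1 hq)]
    exact embDomain_of_notMem_range fun ⟨k, hk⟩ => hq ⟨k, hk⟩

section Field

variable (K : Type*) [Field K]

/-- The field of Puiseux series: the Hahn series whose exponents have a common denominator. -/
def puiseuxField : Subfield (HahnSeries ℚ K) := ⨆ m : ℕ+, (laurentEmb m).fieldRange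

variable {K}

theorem mem_puiseuxField {x : HahnSeries ℚ K} :
    x ∈ puiseuxField K ↔ ∃ m : ℕ+, x ∈ (laurentEmb m).rangeS := by
  refine Subfield.mem_iSup_of_directed fun m n => ⟨m * n, ?_, ?_⟩
  · exact rangeS_laurentEmb_mono (dvd_mul_right m n)
  · exact rangeS_laurentEmb_mono (dvd_mul_left n m)

theorem fracEmb_mem_puiseuxField (m : ℕ+) (φ : K⟦X⟧) : fracEmb m φ ∈ puiseuxField K :=
  mem_puiseuxField.2 ⟨m, ofPowerSeries ℤ K φ, rfl⟩

theorem single_mem_puiseuxField (q : ℚ) (c : K) : single q c ∈ puiseuxField K :=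
  mem_puiseuxField.2 ⟨_, single_mem_rangeS_laurentEmb q c⟩

theorem exists_forall_mem_rangeS_laurentEmb {ι : Type*} (s : Finset ι) {x : ι → HahnSeries ℚ K}
    (h : ∀ i ∈ s, x i ∈ puiseuxField K) : ∃ m : ℕ+, ∀ i ∈ s, x i ∈ (laurentEmb m).rangeS := by
  choose! d hd using fun i hi => mem_puiseuxField.1 (h i hi)
  exact ⟨∏ i ∈ s, d i, fun i hi => rangeS_laurentEmb_mono (Finset.dvd_prod_of_mem d hi) (hd i hi)⟩

open Polynomial in
theorem exists_map_fracEmb_eq {P : (HahnSeries ℚ K)[X]} (hP : P.Monic)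
    (hPK : ∀ i, P.coeff i ∈ puiseuxField K) (h0 : ∀ i, 0 ≤ (P.coeff i).orderTop) :
    ∃ (m : ℕ+) (Q : K⟦X⟧[X]), Q.Monic ∧ Q.natDegree = P.natDegree ∧ Q.map (fracEmb m) = P := by
  obtain ⟨m, hm⟩ := exists_forall_mem_rangeS_laurentEmb P.support fun i _ => hPK i
  have hlift : P ∈ lifts (fracEmb m) := (lifts_iff_coeff_lifts P).2 fun i => by
    by_cases hi : i ∈ P.support
    · exact exists_fracEmb_eq (hm i hi) (h0 i)
    · exact ⟨0, by rw [map_zero, notMem_support_iff.1 hi]⟩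
  obtain ⟨Q, hQ, hdeg, hmonic⟩ := lifts_and_natDegree_eq_and_monic hlift hP
  exact ⟨m, Q, hmonic, hdeg, hQ⟩

end Field

end PuiseuxSeries

/-! ## The Newton–Puiseux theorem -/

section NewtonPuiseux

open HahnSeries Polynomial

theorem dvd_of_isWeierstrassFactorization {A : Type*} [CommRing A] [IsLocalRing A]
    [IsAdicComplete (IsLocalRing.maximalIdeal A) A] {P Q : A[X]} {u : PowerSeries A}
    (H : (P : PowerSeries A).IsWeierstrassFactorization Q u) : Q ∣ P := by
  rw [← Ideal.mem_span_singleton, ← Ideal.Quotient.eq_zero_iff_mem,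
    ← map_eq_zero_iff _ H.algEquivQuotient.injective,
    PowerSeries.IsWeierstrassFactorizationAt.algEquivQuotient_apply]
  simp

theorem exists_monic_dvd_of_residue {A : Type*} [CommRing A] [IsLocalRing A]
    [IsAdicComplete (IsLocalRing.maximalIdeal A) A] {P : A[X]}
    (h0 : IsLocalRing.residue A (P.coeff 0) = 0) {i : ℕ} (hi : i < P.natDegree)
    (hne : IsLocalRing.residue A (P.coeff i) ≠ 0) :
    ∃ Q : A[X], Q.Monic ∧ Q ∣ P ∧ 0 < Q.natDegree ∧ Q.natDegree < P.natDegree := by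
  have hcoeff (j : ℕ) : PowerSeries.coeff j ((P : PowerSeries A).map (IsLocalRing.residue A)) =
      IsLocalRing.residue A (P.coeff j) := by
    rw [PowerSeries.coeff_map, Polynomial.coeff_coe]
  have hP : (P : PowerSeries A).map (IsLocalRing.residue A) ≠ 0 := fun h => hne <| by
    rw [← hcoeff, h, map_zero]
  obtain ⟨Q, u, H⟩ := PowerSeries.exists_isWeierstrassFactorization hP
  have hpos : 0 < Q.natDegree := by
    rw [H.natDegree_eq_toNat_order_map, Nat.pos_iff_ne_zero, Ne, ENat.toNat_eq_zero, not_or]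
    refine ⟨?_, PowerSeries.order_eq_top.not.2 hP⟩
    rw [← Ne, PowerSeries.order_ne_zero_iff_constCoeff_eq_zero,
      ← PowerSeries.coeff_zero_eq_constantCoeff_apply, hcoeff, h0]
  have hle : Q.natDegree ≤ i := by
    rw [H.natDegree_eq_toNat_order_map]
    exact ENat.toNat_le_of_le_natCast (PowerSeries.order_le _ (by rwa [hcoeff]))
  exact ⟨Q, H.isDistinguishedAt.monic, dvd_of_isWeierstrassFactorization H, hpos,
    hle.trans_lt hi⟩

theorem monic_taylor {R : Type*} [CommRing R] {P : R[X]} (hP : P.Monic) (s : R) :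
    (taylor s P).Monic := by
  rw [Monic, leadingCoeff_taylor, hP.leadingCoeff]

theorem nextCoeff_taylor {R : Type*} [CommRing R] {P : R[X]} (hn : 0 < P.natDegree) (s : R) :
    (taylor s P).nextCoeff = P.nextCoeff + P.natDegree * P.leadingCoeff * s := by
  obtain ⟨n, hn'⟩ := Nat.exists_eq_add_one.2 hn
  rw [nextCoeff_of_natDegree_pos (by rwa [natDegree_taylor]), nextCoeff_of_natDegree_pos hn,
    natDegree_taylor, taylor_coeff, Polynomial.leadingCoeff, hn', Nat.add_sub_cancel,
    eval_eq_sum_range' (n := 2) (by have := natDegree_hasseDeriv_le P n; omega)]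
  simp [Finset.sum_range_succ, hasseDeriv_coeff, add_comm 1 n]

theorem dvd_taylor_iff {R : Type*} [CommRing R] {P Q : R[X]} {s : R} :
    Q ∣ taylor s P ↔ taylor (-s) Q ∣ P := by
  rw [← map_dvd_iff (taylorEquiv (-s))]
  change taylor (-s) Q ∣ taylor (-s) (taylor s P) ↔ _
  rw [taylor_taylor, neg_add_cancel, taylor_zero]

section Field

variable {K : Type*} [Field K]

theorem residue_eq_zero_iff_constantCoeff (a : PowerSeries K) :
    IsLocalRing.residue (PowerSeries K) a = 0 ↔ PowerSeries.constantCoeff a = 0 := by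
  rw [IsLocalRing.residue_eq_zero_iff, PowerSeries.maximalIdeal_eq_span_X,
    Ideal.mem_span_singleton, PowerSeries.X_dvd_iff]

instance isAdicComplete_maximalIdeal_powerSeries :
    IsAdicComplete (IsLocalRing.maximalIdeal (PowerSeries K)) (PowerSeries K) := by
  rw [PowerSeries.maximalIdeal_eq_span_X]
  infer_instance

theorem exists_monic_dvd_of_constantCoeff [IsAlgClosed K] [CharZero K] {P : (PowerSeries K)[X]}
    (hP : P.Monic) (hnext : PowerSeries.constantCoeff P.nextCoeff = 0) {i : ℕ}
    (hi : i < P.natDegree) (hne : PowerSeries.constantCoeff (P.coeff i) ≠ 0) :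
    ∃ Q : (PowerSeries K)[X], Q.Monic ∧ Q ∣ P ∧ 0 < Q.natDegree ∧ Q.natDegree < P.natDegree := by
  have hn : 0 < P.natDegree := i.zero_le.trans_lt hi
  set p : K[X] := P.map PowerSeries.constantCoeff with hp
  have hpm : p.Monic := hP.map _
  have hpd : p.natDegree = P.natDegree := hP.natDegree_map _
  have hpnext : p.nextCoeff = 0 := by
    rw [nextCoeff_of_natDegree_pos (hpd ▸ hn), hpd, hp, coeff_map,
      ← nextCoeff_of_natDegree_pos hn, hnext]
  obtain ⟨c, hc⟩ := IsAlgClosed.exists_root p (degree_ne_of_natDegree_ne (n := 0) (by omega))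
  have hcoeff (j : ℕ) : PowerSeries.constantCoeff ((taylor (PowerSeries.C c) P).coeff j) =
      (taylor c p).coeff j := by
    rw [← coeff_map, map_taylor, PowerSeries.constantCoeff_C]
  obtain ⟨j, hj, hjne⟩ : ∃ j < P.natDegree, (taylor c p).coeff j ≠ 0 := by
    by_contra! hpure
    -- `p = (y - c) ^ n` would force `c = 0`, since the subleading coefficient vanishes.
    have hnc := nextCoeff_taylor (hpd ▸ hn) c
    rw [nextCoeff_of_natDegree_pos (by rwa [natDegree_taylor, hpd]), natDegree_taylor, hpd,
      hpure _ (by omega), hpnext, hpm.leadingCoeff, zero_add, mul_one, eq_comm, mul_eq_zero,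
      Nat.cast_eq_zero] at hnc
    have hci := hpure i hi
    rw [hnc.resolve_left hn.ne', taylor_zero, hp, coeff_map] at hci
    exact hne hci
  obtain ⟨Q, hQm, hQ, hQ0, hQlt⟩ :=
    exists_monic_dvd_of_residue (P := taylor (PowerSeries.C c) P) (i := j)
      (by rw [residue_eq_zero_iff_constantCoeff, hcoeff, taylor_coeff_zero]; exact hc)
      (by rwa [natDegree_taylor])
      (by rwa [Ne, residue_eq_zero_iff_constantCoeff, hcoeff])
  refine ⟨_, monic_taylor hQm _, dvd_taylor_iff.1 hQ, ?_, ?_⟩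
  · rwa [natDegree_taylor]
  · rwa [natDegree_taylor] at hQlt ⊢

theorem coeff_scaleRoots_single (P : (HahnSeries ℚ K)[X]) (q : ℚ) (i : ℕ) :
    (P.scaleRoots (single q 1)).coeff i = single ((P.natDegree - i : ℕ) * q) 1 * P.coeff i := by
  rw [coeff_scaleRoots, single_pow, one_pow, nsmul_eq_mul, mul_comm]

/-- Scaling by the steepest slope `q` of the Newton polygon. -/
theorem exists_scaleRoots_orderTop_nonneg {P : (HahnSeries ℚ K)[X]} (hP : P.Monic)
    (hex : ∃ i < P.natDegree, P.coeff i ≠ 0) :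
    ∃ q : ℚ, (∀ i, 0 ≤ ((P.scaleRoots (single q 1)).coeff i).orderTop) ∧
      ∃ i < P.natDegree, ((P.scaleRoots (single q 1)).coeff i).coeff 0 ≠ 0 := by
  classical
  set n := P.natDegree with hn
  obtain ⟨i₀, hi₀, hmin⟩ := ((Finset.range n).filter (P.coeff · ≠ 0)).exists_min_image
    (fun i => (P.coeff i).order / ((n - i : ℕ) : ℚ))
    (by obtain ⟨i, hi, hne⟩ := hex; exact ⟨i, by simp [hi, hne]⟩)
  obtain ⟨hi₀n, hi₀ne⟩ : i₀ < n ∧ P.coeff i₀ ≠ 0 := by simpa using hi₀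
  set h : ℚ := (P.coeff i₀).order / ((n - i₀ : ℕ) : ℚ)
  have hslope : ((n - i₀ : ℕ) : ℚ) * h = (P.coeff i₀).order :=
    mul_div_cancel₀ _ (Nat.cast_ne_zero.2 (by omega))
  refine ⟨-h, fun i => ?_, i₀, hi₀n, ?_⟩
  · by_cases hi : P.coeff i = 0
    · simp [hi]
    rw [coeff_scaleRoots_single, orderTop_mul, orderTop_single one_ne_zero,
      ← order_eq_orderTop_of_ne_zero hi]
    norm_cast
    rcases (le_natDegree_of_ne_zero hi).lt_or_eq with hin | rfl
    · have := hmin i (by simp [hn, hin, hi])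
      rw [le_div_iff₀ (by exact_mod_cast (by omega : 0 < n - i))] at this
      linarith
    · simp [hP.coeff_natDegree]
  · rw [coeff_scaleRoots_single, ← hn, mul_neg, hslope, coeff_single_mul, one_mul, zero_sub,
      neg_neg]
    exact coeff_order_eq_zero.not.2 hi₀ne

theorem exists_monic_dvd_scaleRoots [IsAlgClosed K] [CharZero K] {p : (puiseuxField K)[X]}
    (hp : p.Monic) (hnext : p.nextCoeff = 0) (hex : ∃ i < p.natDegree, p.coeff i ≠ 0) :
    ∃ s : puiseuxField K, s ≠ 0 ∧ ∃ r : (puiseuxField K)[X], r ∣ p.scaleRoots s ∧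
      r.Monic ∧ 0 < r.natDegree ∧ r.natDegree < p.natDegree := by
  set ι := (puiseuxField K).subtype
  have hdeg : (p.map ι).natDegree = p.natDegree := hp.natDegree_map ι
  obtain ⟨q, horder, i, hi, hne⟩ := exists_scaleRoots_orderTop_nonneg (hp.map ι) (by
    rw [hdeg]
    simpa [coeff_map] using hex)
  have hscale : (p.scaleRoots ⟨single q 1, single_mem_puiseuxField q 1⟩).map ι =
      (p.map ι).scaleRoots (single q 1) :=
    map_scaleRoots _ _ _ (by rw [hp.leadingCoeff, map_one]; exact one_ne_zero)
  obtain ⟨m, Q, hQm, hQd, hQ⟩ := exists_map_fracEmb_eq ((monic_scaleRoots_iff _).2 (hp.map ι))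
    (fun j => by rw [← hscale, coeff_map]; exact SetLike.coe_mem _) horder
  rw [natDegree_scaleRoots, hdeg] at hQd
  have hcoeff (j : ℕ) : PowerSeries.constantCoeff (Q.coeff j) =
      (((p.map ι).scaleRoots (single q 1)).coeff j).coeff 0 := by
    rw [← hQ, coeff_map, coeff_zero_fracEmb]
  have hn : 0 < p.natDegree := by omega
  obtain ⟨F, hFm, hF, hF0, hFlt⟩ := exists_monic_dvd_of_constantCoeff hQm
    (by
      rw [nextCoeff_of_natDegree_pos (by omega), hcoeff, coeff_scaleRoots, hQd, coeff_map,
        ← nextCoeff_of_natDegree_pos hn, hnext, map_zero, zero_mul, HahnSeries.coeff_zero])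
    (i := i) (by omega) (by rwa [hcoeff])
  set j : PowerSeries K →+* puiseuxField K :=
    (fracEmb m).codRestrict (puiseuxField K) (fracEmb_mem_puiseuxField m)
  have hQj : Q.map j = p.scaleRoots ⟨single q 1, single_mem_puiseuxField q 1⟩ :=
    map_injective ι ι.injective (by rw [hscale, ← hQ, Polynomial.map_map]; rfl)
  refine ⟨⟨single q 1, single_mem_puiseuxField q 1⟩, ?_, F.map j, ?_, hFm.map j, ?_, ?_⟩
  · exact fun h => single_ne_zero one_ne_zero (congrArg ι h)
  · exact hQj ▸ Polynomial.map_dvd j hF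
  · rwa [hFm.natDegree_map]
  · rwa [hFm.natDegree_map, ← hQd]

theorem isRoot_inv_mul_of_isRoot_scaleRoots {L : Type*} [Field L] {p : L[X]} {s β : L}
    (hs : s ≠ 0) (h : (p.scaleRoots s).IsRoot β) : p.IsRoot (s⁻¹ * β) := by
  have := scaleRoots_eval_mul p (s⁻¹ * β) s
  rw [mul_inv_cancel_left₀ hs, h.eq_zero, eq_comm, mul_eq_zero] at this
  exact this.resolve_left (pow_ne_zero _ hs)

theorem exists_isRoot_of_monic [IsAlgClosed K] [CharZero K] (n : ℕ) {p : (puiseuxField K)[X]}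
    (hp : p.Monic) (hdeg : p.natDegree = n) (hn : 0 < n) : ∃ α, p.IsRoot α := by
  induction n using Nat.strong_induction_on generalizing p with
  | _ n ih =>
  set s := -(p.nextCoeff / n) with hs
  have hn' : (n : puiseuxField K) ≠ 0 := Nat.cast_ne_zero.2 hn.ne'
  have hnext : (taylor s p).nextCoeff = 0 := by
    rw [nextCoeff_taylor (by omega), hp.leadingCoeff, hdeg, mul_one, hs, mul_neg,
      mul_div_cancel₀ _ hn', add_neg_cancel]
  suffices h : ∃ α, (taylor s p).IsRoot α by
    obtain ⟨α, hα⟩ := h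
    exact ⟨α + s, by rwa [IsRoot, taylor_eval] at hα⟩
  by_cases hex : ∃ i < n, (taylor s p).coeff i ≠ 0
  · rw [← hdeg, ← natDegree_taylor p s] at hex
    obtain ⟨t, ht, r, hr, hrm, hr0, hrlt⟩ :=
      exists_monic_dvd_scaleRoots (monic_taylor hp s) hnext hex
    rw [natDegree_taylor, hdeg] at hrlt
    obtain ⟨β, hβ⟩ := ih _ hrlt hrm rfl hr0
    exact ⟨_, isRoot_inv_mul_of_isRoot_scaleRoots ht (hβ.dvd hr)⟩
  · push Not at hex
    exact ⟨0, by rw [IsRoot, ← coeff_zero_eq_eval_zero, hex 0 hn]⟩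

instance isAlgClosed_puiseuxField [IsAlgClosed K] [CharZero K] : IsAlgClosed (puiseuxField K) :=
  .of_exists_root _ fun _ hp hirr => exists_isRoot_of_monic _ hp rfl hirr.natDegree_pos

theorem splits_of_coeff_mem_puiseuxField [IsAlgClosed K] [CharZero K] {P : (HahnSeries ℚ K)[X]}
    (h : ∀ i, P.coeff i ∈ puiseuxField K) : P.Splits ∧ ∀ α ∈ P.roots, α ∈ puiseuxField K := by
  obtain ⟨p, rfl⟩ : P ∈ lifts (puiseuxField K).subtype :=
    (lifts_iff_coeff_lifts P).2 fun i => ⟨⟨_, h i⟩, rfl⟩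
  have hp : p.Splits := IsAlgClosed.splits p
  rw [coe_mapRingHom, hp.roots_map]
  refine ⟨hp.map _, fun α hα => ?_⟩
  obtain ⟨β, -, rfl⟩ := Multiset.mem_map.1 hα
  exact β.2

end Field

end NewtonPuiseux

/-! ## Monodromy and the Euler derivation -/

section Monodromy

open HahnSeries PowerSeries

/-- The character `q ↦ exp (2πi q)` of the group of exponents of Puiseux series. -/
def expTwoPiI : AddChar ℚ ℂ where
  toFun q := Complex.exp (2 * Real.pi * Complex.I * q)
  map_zero_eq_one' := by simp
  map_add_eq_mul' p q := by rw [← Complex.exp_add, Rat.cast_add, mul_add]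

theorem expTwoPiI_ne_zero (q : ℚ) : expTwoPiI q ≠ 0 := Complex.exp_ne_zero _

theorem expTwoPiI_eq_one_iff {q : ℚ} : expTwoPiI q = 1 ↔ ∃ n : ℤ, (n : ℚ) = q := by
  refine Complex.exp_eq_one_iff.trans (exists_congr fun n => ?_)
  rw [mul_comm (2 * Real.pi * Complex.I : ℂ), mul_left_inj' Complex.two_pi_I_ne_zero]
  exact ⟨fun h => by exact_mod_cast h.symm, fun h => by exact_mod_cast h.symm⟩

/-- The monodromy `x^q ↦ exp (2πi j q) x^q`, which continues a series `j` times around `x = 0`. -/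
def monodromy (j : ℤ) : HahnSeries ℚ ℂ →+* HahnSeries ℚ ℂ := characterTwist (expTwoPiI.mulShift j)

theorem coeff_monodromy (j : ℤ) (a : HahnSeries ℚ ℂ) (q : ℚ) :
    (monodromy j a).coeff q = expTwoPiI (j * q) * a.coeff q := coeff_characterTwist _ _ _

theorem monodromy_add (i j : ℤ) (a : HahnSeries ℚ ℂ) :
    monodromy (i + j) a = monodromy i (monodromy j a) := by
  ext q
  rw [coeff_monodromy, coeff_monodromy, coeff_monodromy, Int.cast_add, add_mul,
    AddChar.map_add_eq_mul, mul_assoc]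

theorem monodromy_zero (a : HahnSeries ℚ ℂ) : monodromy 0 a = a := by
  ext q
  rw [coeff_monodromy, Int.cast_zero, zero_mul, AddChar.map_zero_eq_one, one_mul]

theorem orderTop_monodromy (j : ℤ) (a : HahnSeries ℚ ℂ) :
    (monodromy j a).orderTop = a.orderTop := by
  refine eq_of_forall_le_iff fun c => ?_
  simp only [le_orderTop_iff_forall, coeff_monodromy, mul_eq_zero, expTwoPiI_ne_zero, false_or]

theorem monodromy_eq_self_iff {j : ℤ} {a : HahnSeries ℚ ℂ} :
    monodromy j a = a ↔ ∀ q, a.coeff q ≠ 0 → ∃ n : ℤ, (n : ℚ) = j * q := by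
  simp only [← expTwoPiI_eq_one_iff, HahnSeries.ext_iff, funext_iff, coeff_monodromy]
  refine forall_congr' fun q => ?_
  rw [mul_left_eq_self₀, or_comm, or_iff_not_imp_left]

theorem monodromy_mul_eq_self {m : ℤ} {a : HahnSeries ℚ ℂ} (h : monodromy m a = a) (k : ℤ) :
    monodromy (m * k) a = a := by
  rw [monodromy_eq_self_iff] at h ⊢
  intro q hq
  obtain ⟨n, hn⟩ := h q hq
  exact ⟨n * k, by push_cast; rw [hn]; ring⟩

theorem monodromy_eq_self_iff_mem_rangeS {m : ℕ+} {a : HahnSeries ℚ ℂ} :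
    monodromy (m : ℕ) a = a ↔ a ∈ (laurentEmb m).rangeS := by
  have hm : ((m : ℕ) : ℚ) ≠ 0 := by positivity
  rw [monodromy_eq_self_iff, mem_range_laurentEmb]
  refine forall₂_congr fun q _ => exists_congr fun n => ?_
  rw [div_eq_iff hm, Int.cast_natCast, mul_comm]

theorem monodromy_fracEmb (m : ℕ+) (φ : ℂ⟦X⟧) : monodromy (m : ℕ) (fracEmb m φ) = fracEmb m φ :=
  monodromy_eq_self_iff_mem_rangeS.2 ⟨_, rfl⟩

theorem monodromy_fracEmb_one (j : ℤ) (φ : ℂ⟦X⟧) : monodromy j (fracEmb 1 φ) = fracEmb 1 φ := by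
  simpa only [PNat.one_coe, Nat.cast_one, one_mul] using
    monodromy_mul_eq_self (monodromy_fracEmb 1 φ) j

/-- The Euler derivation `x d/dx`. The instance is given explicitly, as instance search would find
`HahnSeries.powerSeriesAlgebra`. -/
def euler :
    letI : Algebra ℤ (HahnSeries ℚ ℂ) := Ring.toIntAlgebra _
    Derivation ℤ (HahnSeries ℚ ℂ) (HahnSeries ℚ ℂ) :=
  weightDerivation (Rat.castHom ℂ : ℚ →+ ℂ)

theorem coeff_euler (a : HahnSeries ℚ ℂ) (q : ℚ) : (euler a).coeff q = q * a.coeff q :=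
  coeff_weightDerivation _ _ _

end Monodromy

/-! ## Convergence of algebraic power series -/

section PartialNorm

open PowerSeries

variable {R : Type*} [NormedRing R]

/-- The partial sums of `∑ ‖aₙ‖ r^n`, which are submultiplicative in the series `∑ aₙ x^n`. -/
def partialNorm (r : ℝ) (M : ℕ) (φ : R⟦X⟧) : ℝ :=
  ∑ n ∈ Finset.range (M + 1), ‖coeff n φ‖ * r ^ n

theorem partialNorm_nonneg {r : ℝ} (hr : 0 ≤ r) (M : ℕ) (φ : R⟦X⟧) : 0 ≤ partialNorm r M φ :=
  Finset.sum_nonneg fun n _ => by positivity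

theorem partialNorm_mono {r s : ℝ} (hr : 0 ≤ r) (hrs : r ≤ s) (M : ℕ) (φ : R⟦X⟧) :
    partialNorm r M φ ≤ partialNorm s M φ :=
  Finset.sum_le_sum fun n _ => by gcongr

theorem norm_coeff_mul_pow_le_partialNorm {r : ℝ} (hr : 0 ≤ r) (n : ℕ) (φ : R⟦X⟧) :
    ‖coeff n φ‖ * r ^ n ≤ partialNorm r n φ :=
  Finset.single_le_sum (f := fun n => ‖coeff n φ‖ * r ^ n) (fun i _ => by positivity)
    (Finset.self_mem_range_succ n)

theorem partialNorm_add_le {r : ℝ} (hr : 0 ≤ r) (M : ℕ) (φ ψ : R⟦X⟧) :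
    partialNorm r M (φ + ψ) ≤ partialNorm r M φ + partialNorm r M ψ := by
  rw [partialNorm, partialNorm, partialNorm, ← Finset.sum_add_distrib]
  refine Finset.sum_le_sum fun n _ => ?_
  rw [← add_mul, map_add]
  gcongr
  exact norm_add_le _ _

theorem partialNorm_sum_le {r : ℝ} (hr : 0 ≤ r) (M : ℕ) {ι : Type*} (s : Finset ι)
    (φ : ι → R⟦X⟧) : partialNorm r M (∑ i ∈ s, φ i) ≤ ∑ i ∈ s, partialNorm r M (φ i) :=
  Finset.le_sum_of_subadditive (partialNorm r M) (by simp [partialNorm])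
    (partialNorm_add_le hr M) s φ

theorem norm_coeff_mul_le {r : ℝ} (hr : 0 ≤ r) (n : ℕ) (φ ψ : R⟦X⟧) :
    ‖coeff n (φ * ψ)‖ * r ^ n ≤ ∑ p ∈ Finset.HasAntidiagonal.antidiagonal n,
      (‖coeff p.1 φ‖ * r ^ p.1) * (‖coeff p.2 ψ‖ * r ^ p.2) := by
  rw [coeff_mul]
  refine (mul_le_mul_of_nonneg_right (norm_sum_le _ _) (by positivity)).trans ?_
  rw [Finset.sum_mul]
  refine Finset.sum_le_sum fun p hp => ?_
  rw [← Finset.HasAntidiagonal.mem_antidiagonal.1 hp, pow_add, mul_mul_mul_comm]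
  gcongr
  exact norm_mul_le _ _

theorem partialNorm_mul_le {r : ℝ} (hr : 0 ≤ r) (M : ℕ) (φ ψ : R⟦X⟧) :
    partialNorm r M (φ * ψ) ≤ partialNorm r M φ * partialNorm r M ψ := by
  rw [partialNorm, partialNorm, partialNorm, Finset.sum_mul_sum, ← Finset.sum_product']
  refine (Finset.sum_le_sum fun n _ => norm_coeff_mul_le hr n φ ψ).trans ?_
  rw [← Finset.sum_fiberwise_of_maps_to (s := _ ×ˢ _) (t := Finset.range (2 * M + 1))
    (g := fun p : ℕ × ℕ => p.1 + p.2) (fun p hp => by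
      simp only [Finset.mem_product, Finset.mem_range] at hp ⊢; omega)]
  refine (Finset.sum_le_sum fun n hn => ?_).trans (Finset.sum_le_sum_of_subset_of_nonneg
    (Finset.range_mono (by omega)) fun n _ _ => Finset.sum_nonneg fun p _ => by positivity)
  refine Finset.sum_le_sum_of_subset_of_nonneg (fun p hp => ?_) fun p _ _ => by positivity
  simp only [Finset.HasAntidiagonal.mem_antidiagonal, Finset.mem_filter, Finset.mem_product,
    Finset.mem_range] at hp hn ⊢
  omega

theorem partialNorm_pow_le [NormOneClass R] {r : ℝ} (hr : 0 ≤ r) (M : ℕ) (φ : R⟦X⟧) (i : ℕ) :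
    partialNorm r M (φ ^ i) ≤ partialNorm r M φ ^ i := by
  induction i with
  | zero => simp [partialNorm, coeff_one, Finset.sum_range_succ']
  | succ i ih =>
    rw [pow_succ, pow_succ]
    exact (partialNorm_mul_le hr M _ _).trans
      (mul_le_mul_of_nonneg_right ih (partialNorm_nonneg hr M φ))

theorem partialNorm_X_mul (r : ℝ) (M : ℕ) (φ : R⟦X⟧) :
    partialNorm r (M + 1) (X * φ) = r * partialNorm r M φ := by
  rw [partialNorm, Finset.sum_range_succ', partialNorm, Finset.mul_sum]
  simp only [coeff_succ_X_mul, coeff_zero_X_mul, norm_zero, zero_mul, add_zero]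
  exact Finset.sum_congr rfl fun n _ => by ring

theorem partialNorm_eval₂_le [NormOneClass R] {S : Type*} [Semiring S] (i : S →+* R⟦X⟧)
    (T : Polynomial S) {r K L : ℝ} (hr : 0 ≤ r) (hK : 0 ≤ K) {M : ℕ} {φ : R⟦X⟧}
    (hT : ∀ j ∈ Finset.range (T.natDegree + 1), partialNorm r M (i (T.coeff j)) ≤ K)
    (hφ : partialNorm r M φ ≤ L) :
    partialNorm r M (T.eval₂ i φ) ≤ ∑ j ∈ Finset.range (T.natDegree + 1), K * L ^ j := by
  rw [Polynomial.eval₂_eq_sum_range]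
  refine (partialNorm_sum_le hr M _ _).trans (Finset.sum_le_sum fun j hj => ?_)
  exact (partialNorm_mul_le hr M _ _).trans (mul_le_mul (hT j hj)
    ((partialNorm_pow_le hr M _ _).trans (pow_le_pow_left₀ (partialNorm_nonneg hr M φ) hφ j))
    (partialNorm_nonneg hr M _) hK)

theorem partialNorm_le_of_eq_add_X_mul {α β χ : R⟦X⟧} {r K D : ℝ} (hr : 0 ≤ r)
    (h : χ = α + X * β) (hα : ∀ M, partialNorm r M α ≤ K)
    (hβ : ∀ M, partialNorm r M χ ≤ K + 1 → partialNorm r M β ≤ D) (hrD : r * D ≤ 1) (M : ℕ) :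
    partialNorm r M χ ≤ K + 1 := by
  induction M with
  | zero =>
    have h0 : partialNorm r 0 χ = partialNorm r 0 α := by simp [partialNorm, h]
    exact h0.trans_le ((hα 0).trans (le_add_of_nonneg_right zero_le_one))
  | succ M ih =>
    rw [h]
    refine (partialNorm_add_le hr _ _ _).trans (add_le_add (hα _) ?_)
    rw [partialNorm_X_mul]
    exact (mul_le_mul_of_nonneg_left (hβ M ih) hr).trans hrD

end PartialNorm

section Convergence

open PowerSeries

theorem isConvergent_iff_summable {φ : ℂ⟦X⟧} :
    IsConvergent φ ↔ ∃ r : ℝ, 0 < r ∧ Summable fun n : ℕ => ‖coeff n φ‖ * r ^ n := by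
  refine exists_congr fun r => and_congr_right fun _ => ?_
  let e : ℕ ≃ (Unit →₀ ℕ) :=
    { toFun := fun n => Finsupp.single () n
      invFun := fun v => v ()
      left_inv := fun n => by simp
      right_inv := fun v => by ext; simp }
  rw [← e.summable_iff]
  refine iff_of_eq (congrArg Summable (funext fun n => ?_))
  simp [e, coeff, Finsupp.degree_single]

theorem isConvergent_iff_bounded {φ : ℂ⟦X⟧} :
    IsConvergent φ ↔ ∃ r : ℝ, 0 < r ∧ ∃ K : ℝ, ∀ n : ℕ, ‖coeff n φ‖ * r ^ n ≤ K := by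
  rw [isConvergent_iff_summable]
  constructor
  · rintro ⟨r, hr, h⟩
    exact ⟨r, hr, _, fun n => h.le_tsum n fun j _ => by positivity⟩
  · rintro ⟨r, hr, K, hK⟩
    refine ⟨r / 2, by positivity, Summable.of_nonneg_of_le (fun n => by positivity) (fun n => ?_)
      (summable_geometric_two.mul_left K)⟩
    rw [div_pow, one_div, inv_pow, mul_div_assoc', div_eq_mul_inv]
    exact mul_le_mul_of_nonneg_right (hK n) (by positivity)

theorem isConvergent_coe (p : Polynomial ℂ) : IsConvergent (p : ℂ⟦X⟧) := by
  refine isConvergent_iff_summable.2 ⟨1, one_pos, summable_of_ne_finset_zero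
    (s := Finset.range (p.natDegree + 1)) fun n hn => ?_⟩
  rw [Polynomial.coeff_coe, Polynomial.coeff_eq_zero_of_natDegree_lt
    (by simpa only [Finset.mem_range, not_lt, Nat.succ_le_iff] using hn), norm_zero, zero_mul]

theorem isConvergent_X_pow (k : ℕ) : IsConvergent (X ^ k : ℂ⟦X⟧) := by
  simpa using isConvergent_coe (Polynomial.X ^ k)

theorem IsConvergent.of_X_pow_mul {k : ℕ} {φ : ℂ⟦X⟧} (h : IsConvergent (X ^ k * φ)) :
    IsConvergent φ := by
  rw [isConvergent_iff_bounded] at h ⊢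
  obtain ⟨r, hr, K, hK⟩ := h
  refine ⟨r, hr, K / r ^ k, fun n => ?_⟩
  rw [le_div_iff₀ (by positivity), mul_assoc, ← pow_add]
  simpa only [coeff_X_pow_mul] using hK (n + k)

theorem IsConvergent.derivative {φ : ℂ⟦X⟧} (h : IsConvergent φ) :
    IsConvergent (PowerSeries.derivative ℂ φ) := by
  rw [isConvergent_iff_bounded] at h ⊢
  obtain ⟨r, hr, K, hK⟩ := h
  refine ⟨r / 2, by positivity, K / r, fun n => ?_⟩
  have hn : ((n + 1 : ℕ) : ℝ) / 2 ^ n ≤ 1 := by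
    rw [div_le_one (by positivity)]
    exact_mod_cast Nat.lt_two_pow_self (n := n)
  rw [coeff_derivative, norm_mul, le_div_iff₀ hr, div_pow, ← Nat.cast_succ, Complex.norm_natCast]
  calc _ = (‖coeff (n + 1) φ‖ * r ^ (n + 1)) * (((n + 1 : ℕ) : ℝ) / 2 ^ n) := by
        rw [pow_succ]; ring
    _ ≤ ‖coeff (n + 1) φ‖ * r ^ (n + 1) := mul_le_of_le_one_right (by positivity) hn
    _ ≤ K := hK (n + 1)

theorem isConvergent_expand_iff {k : ℕ} (hk : k ≠ 0) {φ : ℂ⟦X⟧} :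
    IsConvergent (φ.expand k hk) ↔ IsConvergent φ := by
  rw [isConvergent_iff_bounded, isConvergent_iff_bounded]
  constructor
  · rintro ⟨r, hr, K, hK⟩
    refine ⟨r ^ k, by positivity, K, fun n => ?_⟩
    simpa only [coeff_expand_mul, pow_mul] using hK (k * n)
  · rintro ⟨r, hr, K, hK⟩
    have hm : 0 < min r 1 := lt_min hr one_pos
    refine ⟨min r 1, hm, K, fun n => ?_⟩
    by_cases hn : k ∣ n
    · obtain ⟨j, rfl⟩ := hn
      rw [coeff_expand_mul]
      refine le_trans ?_ (hK j)
      gcongr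
      calc (min r 1) ^ (k * j) ≤ (min r 1) ^ j :=
            pow_le_pow_of_le_one hm.le (min_le_right _ _)
              (Nat.le_mul_of_pos_left j (Nat.pos_of_ne_zero hk))
        _ ≤ r ^ j := pow_le_pow_left₀ hm.le (min_le_left _ _) j
    · rw [coeff_expand_of_not_dvd _ _ _ hn, norm_zero, zero_mul]
      exact le_trans (by positivity) (hK 0)

theorem IsConvergent.exists_partialNorm_le {φ : ℂ⟦X⟧} (h : IsConvergent φ) :
    ∃ r : ℝ, 0 < r ∧ ∃ K : ℝ, ∀ M, partialNorm r M φ ≤ K := by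
  obtain ⟨r, hr, h⟩ := isConvergent_iff_summable.1 h
  exact ⟨r, hr, _, fun M => h.sum_le_tsum _ fun n _ => by positivity⟩

theorem exists_forall_partialNorm_le {ι : Type*} (s : Finset ι) {φ : ι → ℂ⟦X⟧}
    (h : ∀ i ∈ s, IsConvergent (φ i)) :
    ∃ r : ℝ, 0 < r ∧ ∃ K : ℝ, 0 ≤ K ∧ ∀ i ∈ s, ∀ M, partialNorm r M (φ i) ≤ K := by
  classical
  induction s using Finset.induction_on with
  | empty => exact ⟨1, one_pos, 0, le_rfl, by simp⟩
  | insert a s ha ih =>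
    obtain ⟨r, hr, K, hK0, hK⟩ := ih fun i hi => h i (Finset.mem_insert_of_mem hi)
    obtain ⟨r', hr', K', hK'⟩ := (h a (Finset.mem_insert_self _ _)).exists_partialNorm_le
    have hm : 0 < min r r' := lt_min hr hr'
    refine ⟨min r r', hm, max K K', le_max_of_le_left hK0, fun i hi M => ?_⟩
    rcases Finset.mem_insert.1 hi with rfl | hi
    · exact ((partialNorm_mono hm.le (min_le_right _ _) M _).trans (hK' M)).trans (le_max_right _ _)
    · exact ((partialNorm_mono hm.le (min_le_left _ _) M _).trans (hK i hi M)).trans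
        (le_max_left _ _)

/-- A convergent series, as an element of `ℂ{x}`. -/
def Cx.mk (φ : ℂ⟦X⟧) (h : IsConvergent φ) : Cx := (⟨φ, h⟩ : convergentSeries Unit)

@[simp]
theorem Cx.incl_mk (φ : ℂ⟦X⟧) (h : IsConvergent φ) : Cx.incl (Cx.mk φ h) = φ := rfl

theorem Cx.incl_injective : Function.Injective Cx.incl := Subtype.val_injective

theorem Cx.isConvergent_incl (a : Cx) : IsConvergent (Cx.incl a) := a.2

instance : IsDomain Cx := inferInstanceAs (IsDomain (convergentSeries Unit))

instance : Algebra ℂ Cx := inferInstanceAs (Algebra ℂ (convergentSeries Unit))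

instance : CharZero Cx := Algebra.charZero_of_charZero ℂ Cx

theorem Cx.incl_algebraMap (c : ℂ) : Cx.incl (algebraMap ℂ Cx c) = C c := rfl

theorem exists_eq_incl_add_X_pow_mul (k : ℕ) (φ : ℂ⟦X⟧) :
    ∃ (a : Cx) (χ : ℂ⟦X⟧), φ = Cx.incl a + X ^ k * χ :=
  ⟨Cx.mk _ (isConvergent_coe _), _, (eq_X_pow_mul_shift_add_trunc k φ).trans (add_comm _ _)⟩

theorem isConvergent_of_eq_add_X_mul {χ : ℂ⟦X⟧} {a : Cx} {T : Polynomial Cx}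
    (h : χ = Cx.incl a + X * T.eval₂ Cx.incl χ) : IsConvergent χ := by
  obtain ⟨r₁, hr₁, K₁, hK₁0, hK₁⟩ := exists_forall_partialNorm_le
    (Finset.range (T.natDegree + 1)) (φ := fun i => Cx.incl (T.coeff i))
    fun i _ => Cx.isConvergent_incl _
  obtain ⟨r₂, hr₂, K₂, hK₂⟩ := (Cx.isConvergent_incl a).exists_partialNorm_le
  have hK₂0 : 0 ≤ K₂ := (partialNorm_nonneg hr₂.le 0 _).trans (hK₂ 0)
  set D : ℝ := ∑ i ∈ Finset.range (T.natDegree + 1), K₁ * (K₂ + 1) ^ i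
  have hD1 : 0 < D + 1 :=
    add_pos_of_nonneg_of_pos (Finset.sum_nonneg fun i _ => by positivity) one_pos
  set r : ℝ := min (min r₁ r₂) (1 / (D + 1))
  have hr0 : 0 < r := lt_min (lt_min hr₁ hr₂) (one_div_pos.2 hD1)
  have hr1 : r ≤ r₁ := (min_le_left _ _).trans (min_le_left _ _)
  have hr2 : r ≤ r₂ := (min_le_left _ _).trans (min_le_right _ _)
  have hrD : r * D ≤ 1 := by
    have := (le_div_iff₀ hD1).1 (min_le_right (min r₁ r₂) (1 / (D + 1)))
    linarith
  have hχ := partialNorm_le_of_eq_add_X_mul hr0.le h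
    (fun M => (partialNorm_mono hr0.le hr2 M _).trans (hK₂ M))
    (fun M hM => partialNorm_eval₂_le Cx.incl T hr0.le hK₁0
      (fun i hi => (partialNorm_mono hr0.le hr1 M _).trans (hK₁ i hi M)) hM) hrD
  exact isConvergent_iff_bounded.2
    ⟨r, hr0, K₂ + 1, fun n => (norm_coeff_mul_pow_le_partialNorm hr0.le n χ).trans (hχ n)⟩

theorem isConvergent_of_mul_add_X_mul {v χ : ℂ⟦X⟧} (hv : IsConvergent v)
    (hv0 : constantCoeff v ≠ 0) (T : Polynomial Cx)
    (h : IsConvergent (v * χ + X * T.eval₂ Cx.incl χ)) : IsConvergent χ := by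
  set c := constantCoeff v
  obtain ⟨w, hw⟩ : ∃ w, v - C c = X * w := ⟨_, sub_const_eq_X_mul_shift v⟩
  have hwc : IsConvergent w := by
    refine IsConvergent.of_X_pow_mul (k := 1) ?_
    rw [pow_one, ← hw, sub_eq_add_neg, ← map_neg]
    exact hv.add (IsConvergent.monomial 0 _)
  have hc : C c⁻¹ * C c = (1 : ℂ⟦X⟧) := by rw [← map_mul, inv_mul_cancel₀ hv0, map_one]
  refine isConvergent_of_eq_add_X_mul (a := algebraMap ℂ Cx c⁻¹ * Cx.mk _ h)
    (T := -Polynomial.C (algebraMap ℂ Cx c⁻¹) * (Polynomial.C (Cx.mk w hwc) * Polynomial.X + T)) ?_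
  simp only [Polynomial.eval₂_add, Polynomial.eval₂_mul, Polynomial.eval₂_C, Polynomial.eval₂_X,
    Polynomial.eval₂_neg, map_mul, Cx.incl_algebraMap, Cx.incl_mk]
  linear_combination (-χ) * hc - (C c⁻¹ * χ) * hw

theorem eval₂_add_eq_taylor_two {R S : Type*} [CommRing R] [CommRing S] (i : R →+* S)
    (P : Polynomial R) (a : R) (s : S) :
    P.eval₂ i (i a + s) = i (P.eval a) + s * i (P.derivative.eval a) +
      s ^ 2 * (P.taylor a).divX.divX.eval₂ i s := by
  have htaylor : P.eval₂ i (i a + s) = (P.taylor a).eval₂ i s := by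
    rw [Polynomial.taylor_apply, Polynomial.eval₂_comp]
    simp only [Polynomial.eval₂_add, Polynomial.eval₂_X, Polynomial.eval₂_C, add_comm]
  conv_lhs => rw [htaylor, ← Polynomial.divX_mul_X_add (P.taylor a),
    ← Polynomial.divX_mul_X_add (P.taylor a).divX]
  simp only [Polynomial.coeff_divX, zero_add, Polynomial.taylor_coeff_one,
    Polynomial.taylor_coeff_zero, Polynomial.eval₂_add, Polynomial.eval₂_mul, Polynomial.eval₂_C,
    Polynomial.eval₂_X]
  ring

theorem exists_map_eval_eq_X_pow_mul {S R : Type*} [CommRing S] [CommRing R] (i : S →+* R⟦X⟧)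
    (Q : Polynomial S) {e : ℕ} {a : S} {u χ : R⟦X⟧}
    (h : Q.eval₂ i (i a + X ^ (e + 1) * χ) = X ^ e * u) :
    ∃ v, constantCoeff v = constantCoeff u ∧ i (Q.eval a) = X ^ e * v := by
  rw [eval₂_add_eq_taylor_two] at h
  refine ⟨u - X * (χ * i (Q.derivative.eval a) +
    χ ^ 2 * X ^ (e + 1) * (Q.taylor a).divX.divX.eval₂ i (X ^ (e + 1) * χ)), by simp, ?_⟩
  linear_combination h

/-- Newton's method: `φ` agrees with some `a` in `ℂ{x}` to an order exceeding that of `P' (φ)`, and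
the rescaled difference solves an equation whose linear coefficient is a unit. -/
theorem isConvergent_of_simple_root {φ : ℂ⟦X⟧} {P : Polynomial Cx} (h : P.eval₂ Cx.incl φ = 0)
    (h' : P.derivative.eval₂ Cx.incl φ ≠ 0) : IsConvergent φ := by
  obtain ⟨e, u, hu, he⟩ : ∃ (e : ℕ) (u : ℂ⟦X⟧), constantCoeff u ≠ 0 ∧
      P.derivative.eval₂ Cx.incl φ = X ^ e * u :=
    ⟨_, _, constantCoeff_divXPowOrder_eq_zero_iff.not.2 h', X_pow_order_mul_divXPowOrder.symm⟩
  obtain ⟨a, χ, rfl⟩ := exists_eq_incl_add_X_pow_mul (e + 1) φ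
  obtain ⟨v, hv0, hv⟩ := exists_map_eval_eq_X_pow_mul Cx.incl P.derivative he
  have hvc : IsConvergent v := IsConvergent.of_X_pow_mul (hv ▸ Cx.isConvergent_incl _)
  set E := (P.taylor a).divX.divX
  refine (Cx.isConvergent_incl a).add ((isConvergent_X_pow _).mul ?_)
  refine isConvergent_of_mul_add_X_mul hvc (hv0.trans_ne hu)
    (Polynomial.X ^ 2 *
      E.comp (Polynomial.C (Cx.mk _ (isConvergent_X_pow (e + 1))) * Polynomial.X)) ?_
  refine IsConvergent.of_X_pow_mul (k := 2 * e + 1) ?_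
  rw [eval₂_add_eq_taylor_two, hv] at h
  convert Cx.isConvergent_incl (-P.eval a) using 1
  simp only [Polynomial.eval₂_mul, Polynomial.eval₂_X_pow, Polynomial.eval₂_comp,
    Polynomial.eval₂_C, Polynomial.eval₂_X, Cx.incl_mk, map_neg]
  linear_combination h

theorem isConvergent_of_root {φ : ℂ⟦X⟧} {P : Polynomial Cx} (hP : P ≠ 0)
    (h : P.eval₂ Cx.incl φ = 0) : IsConvergent φ := by
  induction hn : P.natDegree using Nat.strong_induction_on generalizing P with
  | _ n ih =>
    by_cases h' : P.derivative.eval₂ Cx.incl φ = 0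
    · have hd : P.natDegree ≠ 0 := by
        intro h0
        rw [Polynomial.eq_C_of_natDegree_eq_zero h0, Polynomial.eval₂_C,
          map_eq_zero_iff _ Cx.incl_injective] at h
        exact hP (by rw [Polynomial.eq_C_of_natDegree_eq_zero h0, h, Polynomial.C_0])
      exact ih _ (hn ▸ Polynomial.natDegree_derivative_lt hd)
        (fun h0 => hd (Polynomial.derivative_eq_zero.1 h0)) h' rfl
    · exact isConvergent_of_simple_root h h'

end Convergence

/-! ## Newton-Puiseux roots and jacobians of polynomials over `ℂ{x}` -/

section Substitution

open HahnSeries Polynomial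

/-- The inclusion of `ℂ{x}` in the field of Hahn series, over which polynomials in `ℂ{x}[y]` are
evaluated at fractional power series. -/
def toHahn : Cx →+* HahnSeries ℚ ℂ := (fracEmb 1).comp Cx.incl

theorem toHahn_apply (a : Cx) : toHahn a = fracEmb 1 (Cx.incl a) := rfl

theorem toHahn_injective : Function.Injective toHahn :=
  (fracEmb_injective 1).comp Cx.incl_injective

theorem map_toHahn_ne_zero {P : Cx[X]} (hP : P ≠ 0) : P.map toHahn ≠ 0 :=
  (Polynomial.map_ne_zero_iff toHahn_injective).2 hP

theorem monodromy_comp_toHahn (j : ℤ) : (monodromy j).comp toHahn = toHahn :=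
  RingHom.ext fun _ => monodromy_fracEmb_one j _

theorem coeff_map_toHahn_mem_puiseuxField (P : Cx[X]) (i : ℕ) :
    (P.map toHahn).coeff i ∈ puiseuxField ℂ := by
  rw [coeff_map]
  exact fracEmb_mem_puiseuxField _ _

/-- The inclusion of `ℂ⟦x⟧` in `ℂ⟦x, y⟧`. -/
def inX : PowerSeries ℂ →ₐ[ℂ] MvPowerSeries (Fin 2) ℂ :=
  MvPowerSeries.rename (R := ℂ) (fun _ : Unit => (0 : Fin 2))

theorem toSeries_C (a : Cx) : toSeries (C a) = inX (Cx.incl a) := by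
  rw [toSeries, coe_eval₂RingHom, eval₂_C]
  rfl

theorem toSeries_X : toSeries X = MvPowerSeries.X 1 := by
  rw [toSeries, coe_eval₂RingHom, eval₂_X]

theorem hasSubst_X_pow_pair (m : ℕ+) {φ : PowerSeries ℂ} (h : PowerSeries.constantCoeff φ = 0) :
    MvPowerSeries.HasSubst ![(PowerSeries.X : PowerSeries ℂ) ^ (m : ℕ), φ] :=
  MvPowerSeries.hasSubst_of_constantCoeff_zero <| Fin.forall_fin_two.2
    ⟨show PowerSeries.constantCoeff ((PowerSeries.X : PowerSeries ℂ) ^ (m : ℕ)) = 0 by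
      rw [map_pow, PowerSeries.constantCoeff_X, zero_pow m.ne_zero], h⟩

theorem subst_inX (m : ℕ+) {φ : PowerSeries ℂ} (h : PowerSeries.constantCoeff φ = 0)
    (a : PowerSeries ℂ) :
    MvPowerSeries.subst ![(PowerSeries.X : PowerSeries ℂ) ^ (m : ℕ), φ] (inX a) =
      PowerSeries.expand m m.ne_zero a := by
  rw [inX, MvPowerSeries.rename_eq_subst, MvPowerSeries.subst_comp_subst_apply
    (MvPowerSeries.HasSubst.X_comp _) (hasSubst_X_pow_pair m h), PowerSeries.expand_apply,
    PowerSeries.subst]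
  congr 1
  funext i
  rw [Function.comp_apply, MvPowerSeries.subst_X (hasSubst_X_pow_pair m h)]
  rfl

theorem fracEmb_expand_eq_fracEmb_one (m : ℕ+) (φ : PowerSeries ℂ) :
    fracEmb m (φ.expand m m.ne_zero) = fracEmb 1 φ := by
  simpa only [mul_one] using fracEmb_expand 1 m φ

theorem fracEmb_subst_toSeries (m : ℕ+) {φ : PowerSeries ℂ} (h : PowerSeries.constantCoeff φ = 0)
    (P : Cx[X]) :
    fracEmb m (MvPowerSeries.subst ![(PowerSeries.X : PowerSeries ℂ) ^ (m : ℕ), φ] (toSeries P)) =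
      (P.map toHahn).eval (fracEmb m φ) := by
  have hsubst := hasSubst_X_pow_pair m h
  let subst : MvPowerSeries (Fin 2) ℂ →+* PowerSeries ℂ := MvPowerSeries.substAlgHom (R := ℂ) hsubst
  have key : ((fracEmb m).comp subst).comp toSeries =
      (evalRingHom (fracEmb m φ)).comp (mapRingHom toHahn) := by
    refine Polynomial.ringHom_ext (fun a => ?_) ?_
    · simp only [RingHom.comp_apply, coe_mapRingHom, Polynomial.map_C, coe_evalRingHom, eval_C,
        toSeries_C, subst, RingHom.coe_coe, MvPowerSeries.coe_substAlgHom]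
      exact (congrArg (fracEmb m) (subst_inX m h _)).trans (fracEmb_expand_eq_fracEmb_one m _)
    · simp only [RingHom.comp_apply, coe_mapRingHom, map_X, coe_evalRingHom, eval_X, toSeries_X,
        subst, RingHom.coe_coe, MvPowerSeries.coe_substAlgHom, MvPowerSeries.subst_X hsubst]
      rfl
  simpa only [RingHom.comp_apply, coe_mapRingHom, coe_evalRingHom, subst, RingHom.coe_coe,
    MvPowerSeries.coe_substAlgHom] using RingHom.congr_fun key P

/-- The substitution `x ↦ x^k` on `ℂ{x}`, which turns roots in `ℂ⟦x^(1/k)⟧` into roots in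
`ℂ⟦x⟧`. -/
def Cx.expand (k : ℕ+) : Cx →+* Cx where
  toFun a := Cx.mk (PowerSeries.expand k k.ne_zero (Cx.incl a))
    ((isConvergent_expand_iff k.ne_zero).2 (Cx.isConvergent_incl a))
  map_zero' := Cx.incl_injective (by simp)
  map_one' := Cx.incl_injective (by simp)
  map_add' a b := Cx.incl_injective (by simp)
  map_mul' a b := Cx.incl_injective (by simp)

theorem fracEmb_incl_expand (m : ℕ+) (a : Cx) : fracEmb m (Cx.incl (Cx.expand m a)) = toHahn a :=
  fracEmb_expand_eq_fracEmb_one m _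

theorem isConvergent_of_eval_fracEmb_eq_zero {P : Cx[X]} (hP : P ≠ 0) {m : ℕ+} {φ : PowerSeries ℂ}
    (h : (P.map toHahn).eval (fracEmb m φ) = 0) : IsConvergent φ := by
  have hcomp : ((fracEmb m).comp Cx.incl).comp (Cx.expand m) = toHahn :=
    RingHom.ext (fracEmb_incl_expand m)
  refine isConvergent_of_root (P := P.map (Cx.expand m)) ?_ (fracEmb_injective m ?_)
  · refine (Polynomial.map_ne_zero_iff ?_).2 hP
    refine Function.Injective.of_comp (f := (fracEmb m).comp Cx.incl) ?_
    rw [← RingHom.coe_comp, hcomp]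
    exact toHahn_injective
  · rw [hom_eval₂, eval₂_map, hcomp, ← eval_map, h, map_zero]

theorem mem_zer_toSeries_iff {P : Cx[X]} (hP : P ≠ 0) {α : HahnSeries ℚ ℂ} :
    α ∈ Zer (toSeries P) ↔ (P.map toHahn).eval α = 0 ∧ 0 < α.orderTop := by
  constructor
  · rintro ⟨m, φ, -, h0, rfl, h⟩
    rw [fracSeries_eq_fracEmb]
    refine ⟨?_, (orderTop_fracEmb_pos_iff m φ).2 h0⟩
    rw [← fracEmb_subst_toSeries m h0, h, map_zero]
  · rintro ⟨h, h0⟩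
    obtain ⟨m, hm⟩ := mem_puiseuxField.1
      ((splits_of_coeff_mem_puiseuxField (coeff_map_toHahn_mem_puiseuxField P)).2 α
        ((mem_roots (map_toHahn_ne_zero hP)).2 h))
    obtain ⟨φ, rfl⟩ := exists_fracEmb_eq hm h0.le
    have hφ0 := (orderTop_fracEmb_pos_iff m φ).1 h0
    refine ⟨m, φ, isConvergent_of_eval_fracEmb_eq_zero hP h, hφ0, (fracSeries_eq_fracEmb m φ).symm,
      fracEmb_injective m ?_⟩
    rw [fracEmb_subst_toSeries m hφ0, h, map_zero]

end Substitution

section PolynomialsAsSeries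

open Polynomial

theorem coeff_inX (a : PowerSeries ℂ) (e : Fin 2 →₀ ℕ) :
    MvPowerSeries.coeff e (inX a) = if e 1 = 0 then PowerSeries.coeff (e 0) a else 0 := by
  split_ifs with h
  · have he : Finsupp.embDomain (⟨fun _ => 0, fun _ _ _ => rfl⟩ : Unit ↪ Fin 2)
        (Finsupp.single () (e 0)) = e := by
      rw [Finsupp.embDomain_single]
      change Finsupp.single (0 : Fin 2) (e 0) = e
      ext i
      fin_cases i <;> simp [h]
    conv_lhs => rw [← he]
    exact MvPowerSeries.coeff_embDomain_rename (R := ℂ) _ a _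
  · refine MvPowerSeries.coeff_rename_eq_zero _ _ ?_
    rintro ⟨d, rfl⟩
    exact h (Finsupp.mapDomain_of_notMem_range _ _ (by simp))

theorem isConvergent_inX {a : PowerSeries ℂ} (h : IsConvergent a) : IsConvergent (inX a) := by
  obtain ⟨r, hr, h⟩ := isConvergent_iff_summable.1 h
  refine ⟨r, hr, ((Finsupp.single_injective (0 : Fin 2)).summable_iff fun e he => ?_).1
    (h.congr fun n => by simp [coeff_inX, Finsupp.degree_single])⟩
  rw [coeff_inX, if_neg, norm_zero, zero_mul]
  intro h1
  refine he ⟨e 0, ?_⟩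
  ext i
  fin_cases i <;> simp [h1]

theorem isConvergent_toSeries (P : Cx[X]) : IsConvergent (toSeries P) := by
  induction P using Polynomial.induction_on' with
  | add p q hp hq => rw [map_add]; exact hp.add hq
  | monomial n a =>
    rw [← C_mul_X_pow_eq_monomial, map_mul, map_pow, toSeries_C, toSeries_X, MvPowerSeries.X_pow_eq]
    exact (isConvergent_inX (Cx.isConvergent_incl a)).mul (IsConvergent.monomial _ 1)

/-- The inclusion of `ℂ{x}[y]` in `ℂ{x,y}`. -/
def toCxy : Cx[X] →+* Cxy :=
  (toSeries.codRestrict (convergentSeries (Fin 2)) isConvergent_toSeries :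
    Cx[X] →+* convergentSeries (Fin 2))

theorem incl_toCxy (P : Cx[X]) : Cxy.incl (toCxy P) = toSeries P := rfl

theorem Cxy.incl_injective : Function.Injective Cxy.incl := Subtype.val_injective

end PolynomialsAsSeries

section Jacobian

open HahnSeries Polynomial

/-- The derivation of `A[y]` which applies the derivation `d` of `A` to the coefficients. -/
def coeffDerivation {A : Type*} [CommRing A] (d : Derivation ℤ A A) : Derivation ℤ A[X] A[X] :=
  PolynomialModule.equivPolynomialSelf.compDer d.mapCoeffs

theorem coeff_coeffDerivation {A : Type*} [CommRing A] (d : Derivation ℤ A A) (P : A[X]) (n : ℕ) :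
    (coeffDerivation d P).coeff n = d (P.coeff n) := rfl

theorem coeffDerivation_C {A : Type*} [CommRing A] (d : Derivation ℤ A A) (a : A) :
    coeffDerivation d (C a) = C (d a) := by
  ext n
  rw [coeff_coeffDerivation, coeff_C, coeff_C]
  split_ifs <;> simp

theorem coeffDerivation_X {A : Type*} [CommRing A] (d : Derivation ℤ A A) :
    coeffDerivation d X = 0 := by
  ext n
  rw [coeff_coeffDerivation, coeff_X]
  split_ifs <;> simp

/-- The derivation `d/dx` of `ℂ{x}`. -/
def Cx.deriv : Derivation ℤ Cx Cx :=
  Derivation.mk'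
    (AddMonoidHom.toIntLinearMap
      { toFun := fun a =>
          Cx.mk (PowerSeries.derivative ℂ (Cx.incl a)) (Cx.isConvergent_incl a).derivative
        map_zero' := Cx.incl_injective (by simp)
        map_add' := fun a b => Cx.incl_injective (by simp) })
    fun a b => Cx.incl_injective (by
      simp only [AddMonoidHom.coe_toIntLinearMap, AddMonoidHom.coe_mk, ZeroHom.coe_mk, Cx.incl_mk,
        map_mul, map_add, Derivation.leibniz, smul_eq_mul])

theorem Cx.incl_deriv (a : Cx) :
    Cx.incl (Cx.deriv a) = PowerSeries.derivative ℂ (Cx.incl a) := rfl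

theorem fracEmb_one_X : fracEmb 1 (PowerSeries.X : PowerSeries ℂ) = single 1 1 := by
  rw [fracEmb, RingHom.comp_apply, ofPowerSeries_X]
  exact embDomain_single.trans (by simp)

theorem fracEmb_one_X_mul_derivative (φ : PowerSeries ℂ) :
    fracEmb 1 (PowerSeries.X * PowerSeries.derivative ℂ φ) = euler (fracEmb 1 φ) := by
  ext q
  rw [coeff_euler]
  by_cases hq : ∃ n : ℕ, (n : ℚ) / ((1 : ℕ+) : ℕ) = q
  · obtain ⟨n, rfl⟩ := hq
    rw [coeff_fracEmb_div, coeff_fracEmb_div]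
    cases n with
    | zero => simp
    | succ n =>
      rw [PowerSeries.coeff_succ_X_mul, PowerSeries.coeff_derivative, mul_comm]
      simp
  · rw [coeff_fracEmb_of_forall_ne _ _ (not_exists.1 hq),
      coeff_fracEmb_of_forall_ne _ _ (not_exists.1 hq), mul_zero]

theorem single_one_mul_toHahn_deriv (a : Cx) :
    single 1 1 * toHahn (Cx.deriv a) = euler (toHahn a) := by
  rw [toHahn_apply, toHahn_apply, ← fracEmb_one_X_mul_derivative, map_mul, fracEmb_one_X,
    Cx.incl_deriv]

theorem pderiv_zero_inX (a : PowerSeries ℂ) :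
    MvPowerSeries.pderiv ℂ 0 (inX a) = inX (PowerSeries.derivative ℂ a) := by
  ext e
  rw [MvPowerSeries.coeff_pderiv, coeff_inX, coeff_inX, PowerSeries.coeff_derivative]
  simp

theorem pderiv_one_inX (a : PowerSeries ℂ) : MvPowerSeries.pderiv ℂ 1 (inX a) = 0 := by
  ext e
  rw [MvPowerSeries.coeff_pderiv, coeff_inX]
  simp

theorem pderiv_one_toSeries (P : Cx[X]) :
    MvPowerSeries.pderiv ℂ 1 (toSeries P) = toSeries (derivative P) := by
  induction P using Polynomial.induction_on' with
  | add p q hp hq => rw [map_add, map_add, hp, hq, derivative_add, map_add]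
  | monomial n a =>
    rw [← C_mul_X_pow_eq_monomial, map_mul, map_pow, toSeries_C, toSeries_X, Derivation.leibniz,
      MvPowerSeries.pderiv_pow, pderiv_one_inX, MvPowerSeries.pderiv_X_self, derivative_C_mul_X_pow,
      map_mul, map_pow, toSeries_X, toSeries_C, map_mul, map_mul, map_natCast, map_natCast]
    simp only [smul_eq_mul]
    ring

theorem pderiv_zero_toSeries (P : Cx[X]) :
    MvPowerSeries.pderiv ℂ 0 (toSeries P) = toSeries (coeffDerivation Cx.deriv P) := by
  induction P using Polynomial.induction_on' with
  | add p q hp hq => simp only [map_add, hp, hq]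
  | monomial n a =>
    simp only [← C_mul_X_pow_eq_monomial, map_mul, map_pow, toSeries_C, toSeries_X,
      Derivation.leibniz, Derivation.leibniz_pow, coeffDerivation_C, coeffDerivation_X,
      Cx.incl_deriv, pderiv_zero_inX, MvPowerSeries.pderiv_X_of_ne (zero_ne_one' (Fin 2)).symm,
      smul_eq_mul, smul_zero, mul_zero, zero_add]

/-- The jacobian of two polynomials in `ℂ{x}[y]`, which is again such a polynomial. -/
def jacPoly (P Q : Cx[X]) : Cx[X] :=
  coeffDerivation Cx.deriv P * derivative Q - derivative P * coeffDerivation Cx.deriv Q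

theorem jac_toSeries (P Q : Cx[X]) : jac (toSeries P) (toSeries Q) = toSeries (jacPoly P Q) := by
  rw [jac, jacPoly, map_sub, map_mul, map_mul, pderiv_one_toSeries, pderiv_one_toSeries,
    pderiv_zero_toSeries, pderiv_zero_toSeries]

theorem C_single_one_mul_map_coeffDerivation (P : Cx[X]) :
    C (single 1 1) * (coeffDerivation Cx.deriv P).map toHahn =
      coeffDerivation euler (P.map toHahn) := by
  ext1 n
  rw [coeff_C_mul, coeff_map, coeff_coeffDerivation, coeff_coeffDerivation, coeff_map,
    single_one_mul_toHahn_deriv]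

theorem C_single_one_mul_map_jacPoly (P Q : Cx[X]) :
    C (single 1 1) * (jacPoly P Q).map toHahn =
      coeffDerivation euler (P.map toHahn) * derivative (Q.map toHahn) -
        derivative (P.map toHahn) * coeffDerivation euler (Q.map toHahn) := by
  rw [← C_single_one_mul_map_coeffDerivation, ← C_single_one_mul_map_coeffDerivation, jacPoly]
  simp only [Polynomial.map_sub, Polynomial.map_mul, derivative_map]
  ring

end Jacobian

/-! ## Intersection multiplicity with `x` -/

open Polynomial

section MvPowerSeries

variable {σ R : Type*}

/-- The restriction of a power series to the axis of the variable `s`: all other variables are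
set to `0`. -/
def alongAxis [CommSemiring R] (s : σ) : MvPowerSeries σ R →+* PowerSeries R where
  toFun g := PowerSeries.mk fun n => MvPowerSeries.coeff (Finsupp.single s n) g
  map_zero' := by ext n; simp
  map_one' := by classical ext n; simp [MvPowerSeries.coeff_one, PowerSeries.coeff_one]
  map_add' g h := by ext n; simp
  map_mul' g h := by
    classical
    ext n
    simp [MvPowerSeries.coeff_mul, PowerSeries.coeff_mul, Finsupp.antidiagonal_single]

theorem coeff_alongAxis [CommSemiring R] (s : σ) (n : ℕ) (g : MvPowerSeries σ R) :
    PowerSeries.coeff n (alongAxis s g) = MvPowerSeries.coeff (Finsupp.single s n) g :=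
  PowerSeries.coeff_mk n fun n => MvPowerSeries.coeff (Finsupp.single s n) g

theorem alongAxis_X_self [CommSemiring R] (s : σ) :
    alongAxis s (MvPowerSeries.X s : MvPowerSeries σ R) = PowerSeries.X := by
  classical
  ext n
  rw [coeff_alongAxis, MvPowerSeries.coeff_X, PowerSeries.coeff_X]
  simp only [(Finsupp.single_injective s).eq_iff]

theorem X_zero_dvd_iff [CommRing R] {g : MvPowerSeries (Fin 2) R} :
    MvPowerSeries.X 0 ∣ g ↔ alongAxis 1 g = 0 := by
  rw [MvPowerSeries.X_dvd_iff, PowerSeries.ext_iff]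
  simp only [coeff_alongAxis, map_zero]
  refine ⟨fun h n => h _ (Finsupp.single_eq_of_ne zero_ne_one), fun h e he => ?_⟩
  have he' : e = Finsupp.single 1 (e 1) := by
    ext i
    fin_cases i <;> simp [he]
  rw [he', h]

theorem IsConvergent.of_monomial_mul {s : σ →₀ ℕ} {g : MvPowerSeries σ ℂ}
    (h : IsConvergent (MvPowerSeries.monomial s 1 * g)) : IsConvergent g := by
  obtain ⟨r, hr, h⟩ := h
  refine ⟨r, hr, ((h.comp_injective (add_right_injective s)).mul_right (r ^ s.degree)⁻¹).congr
    fun e => ?_⟩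
  rw [Function.comp_apply, MvPowerSeries.coeff_add_monomial_mul, one_mul, map_add, pow_add]
  field_simp

theorem IsConvergent.of_coeff_eq_zero_or_eq {g g' : MvPowerSeries σ ℂ} (h : IsConvergent g)
    (h' : ∀ e, MvPowerSeries.coeff e g' = 0 ∨
      MvPowerSeries.coeff e g' = MvPowerSeries.coeff e g) : IsConvergent g' := by
  obtain ⟨r, hr, h⟩ := h
  refine ⟨r, hr, h.of_nonneg_of_le (fun e => by positivity) fun e => ?_⟩
  rcases h' e with h0 | h0 <;> rw [h0]
  rw [norm_zero, zero_mul]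
  positivity

end MvPowerSeries

instance : IsDomain Cxy :=
  haveI : IsDomain (MvPowerSeries (Fin 2) ℂ) := NoZeroDivisors.to_isDomain _
  Cxy.incl_injective.isDomain Cxy.incl.toRingHom

/-- A convergent series, as an element of `ℂ{x,y}`. -/
def Cxy.mk (g : MvPowerSeries (Fin 2) ℂ) (h : IsConvergent g) : Cxy :=
  (⟨g, h⟩ : convergentSeries (Fin 2))

theorem Cxy.incl_mk (g : MvPowerSeries (Fin 2) ℂ) (h : IsConvergent g) :
    Cxy.incl (Cxy.mk g h) = g := rfl

theorem Cxy.isConvergent_incl (g : Cxy) : IsConvergent (Cxy.incl g) := g.2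

theorem incl_xVar : Cxy.incl xVar = MvPowerSeries.X 0 := rfl

theorem Cxy.dvd_of_incl_dvd {a g : Cxy} {s : Fin 2 →₀ ℕ}
    (ha : Cxy.incl a = MvPowerSeries.monomial s 1) (h : Cxy.incl a ∣ Cxy.incl g) : a ∣ g := by
  obtain ⟨q, hq⟩ := h
  have hconv : IsConvergent q := IsConvergent.of_monomial_mul (s := s) (by
    rw [← ha, ← hq]
    exact Cxy.isConvergent_incl g)
  exact ⟨Cxy.mk q hconv, Cxy.incl_injective (by
    rw [map_mul, Cxy.incl_mk, hq])⟩

theorem xVar_dvd_iff {g : Cxy} : xVar ∣ g ↔ alongAxis 1 (Cxy.incl g) = 0 := by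
  rw [← X_zero_dvd_iff, ← incl_xVar]
  exact ⟨map_dvd Cxy.incl, Cxy.dvd_of_incl_dvd incl_xVar⟩

theorem prime_xVar : Prime xVar := by
  refine ⟨fun h => ?_, fun h => ?_, fun g h hgh => ?_⟩
  · have hX : MvPowerSeries.coeff (Finsupp.single 0 1) (Cxy.incl xVar) = 1 :=
      MvPowerSeries.coeff_index_single_self_X 0
    rw [h, map_zero, map_zero] at hX
    exact zero_ne_one hX
  · have h1 : alongAxis 1 (Cxy.incl 1) = 0 := xVar_dvd_iff.1 h.dvd
    rw [map_one, map_one] at h1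
    exact one_ne_zero h1
  · simpa only [xVar_dvd_iff, map_mul, mul_eq_zero] using hgh

theorem coeff_toSeries (P : Cx[X]) (e : Fin 2 →₀ ℕ) :
    MvPowerSeries.coeff e (toSeries P) = PowerSeries.coeff (e 0) (Cx.incl (P.coeff (e 1))) := by
  classical
  induction P using Polynomial.induction_on' with
  | add p q hp hq => simp only [map_add, hp, hq, coeff_add]
  | monomial n a =>
    rw [← C_mul_X_pow_eq_monomial, map_mul toSeries, map_pow, toSeries_C, toSeries_X,
      coeff_C_mul_X_pow, MvPowerSeries.X_pow_eq, MvPowerSeries.coeff_mul_monomial, coeff_inX]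
    have hle : Finsupp.single (1 : Fin 2) n ≤ e ↔ n ≤ e 1 := Finsupp.single_le_iff
    simp only [hle, Finsupp.tsub_apply, Finsupp.single_eq_same, mul_one]
    rcases lt_trichotomy (e 1) n with h | h | h
    · simp [h.not_ge, h.ne]
    · simp [h]
    · simp [h.le, h.ne', (tsub_pos_of_lt h).ne']

theorem coeff_alongAxis_toSeries (P : Cx[X]) (n : ℕ) :
    PowerSeries.coeff n (alongAxis 1 (toSeries P)) =
      PowerSeries.constantCoeff (Cx.incl (P.coeff n)) := by
  rw [coeff_alongAxis, coeff_toSeries, Finsupp.single_eq_same,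
    Finsupp.single_eq_of_ne zero_ne_one, PowerSeries.coeff_zero_eq_constantCoeff]

theorem isRelPrime_xVar_toCxy {Q : Cx[X]} (hQ : Q.Monic) : IsRelPrime xVar (toCxy Q) := by
  refine prime_xVar.irreducible.isRelPrime_iff_not_dvd.2 fun h => ?_
  have h0 := congrArg (PowerSeries.coeff Q.natDegree) (xVar_dvd_iff.1 h)
  rw [incl_toCxy, coeff_alongAxis_toSeries, hQ.coeff_natDegree, map_one, map_one, map_zero] at h0
  exact one_ne_zero h0

theorem IsWeierstrass.alongAxis_toSeries {Q : Cx[X]} (hQ : IsWeierstrass Q) :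
    alongAxis 1 (toSeries Q) = PowerSeries.X ^ Q.natDegree := by
  ext n
  rw [coeff_alongAxis_toSeries, PowerSeries.coeff_X_pow]
  rcases lt_trichotomy n Q.natDegree with h | rfl | h
  · rw [if_neg h.ne, hQ.2 n h]
  · rw [if_pos rfl, hQ.1.coeff_natDegree, map_one, map_one]
  · rw [if_neg h.ne', coeff_eq_zero_of_natDegree_lt h, map_zero, map_zero]

theorem span_toCxy_xVar {Q : Cx[X]} (hQ : IsWeierstrass Q) :
    Ideal.span {toCxy Q, xVar} = Ideal.span {toCxy X ^ Q.natDegree, xVar} := by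
  obtain ⟨R, hR⟩ : xVar ∣ toCxy Q - toCxy X ^ Q.natDegree := by
    rw [xVar_dvd_iff, map_sub, map_pow, incl_toCxy, incl_toCxy, map_sub, map_pow,
      hQ.alongAxis_toSeries, toSeries_X, alongAxis_X_self, sub_self]
  rw [← Ideal.span_pair_add_mul_right (toCxy X ^ Q.natDegree) xVar R, mul_comm R, ← hR,
    add_sub_cancel]

/-- The first `d` coefficients of `g(0, y)`. -/
def lowCoeffs (d : ℕ) : Cxy →ₗ[ℂ] (Fin d → ℂ) :=
  LinearMap.pi fun j => (MvPowerSeries.coeff (Finsupp.single (1 : Fin 2) (j : ℕ))).comp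
    Cxy.incl.toLinearMap

theorem lowCoeffs_apply (d : ℕ) (g : Cxy) (j : Fin d) :
    lowCoeffs d g j = PowerSeries.coeff j (alongAxis 1 (Cxy.incl g)) :=
  (coeff_alongAxis _ _ _).symm

theorem lowCoeffs_surjective (d : ℕ) : Function.Surjective (lowCoeffs d) := by
  intro v
  refine ⟨toCxy (∑ i : Fin d, C (algebraMap ℂ Cx (v i)) * X ^ (i : ℕ)), ?_⟩
  ext j
  rw [lowCoeffs_apply, incl_toCxy, coeff_alongAxis_toSeries, finsetSum_coeff,
    Finset.sum_eq_single j]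
  · simp [Cx.incl_algebraMap]
  · intro i _ hi
    rw [coeff_C_mul_X_pow, if_neg (Fin.val_injective.ne hi.symm)]
  · simp

theorem lowCoeffs_eq_zero_iff {d : ℕ} {g : Cxy} :
    lowCoeffs d g = 0 ↔ PowerSeries.X ^ d ∣ alongAxis 1 (Cxy.incl g) := by
  rw [PowerSeries.X_pow_dvd_iff, funext_iff]
  simp only [lowCoeffs_apply, Fin.forall_iff, Pi.zero_apply]

/-- `g(0, y)`, as an element of `ℂ{x,y}`. -/
def Cxy.atXZero (g : Cxy) : Cxy :=
  Cxy.mk (fun e => if e 0 = 0 then MvPowerSeries.coeff e (Cxy.incl g) else 0)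
    ((Cxy.isConvergent_incl g).of_coeff_eq_zero_or_eq fun _ => (ite_eq_or_eq _ _ _).symm)

theorem Cxy.coeff_incl_atXZero (g : Cxy) (e : Fin 2 →₀ ℕ) :
    MvPowerSeries.coeff e (Cxy.incl g.atXZero) =
      if e 0 = 0 then MvPowerSeries.coeff e (Cxy.incl g) else 0 := rfl

theorem xVar_dvd_sub_atXZero (g : Cxy) : xVar ∣ g - g.atXZero := by
  rw [xVar_dvd_iff]
  ext n
  rw [coeff_alongAxis, map_sub, map_sub, Cxy.coeff_incl_atXZero,
    if_pos (Finsupp.single_eq_of_ne zero_ne_one), sub_self, map_zero]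

theorem toCxy_X_pow_dvd_atXZero {d : ℕ} {g : Cxy} (h : lowCoeffs d g = 0) :
    toCxy X ^ d ∣ g.atXZero := by
  have hy : Cxy.incl (toCxy X ^ d) = MvPowerSeries.X 1 ^ d := by
    rw [map_pow, incl_toCxy, toSeries_X]
  refine Cxy.dvd_of_incl_dvd (hy.trans (MvPowerSeries.X_pow_eq _ _)) ?_
  rw [hy, MvPowerSeries.X_pow_dvd_iff]
  intro e he
  rw [Cxy.coeff_incl_atXZero]
  split_ifs with h0
  · have he' : e = Finsupp.single 1 (e 1) := by
      ext i
      fin_cases i <;> simp [h0]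
    rw [he', ← coeff_alongAxis]
    exact PowerSeries.X_pow_dvd_iff.1 (lowCoeffs_eq_zero_iff.1 h) _ he
  · rfl

theorem ker_lowCoeffs (d : ℕ) :
    LinearMap.ker (lowCoeffs d) = (Ideal.span {toCxy X ^ d, xVar}).restrictScalars ℂ := by
  ext g
  rw [LinearMap.mem_ker, Submodule.restrictScalars_mem]
  constructor
  · intro h
    rw [← add_sub_cancel g.atXZero g]
    exact add_mem (Ideal.mem_of_dvd _ (toCxy_X_pow_dvd_atXZero h) (Ideal.subset_span (by simp)))
      (Ideal.mem_of_dvd _ (xVar_dvd_sub_atXZero g) (Ideal.subset_span (by simp)))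
  · rw [Ideal.mem_span_pair]
    rintro ⟨a, b, rfl⟩
    rw [lowCoeffs_eq_zero_iff, map_add, map_mul, map_mul, map_pow, incl_toCxy, toSeries_X,
      map_add, map_mul, map_pow, alongAxis_X_self, ← map_mul Cxy.incl,
      xVar_dvd_iff.1 (dvd_mul_left xVar b), add_zero]
    exact dvd_mul_left _ _

theorem interMult_toCxy_xVar {Q : Cx[X]} (hQ : IsWeierstrass Q) :
    interMult (toCxy Q) xVar = (Q.natDegree : ℕ∞) := by
  have e : (Cxy ⧸ Ideal.span {toCxy Q, xVar}) ≃ₗ[ℂ] (Fin Q.natDegree → ℂ) :=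
    (Submodule.Quotient.restrictScalarsEquiv ℂ _).symm.trans
      ((Submodule.quotEquivOfEq _ _ (by rw [ker_lowCoeffs, span_toCxy_xVar hQ])).trans
        ((lowCoeffs Q.natDegree).quotKerEquivOfSurjective (lowCoeffs_surjective _)))
  rw [interMult, e.rank_eq, rank_fin_fun, map_natCast]

/-! ## Initial forms on balls -/

open HahnSeries hiding C

section HasInit

variable {Γ R : Type*} [AddCommMonoid Γ] [LinearOrder Γ] [IsOrderedCancelAddMonoid Γ] [CommRing R]

/-- All coefficients of `P` have order at least `A`, and their coefficients at `x^A` are those of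
`F`: if `F ≠ 0` then `x^A F` is the initial form of `P`. The case `F = 0` is allowed, so that
initial forms can be added. -/
def HasInit (P : (HahnSeries Γ R)[X]) (A : Γ) (F : R[X]) : Prop :=
  ∀ i, (A : WithTop Γ) ≤ (P.coeff i).orderTop ∧ (P.coeff i).coeff A = F.coeff i

namespace HasInit

variable {P Q : (HahnSeries Γ R)[X]} {A B : Γ} {F G : R[X]}

theorem zero (A : Γ) : HasInit (0 : (HahnSeries Γ R)[X]) A 0 := fun i => by simp

theorem add (hP : HasInit P A F) (hQ : HasInit Q A G) : HasInit (P + Q) A (F + G) := fun i => by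
  rw [Polynomial.coeff_add, Polynomial.coeff_add, HahnSeries.coeff_add, (hP i).2, (hQ i).2]
  exact ⟨(le_min (hP i).1 (hQ i).1).trans min_orderTop_le_orderTop_add, rfl⟩

theorem neg (hP : HasInit P A F) : HasInit (-P) A (-F) := fun i => by
  rw [Polynomial.coeff_neg, Polynomial.coeff_neg, HahnSeries.coeff_neg, (hP i).2, orderTop_neg]
  exact ⟨(hP i).1, rfl⟩

theorem sub (hP : HasInit P A F) (hQ : HasInit Q A G) : HasInit (P - Q) A (F - G) := by
  rw [sub_eq_add_neg P, sub_eq_add_neg F]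
  exact hP.add hQ.neg

theorem sum {ι : Type*} (s : Finset ι) {P : ι → (HahnSeries Γ R)[X]} {F : ι → R[X]}
    (h : ∀ i ∈ s, HasInit (P i) A (F i)) : HasInit (∑ i ∈ s, P i) A (∑ i ∈ s, F i) := by
  induction s using Finset.cons_induction with
  | empty => exact zero A
  | cons a s ha ih =>
    rw [Finset.sum_cons, Finset.sum_cons]
    exact (h a (Finset.mem_cons_self _ _)).add (ih fun i hi => h i (Finset.mem_cons_of_mem hi))

theorem mul (hP : HasInit P A F) (hQ : HasInit Q B G) : HasInit (P * Q) (A + B) (F * G) :=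
  fun i => by
  rw [Polynomial.coeff_mul, Polynomial.coeff_mul, coe_le_orderTop_iff]
  simp only [HahnSeries.coeff_sum]
  refine ⟨fun c hc => Finset.sum_eq_zero fun p _ => coe_le_orderTop_iff.1 ?_ c hc,
    Finset.sum_congr rfl fun p _ => ?_⟩
  · rw [WithTop.coe_add]
    exact (add_le_add (hP p.1).1 (hQ p.2).1).trans orderTop_add_le_mul
  · rw [coeff_mul_add_of_le_orderTop (hP p.1).1 (hQ p.2).1, (hP p.1).2, (hQ p.2).2]

theorem const {a : HahnSeries Γ R} (h : (A : WithTop Γ) ≤ a.orderTop) :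
    HasInit (C a) A (C (a.coeff A)) := fun i => by
  rw [Polynomial.coeff_C, Polynomial.coeff_C]
  split_ifs
  · exact ⟨h, rfl⟩
  · simp

theorem C_single (a : Γ) : HasInit (C (single a (1 : R))) a 1 := by
  simpa only [coeff_single_same, C_1] using const (orderTop_single_le (a := a) (r := (1 : R)))

theorem one : HasInit (1 : (HahnSeries Γ R)[X]) 0 1 := C_single 0

theorem var : HasInit (X : (HahnSeries Γ R)[X]) 0 X := fun i => by
  rw [Polynomial.coeff_X, Polynomial.coeff_X]
  split_ifs
  · simpa using one (Γ := Γ) (R := R) 0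
  · simp

theorem pow (hP : HasInit P A F) (n : ℕ) : HasInit (P ^ n) (n • A) (F ^ n) := by
  induction n with
  | zero => simpa only [pow_zero, zero_nsmul] using one
  | succ n ih =>
    rw [pow_succ, pow_succ, succ_nsmul]
    exact ih.mul hP

theorem prod {ι : Type*} (s : Finset ι) {P : ι → (HahnSeries Γ R)[X]} {A : ι → Γ} {F : ι → R[X]}
    (h : ∀ i ∈ s, HasInit (P i) (A i) (F i)) :
    HasInit (∏ i ∈ s, P i) (∑ i ∈ s, A i) (∏ i ∈ s, F i) := by
  induction s using Finset.cons_induction with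
  | empty => exact one
  | cons a s ha ih =>
    rw [Finset.prod_cons, Finset.prod_cons, Finset.sum_cons]
    exact (h a (Finset.mem_cons_self _ _)).mul (ih fun i hi => h i (Finset.mem_cons_of_mem hi))

theorem derivative (hP : HasInit P A F) :
    HasInit (derivative P) A (derivative F) := fun i => by
  have hc : ((i : HahnSeries Γ R) + 1) = HahnSeries.C ((i : R) + 1) := by
    rw [map_add, map_natCast, map_one]
  rw [Polynomial.coeff_derivative, Polynomial.coeff_derivative, hc, mul_comm, C_mul_eq_smul,
    HahnSeries.coeff_smul, (hP _).2, smul_eq_mul, mul_comm]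
  exact ⟨(hP _).1.trans (orderTop_le_orderTop_smul _ _), rfl⟩

theorem of_lt (hP : HasInit P A F) (h : B < A) : HasInit P B 0 := fun i =>
  ⟨(WithTop.coe_le_coe.2 h.le).trans (hP i).1, coe_le_orderTop_iff.1 (hP i).1 B h⟩

theorem unique (hP : HasInit P A F) (hP' : HasInit P A G) : F = G := by
  ext i
  rw [← (hP i).2, (hP' i).2]

theorem le_of_ne_zero (hP : HasInit P A F) (hP' : HasInit P B G) (hF : F ≠ 0) : B ≤ A :=
  le_of_not_gt fun h => hF (hP.unique (hP'.of_lt h))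

theorem eq_of_ne_zero (hP : HasInit P A F) (hP' : HasInit P B G) (hF : F ≠ 0) (hG : G ≠ 0) :
    A = B ∧ F = G := by
  obtain rfl : A = B := le_antisymm (hP'.le_of_ne_zero hP hG) (hP.le_of_ne_zero hP' hF)
  exact ⟨rfl, hP.unique hP'⟩

theorem comp (hP : HasInit P A F) (hQ : HasInit Q 0 G) : HasInit (P.comp Q) A (F.comp G) := by
  have hd : F.natDegree < P.natDegree + 1 := by
    refine Nat.lt_succ_of_le (natDegree_le_iff_coeff_eq_zero.2 fun i hi => ?_)
    rw [← (hP i).2, coeff_eq_zero_of_natDegree_lt hi, HahnSeries.coeff_zero]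
  rw [Polynomial.comp, Polynomial.comp, eval₂_eq_sum_range, eval₂_eq_sum_range' _ hd]
  refine sum _ fun i _ => ?_
  have h := (const (hP i).1).mul (hQ.pow i)
  rwa [smul_zero, add_zero, (hP i).2] at h

end HasInit

end HasInit

section Ball

variable {Γ R : Type*} [AddCommGroup Γ] [LinearOrder Γ] [IsOrderedAddMonoid Γ] [CommRing R]

theorem HasInit.of_C_single_mul {h A : Γ} {P : (HahnSeries Γ R)[X]} {F : R[X]}
    (hP : HasInit (C (single h 1) * P) (h + A) F) : HasInit P A F := by
  have := (C_single (-h)).mul hP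
  rwa [← mul_assoc, ← C_mul, single_mul_single, neg_add_cancel, mul_one, single_zero_one, C_1,
    one_mul, one_mul, neg_add_cancel_left] at this

/-- The coordinate `lam + x^h z` on the closed ball of radius `h` about `lam`. -/
def ballVar (lam : HahnSeries Γ R) (h : Γ) : (HahnSeries Γ R)[X] := C lam + C (single h 1) * X

theorem derivative_ballVar (lam : HahnSeries Γ R) (h : Γ) :
    derivative (ballVar lam h) = C (single h 1) := by
  simp [ballVar]

theorem X_sub_C_comp_ballVar (lam a : HahnSeries Γ R) (h : Γ) :
    (X - C a).comp (ballVar lam h) = C (single h 1) * X - C (a - lam) := by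
  simp only [sub_comp, X_comp, C_comp, ballVar, C_sub]
  ring

theorem hasInit_X_sub_C_of_le {lam a : HahnSeries Γ R} {h : Γ}
    (ha : (h : WithTop Γ) ≤ (a - lam).orderTop) :
    HasInit ((X - C a).comp (ballVar lam h)) h (X - C ((a - lam).coeff h)) := by
  have hX : HasInit (C (single h (1 : R)) * X) h X := by
    simpa only [add_zero, one_mul] using (HasInit.C_single h).mul HasInit.var
  rw [X_sub_C_comp_ballVar]
  exact hX.sub (HasInit.const ha)

theorem hasInit_X_sub_C_of_lt {lam a : HahnSeries Γ R} {h o : Γ} (ha : (a - lam).orderTop = o)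
    (ho : o < h) :
    HasInit ((X - C a).comp (ballVar lam h)) o (C ((lam - a).coeff o)) := by
  have hX : HasInit (C (single h (1 : R)) * X) o 0 :=
    ((HasInit.C_single h).mul HasInit.var).of_lt (by rwa [add_zero])
  rw [X_sub_C_comp_ballVar, ← neg_sub a lam, HahnSeries.coeff_neg, C_neg, ← zero_sub]
  exact hX.sub (HasInit.const ha.ge)

variable [IsDomain R]

/-- The factors with root outside the ball have constant initial forms. -/
theorem exists_hasInit_multiset (lam : HahnSeries Γ R) (h : Γ) (s : Multiset (HahnSeries Γ R)) :
    ∃ (A : Γ) (c : R), c ≠ 0 ∧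
      HasInit ((s.map fun a => X - C a).prod.comp (ballVar lam h)) A
        (C c * ((s.filter fun a => (h : WithTop Γ) ≤ (a - lam).orderTop).map
          fun a => X - C ((a - lam).coeff h)).prod) := by
  induction s using Multiset.induction_on with
  | empty => exact ⟨0, 1, one_ne_zero, by simpa using HasInit.one⟩
  | cons a s ih =>
    obtain ⟨A, c, hc, hI⟩ := ih
    rw [Multiset.map_cons, Multiset.prod_cons, mul_comp, Multiset.filter_cons]
    by_cases ha : (h : WithTop Γ) ≤ (a - lam).orderTop
    · refine ⟨h + A, c, hc, ?_⟩
      rw [if_pos ha, Multiset.singleton_add, Multiset.map_cons, Multiset.prod_cons, mul_left_comm]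
      exact (hasInit_X_sub_C_of_le ha).mul hI
    · obtain ⟨o, ho⟩ := WithTop.ne_top_iff_exists.1 (not_le.1 ha).ne_top
      have hco : (lam - a).coeff o ≠ 0 :=
        coeff_orderTop_ne ((orderTop_sub_comm lam a).trans ho.symm)
      refine ⟨o + A, (lam - a).coeff o * c, mul_ne_zero hco hc, ?_⟩
      rw [if_neg ha, zero_add, C_mul, mul_assoc]
      rw [← ho, WithTop.coe_le_coe, not_le] at ha
      exact (hasInit_X_sub_C_of_lt ho.symm ha).mul hI

/-- The number of elements of a multiset in the closed ball of radius `h` about `lam`. -/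
def ballCount (s : Multiset (HahnSeries Γ R)) (lam : HahnSeries Γ R) (h : Γ) : ℕ :=
  (s.filter fun a => (h : WithTop Γ) ≤ (a - lam).orderTop).card

theorem exists_hasInit_of_splits {P : (HahnSeries Γ R)[X]} (hP : P.Splits) (h0 : P ≠ 0)
    (lam : HahnSeries Γ R) (h : Γ) :
    ∃ (A : Γ) (F : R[X]), F ≠ 0 ∧ F.natDegree = ballCount P.roots lam h ∧
      HasInit (P.comp (ballVar lam h)) A F := by
  obtain ⟨A, c, hc, hI⟩ := exists_hasInit_multiset lam h P.roots
  have hlead : P.leadingCoeff ≠ 0 := leadingCoeff_ne_zero.2 h0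
  obtain ⟨o, ho⟩ := WithTop.ne_top_iff_exists.1 (orderTop_ne_top.2 hlead)
  have hne : P.leadingCoeff.coeff o * c ≠ 0 := mul_ne_zero (coeff_orderTop_ne ho.symm) hc
  set S := (P.roots.filter fun a => (h : WithTop Γ) ≤ (a - lam).orderTop).map
    fun a => X - C ((a - lam).coeff h) with hS
  have hmonic : ∀ q ∈ S, q.Monic := by
    simp only [hS, Multiset.mem_map]
    rintro _ ⟨a, -, rfl⟩
    exact monic_X_sub_C _
  have hprod : S.prod.Monic := by
    simpa only [Multiset.map_id] using monic_multiset_prod_of_monic S id hmonic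
  refine ⟨o + A, C (P.leadingCoeff.coeff o * c) * S.prod,
    mul_ne_zero (C_ne_zero.2 hne) hprod.ne_zero, ?_, ?_⟩
  · rw [natDegree_C_mul hne, natDegree_multiset_prod_of_monic _ hmonic, hS, Multiset.map_map]
    simp only [Function.comp_def, natDegree_X_sub_C]
    simp [ballCount]
  · have hcomp : P.comp (ballVar lam h) = C P.leadingCoeff *
        (P.roots.map fun a => X - C a).prod.comp (ballVar lam h) := by
      conv_lhs => rw [hP.eq_prod_roots]
      rw [mul_comp, C_comp]
    rw [hcomp, C_mul, mul_assoc]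
    exact (HasInit.const ho.le).mul hI

theorem natDegree_eq_ballCount {P : (HahnSeries Γ R)[X]} (hP : P.Splits) {lam : HahnSeries Γ R}
    {h A : Γ} {F : R[X]} (hF : F ≠ 0) (hI : HasInit (P.comp (ballVar lam h)) A F) :
    F.natDegree = ballCount P.roots lam h := by
  have h0 : P ≠ 0 := by
    rintro rfl
    rw [zero_comp] at hI
    exact hF (hI.unique (HasInit.zero A))
  obtain ⟨A', F', hF', hd, hI'⟩ := exists_hasInit_of_splits hP h0 lam h
  rw [(hI.eq_of_ne_zero hI' hF hF').2, hd]

end Ball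

section Jacobian

theorem HasInit.euler {P : (HahnSeries ℚ ℂ)[X]} {A : ℚ} {F : ℂ[X]} (hP : HasInit P A F) :
    HasInit (coeffDerivation euler P) A (C (A : ℂ) * F) := fun i => by
  rw [coeff_coeffDerivation, Polynomial.coeff_C_mul, coeff_euler, (hP i).2, coe_le_orderTop_iff]
  refine ⟨fun q hq => ?_, rfl⟩
  rw [coeff_euler, coe_le_orderTop_iff.1 (hP i).1 q hq, mul_zero]

theorem coeffDerivation_comp {A : Type*} [CommRing A] (d : Derivation ℤ A A) (P Q : A[X]) :
    coeffDerivation d (P.comp Q) =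
      (coeffDerivation d P).comp Q + (derivative P).comp Q * coeffDerivation d Q := by
  induction P using Polynomial.induction_on' with
  | add p q hp hq => simp only [add_comp, map_add, hp, hq]; ring
  | monomial n a =>
    have h : coeffDerivation d (C a * X ^ n) = C (d a) * X ^ n := by
      ext i
      simp only [coeff_coeffDerivation, coeff_C_mul, coeff_X_pow, mul_ite, mul_one, mul_zero,
        apply_ite d, map_zero]
    rw [← C_mul_X_pow_eq_monomial, h]
    simp only [Derivation.leibniz, Derivation.leibniz_pow, derivative_C_mul_X_pow,
      Polynomial.mul_comp, C_comp, pow_comp, X_comp, natCast_comp, coeffDerivation_C, smul_eq_mul,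
      nsmul_eq_mul, map_mul, map_natCast]
    ring

theorem HasInit.jac {P Q J : (HahnSeries ℚ ℂ)[X]} {lam : HahnSeries ℚ ℂ} {h A B : ℚ}
    {F G : ℂ[X]}
    (hJ : C (single 1 1) * J =
      coeffDerivation PlaneBranch.euler P * Polynomial.derivative Q -
        Polynomial.derivative P * coeffDerivation PlaneBranch.euler Q)
    (hP : HasInit (P.comp (ballVar lam h)) B G) (hQ : HasInit (Q.comp (ballVar lam h)) A F) :
    HasInit (J.comp (ballVar lam h)) (A + B - h - 1)
      (C (B : ℂ) * (G * Polynomial.derivative F) - C (A : ℂ) * (F * Polynomial.derivative G)) := by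
  have hcomp : C (single (h + 1) 1) * J.comp (ballVar lam h) =
      coeffDerivation PlaneBranch.euler (P.comp (ballVar lam h)) *
        Polynomial.derivative (Q.comp (ballVar lam h)) -
      Polynomial.derivative (P.comp (ballVar lam h)) *
        coeffDerivation PlaneBranch.euler (Q.comp (ballVar lam h)) := by
    have hJ' := congrArg (fun R => R.comp (ballVar lam h)) hJ
    simp only [Polynomial.mul_comp, C_comp, sub_comp] at hJ'
    rw [← mul_one (1 : ℂ), ← single_mul_single, C_mul, mul_assoc, hJ', coeffDerivation_comp,
      coeffDerivation_comp, derivative_comp, derivative_comp, derivative_ballVar]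
    ring
  have hI := (hP.euler.mul hQ.derivative).sub (hP.derivative.mul hQ.euler)
  have hF : C (B : ℂ) * G * Polynomial.derivative F - Polynomial.derivative G * (C (A : ℂ) * F) =
      C (B : ℂ) * (G * Polynomial.derivative F) - C (A : ℂ) * (F * Polynomial.derivative G) := by
    ring
  rw [← hcomp, hF, show B + A = h + 1 + (A + B - h - 1) by ring] at hI
  exact HasInit.of_C_single_mul hI

end Jacobian

/-! ## Descent to convergent Weierstrass polynomials -/

section Descent

theorem exists_toHahn_eq_of_monodromy_eq_self {m : ℕ+} {c : Cx}
    (h : monodromy 1 (fracEmb m (Cx.incl c)) = fracEmb m (Cx.incl c)) :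
    ∃ a, toHahn a = fracEmb m (Cx.incl c) := by
  obtain ⟨ψ, hψ⟩ := exists_fracEmb_eq (m := 1) (monodromy_eq_self_iff_mem_rangeS.1 h)
    (orderTop_fracEmb_nonneg m _)
  have hψc : ψ.expand m m.ne_zero = Cx.incl c := by
    rw [← fracEmb_expand_eq_fracEmb_one m] at hψ
    exact fracEmb_injective m hψ
  exact ⟨Cx.mk ψ ((isConvergent_expand_iff m.ne_zero).1 (hψc ▸ Cx.isConvergent_incl c)), hψ⟩

/-- The roots converge because they are algebraic, and one `m` serves for finitely many of them. -/
theorem exists_prod_X_sub_C_mem_lifts {P : Cx[X]} (hP : P ≠ 0) {s : Multiset (HahnSeries ℚ ℂ)}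
    (hs : ∀ α ∈ s, (P.map toHahn).eval α = 0 ∧ 0 < α.orderTop) :
    ∃ m : ℕ+, (s.map fun α => X - C α).prod ∈ lifts ((fracEmb m).comp Cx.incl) := by
  classical
  have hpui : ∀ α ∈ s.toFinset, α ∈ puiseuxField ℂ := fun α hα =>
    (splits_of_coeff_mem_puiseuxField (coeff_map_toHahn_mem_puiseuxField P)).2 α
      ((mem_roots (map_toHahn_ne_zero hP)).2 (hs α (Multiset.mem_toFinset.1 hα)).1)
  obtain ⟨m, hm⟩ := exists_forall_mem_rangeS_laurentEmb s.toFinset hpui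
  refine ⟨m, multiset_prod_mem _ fun q hq => ?_⟩
  obtain ⟨α, hα, rfl⟩ := Multiset.mem_map.1 hq
  obtain ⟨φ, rfl⟩ := exists_fracEmb_eq (hm α (Multiset.mem_toFinset.2 hα)) (hs α hα).2.le
  refine (lifts_iff_set_range _).2
    ⟨X - C (Cx.mk φ (isConvergent_of_eval_fracEmb_eq_zero hP (hs _ hα).1)), ?_⟩
  rw [Polynomial.map_sub, map_X, Polynomial.map_C, RingHom.comp_apply, Cx.incl_mk]

theorem hasInit_prod_X_sub_C {s : Multiset (HahnSeries ℚ ℂ)} (h : ∀ α ∈ s, 0 < α.orderTop) :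
    HasInit (s.map fun α => X - C α).prod 0 (X ^ s.card) := by
  induction s using Multiset.induction_on with
  | empty => simpa using HasInit.one (Γ := ℚ) (R := ℂ)
  | cons a s ih =>
    have ha := h a (Multiset.mem_cons_self a s)
    have hX := HasInit.var.sub (HasInit.const (A := 0) ha.le)
    rw [coeff_eq_zero_of_lt_orderTop ha, C_0, sub_zero] at hX
    rw [Multiset.map_cons, Multiset.prod_cons, Multiset.card_cons, pow_succ', ← add_zero (0 : ℚ)]
    exact hX.mul (ih fun α hα => h α (Multiset.mem_cons_of_mem hα))

theorem exists_isWeierstrass_of_roots {P : Cx[X]} (hP : P ≠ 0) {s : Multiset (HahnSeries ℚ ℂ)}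
    (hs : ∀ α ∈ s, (P.map toHahn).eval α = 0 ∧ 0 < α.orderTop)
    (hinv : s.map (monodromy 1) = s) :
    ∃ Q : Cx[X], IsWeierstrass Q ∧ Q.map toHahn = (s.map fun α => X - C α).prod := by
  obtain ⟨m, hm⟩ := exists_prod_X_sub_C_mem_lifts hP hs
  set R := (s.map fun α => X - C α).prod with hR
  have hI : HasInit R 0 (X ^ s.card) := hasInit_prod_X_sub_C fun α hα => (hs α hα).2
  have hmonic : R.Monic := monic_multiset_prod_of_monic _ _ fun α _ => monic_X_sub_C α
  have hfix : R.map (monodromy 1) = R := by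
    rw [hR, Polynomial.map_multiset_prod, Multiset.map_map]
    conv_rhs => rw [← hinv, Multiset.map_map]
    simp only [Function.comp_def, Polynomial.map_sub, map_X, Polynomial.map_C]
  have hlift : R ∈ lifts toHahn := by
    rw [lifts_iff_coeff_lifts] at hm ⊢
    intro i
    obtain ⟨c, hc⟩ := hm i
    have hci := congrArg (fun q => q.coeff i) hfix
    simp only [coeff_map, ← hc] at hci ⊢
    exact exists_toHahn_eq_of_monodromy_eq_self hci
  obtain ⟨Q, hQ, hQd, hQm⟩ := lifts_and_natDegree_eq_and_monic hlift hmonic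
  refine ⟨Q, ⟨hQm, fun i hi => ?_⟩, hQ⟩
  rw [hQd, hR, natDegree_multiset_prod_X_sub_C_eq_card] at hi
  rw [← coeff_zero_fracEmb 1, ← toHahn_apply, ← coeff_map, hQ, (hI i).2, coeff_X_pow,
    if_neg hi.ne]

end Descent

section Roots

theorem HasInit.reverse {Γ R : Type*} [AddCommMonoid Γ] [LinearOrder Γ]
    [IsOrderedCancelAddMonoid Γ] [CommRing R] {P : (HahnSeries Γ R)[X]} {A : Γ} {F : R[X]}
    (hP : HasInit P A F) (hd : P.natDegree = F.natDegree) : HasInit P.reverse A F.reverse :=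
  fun i => by
  rw [coeff_reverse, coeff_reverse, hd]
  exact hP _

theorem IsWeierstrass.hasInit_map_toHahn {f : Cx[X]} (hf : IsWeierstrass f) :
    HasInit (f.map toHahn) 0 (X ^ f.natDegree) := fun i => by
  rw [coeff_map, toHahn_apply, coeff_X_pow, coeff_zero_fracEmb]
  refine ⟨orderTop_fracEmb_nonneg 1 _, ?_⟩
  rcases lt_trichotomy i f.natDegree with hi | rfl | hi
  · rw [hf.2 i hi, if_neg hi.ne]
  · rw [hf.1.coeff_natDegree, map_one, map_one, if_pos rfl]
  · rw [coeff_eq_zero_of_natDegree_lt hi, map_zero, map_zero, if_neg hi.ne']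

/-- If `α` had nonpositive order, then `α⁻¹` would have nonnegative order and be a root of the
reversed polynomial, whose initial form is `1`. -/
theorem IsWeierstrass.orderTop_pos {f : Cx[X]} (hf : IsWeierstrass f) {α : HahnSeries ℚ ℂ}
    (h : (f.map toHahn).eval α = 0) : 0 < α.orderTop := by
  by_contra! hneg
  have hα : α ≠ 0 := by
    rintro rfl
    simp at hneg
  have hinv : 0 ≤ α⁻¹.orderTop := by
    by_contra! hlt
    have h1 := orderTop_mul α α⁻¹
    rw [mul_inv_cancel₀ hα, orderTop_one] at h1
    have h2 : α.orderTop + α⁻¹.orderTop ≤ 0 + α⁻¹.orderTop := by gcongr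
    rw [← h1, zero_add] at h2
    exact h2.not_gt hlt
  have hrev : HasInit (f.map toHahn).reverse 0 1 := by
    have := hf.hasInit_map_toHahn.reverse (by rw [hf.1.natDegree_map, natDegree_X_pow])
    rwa [← one_mul (X ^ f.natDegree), reverse_mul_X_pow, ← C_1, reverse_C, C_1] at this
  have hroot : (f.map toHahn).reverse.eval α⁻¹ = 0 := by
    let := invertibleOfNonzero hα
    rw [← invOf_eq_inv]
    exact (eval₂_reverse_eq_zero_iff (RingHom.id _) α _).2 h
  have hcomp := hrev.comp (HasInit.const hinv)
  rw [comp_C, hroot, C_0, one_comp] at hcomp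
  exact one_ne_zero (hcomp.unique (HasInit.zero 0))

end Roots

section Period

/-- `γ` has exactly `N` different conjugates `monodromy j γ`, in the strong sense that the
conjugates of indices `i` and `j` agree exactly when `i ≡ j` modulo `N`. -/
structure HasPeriod (γ : HahnSeries ℚ ℂ) (N : ℕ) : Prop where
  pos : 0 < N
  monodromy_eq_self_iff (j : ℤ) : monodromy j γ = γ ↔ (N : ℤ) ∣ j

theorem exists_hasPeriod {γ : HahnSeries ℚ ℂ} (h : γ ∈ puiseuxField ℂ) : ∃ N, HasPeriod γ N := by
  obtain ⟨m, hm⟩ := mem_puiseuxField.1 h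
  let H : AddSubgroup ℤ :=
    { carrier := {j | monodromy j γ = γ}
      zero_mem' := monodromy_zero γ
      add_mem' := fun {i j} hi hj => by rw [Set.mem_ofPred_eq, monodromy_add, hj, hi]
      neg_mem' := fun {j} hj => by
        rw [Set.mem_ofPred_eq, ← mul_neg_one j]
        exact monodromy_mul_eq_self hj _ }
  obtain ⟨a, ha⟩ := Int.subgroup_cyclic H
  have hdvd (j : ℤ) : monodromy j γ = γ ↔ (a.natAbs : ℤ) ∣ j := by
    rw [Int.natAbs_dvd, show monodromy j γ = γ ↔ j ∈ H from Iff.rfl, ha,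
      AddSubgroup.mem_closure_singleton, dvd_def]
    simp only [smul_eq_mul, mul_comm _ a, eq_comm]
  refine ⟨a.natAbs, Nat.pos_of_ne_zero fun h0 => ?_, hdvd⟩
  have hm' := (hdvd _).1 (monodromy_eq_self_iff_mem_rangeS.2 hm)
  rw [h0, Nat.cast_zero, zero_dvd_iff] at hm'
  exact m.ne_zero (by exact_mod_cast hm')

/-- The conjugates of `γ` of indices `0, …, N - 1`. -/
def conjugates (N : ℕ) (γ : HahnSeries ℚ ℂ) : Multiset (HahnSeries ℚ ℂ) :=
  (Multiset.range N).map fun j : ℕ => monodromy j γ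

theorem card_conjugates (N : ℕ) (γ : HahnSeries ℚ ℂ) : (conjugates N γ).card = N := by
  rw [conjugates, Multiset.card_map, Multiset.card_range]

namespace HasPeriod

variable {γ : HahnSeries ℚ ℂ} {N : ℕ}

theorem monodromy_eq_monodromy_iff (hγ : HasPeriod γ N) (i j : ℤ) :
    monodromy i γ = monodromy j γ ↔ (N : ℤ) ∣ i - j := by
  rw [← hγ.monodromy_eq_self_iff, ← (monodromy j).injective.eq_iff (b := γ), ← monodromy_add,
    add_sub_cancel]

theorem nodup_conjugates (hγ : HasPeriod γ N) : (conjugates N γ).Nodup := by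
  refine (Multiset.nodup_map_iff_inj_on (Multiset.nodup_range N)).2 fun i hi j hj hij => ?_
  rw [Multiset.mem_range] at hi hj
  have hdvd := (hγ.monodromy_eq_monodromy_iff i j).1 hij
  have := Int.eq_zero_of_abs_lt_dvd hdvd (by rw [abs_lt]; omega)
  omega

theorem mem_conjugates (hγ : HasPeriod γ N) {α : HahnSeries ℚ ℂ} :
    α ∈ conjugates N γ ↔ ∃ j : ℤ, monodromy j γ = α := by
  refine Multiset.mem_map.trans ⟨fun ⟨j, _, hj⟩ => ⟨j, hj⟩, fun ⟨j, hj⟩ => ?_⟩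
  have hN : (0 : ℤ) < N := by exact_mod_cast hγ.pos
  obtain ⟨r, hr⟩ := Int.eq_ofNat_of_zero_le (Int.emod_nonneg j hN.ne')
  have hlt := Int.emod_lt_of_pos j hN
  refine ⟨r, by rw [Multiset.mem_range]; omega, ?_⟩
  rw [← hj, hγ.monodromy_eq_monodromy_iff, ← hr, ← neg_sub, dvd_neg]
  exact Int.dvd_self_sub_emod

theorem map_monodromy_conjugates (hγ : HasPeriod γ N) (i : ℤ) :
    (conjugates N γ).map (monodromy i) = conjugates N γ := by
  refine (Multiset.Nodup.ext (hγ.nodup_conjugates.map (monodromy i).injective)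
    hγ.nodup_conjugates).2 fun α => ?_
  simp only [Multiset.mem_map, hγ.mem_conjugates]
  constructor
  · rintro ⟨_, ⟨j, rfl⟩, rfl⟩
    exact ⟨i + j, monodromy_add i j γ⟩
  · rintro ⟨j, rfl⟩
    exact ⟨_, ⟨j - i, rfl⟩, by rw [← monodromy_add, add_sub_cancel]⟩

end HasPeriod

theorem map_monodromy_map_toHahn (j : ℤ) (P : Cx[X]) :
    (P.map toHahn).map (monodromy j) = P.map toHahn := by
  rw [Polynomial.map_map, monodromy_comp_toHahn]

theorem eval_map_toHahn_monodromy_eq_zero {f : Cx[X]} {γ : HahnSeries ℚ ℂ}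
    (h : (f.map toHahn).eval γ = 0) (j : ℤ) : (f.map toHahn).eval (monodromy j γ) = 0 := by
  rw [← map_monodromy_map_toHahn j, eval_map, eval₂_at_apply, h, map_zero]

/-- The conjugates of one root are the roots of a factor over `ℂ{x}`, which must be `f` itself. -/
theorem exists_roots_eq_conjugates {f : Cx[X]} (hW : IsWeierstrass f) (hf : Irreducible f) :
    ∃ γ : HahnSeries ℚ ℂ, 0 < γ.orderTop ∧ HasPeriod γ f.natDegree ∧
      (f.map toHahn).roots = conjugates f.natDegree γ := by
  have hsplit := splits_of_coeff_mem_puiseuxField (coeff_map_toHahn_mem_puiseuxField f)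
  have hfm : (f.map toHahn).Monic := hW.1.map _
  have hdeg : (f.map toHahn).degree ≠ 0 := by
    intro h
    have hd := natDegree_eq_of_degree_eq_some h
    rw [hW.1.natDegree_map] at hd
    exact hf.not_isUnit (eq_one_of_monic_natDegree_zero hW.1 hd ▸ isUnit_one)
  obtain ⟨γ, hγ⟩ := hsplit.1.exists_eval_eq_zero hdeg
  obtain ⟨N, hN⟩ := exists_hasPeriod (hsplit.2 γ ((mem_roots hfm.ne_zero).2 hγ))
  have hconj : ∀ α ∈ conjugates N γ, (f.map toHahn).eval α = 0 ∧ 0 < α.orderTop := by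
    intro α hα
    obtain ⟨j, rfl⟩ := hN.mem_conjugates.1 hα
    have := eval_map_toHahn_monodromy_eq_zero hγ j
    exact ⟨this, hW.orderTop_pos this⟩
  obtain ⟨Q, hQW, hQ⟩ :=
    exists_isWeierstrass_of_roots hf.ne_zero hconj (hN.map_monodromy_conjugates 1)
  have hQN : Q.natDegree = N := by
    rw [← hQW.1.natDegree_map toHahn, hQ, natDegree_multiset_prod_X_sub_C_eq_card, card_conjugates]
  have hdvd : Q ∣ f := by
    rw [← Polynomial.map_dvd_map toHahn toHahn_injective hQW.1, hQ,
      Multiset.prod_X_sub_C_dvd_iff_le_roots hfm.ne_zero,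
      Multiset.le_iff_subset hN.nodup_conjugates]
    exact fun α hα => (mem_roots hfm.ne_zero).2 (hconj α hα).1
  obtain rfl : f = Q := by
    refine eq_of_monic_of_associated hW.1 hQW.1 ((hf.dvd_iff.1 hdvd).resolve_left fun hu => ?_)
    exact hN.pos.ne' (hQN.symm.trans (natDegree_eq_zero_of_isUnit hu))
  refine ⟨γ, hW.orderTop_pos hγ, hQN ▸ hN, ?_⟩
  rw [hQ, roots_multiset_prod_X_sub_C, hQN]

end Period

/-! ## The branch and its characteristic exponents -/

section CharGcd

variable (b : ℕ → ℕ)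

theorem charGcd_dvd {t i : ℕ} (h : t ≤ i) : charGcd b i ∣ b t :=
  Finset.gcd_dvd (Finset.mem_range_succ_iff.2 h)

theorem dvd_mul_charGcd_iff (N : ℕ) (j : ℤ) (i : ℕ) :
    (N : ℤ) ∣ j * charGcd b i ↔ ∀ t ≤ i, (N : ℤ) ∣ j * b t := by
  simp only [← Int.natAbs_dvd_natAbs, Int.natAbs_mul, Int.natAbs_natCast]
  rw [charGcd, ← normalize_eq j.natAbs, ← Finset.gcd_mul_left, Finset.dvd_gcd_iff]
  simp only [Finset.mem_range_succ_iff, normalize_eq]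

end CharGcd

theorem card_filter_range_dvd_mul {N l : ℕ} (hN : 0 < N) (hl : l ∣ N) :
    ((Finset.range N).filter fun j => N ∣ j * l).card = l := by
  obtain ⟨d, rfl⟩ := hl
  have hl0 : 0 < l := Nat.pos_of_mul_pos_right hN
  have hd0 : 0 < d := Nat.pos_of_mul_pos_left hN
  have hdvd (j : ℕ) : l * d ∣ j * l ↔ j ≡ 0 [MOD d] := by
    rw [mul_comm j, Nat.mul_dvd_mul_iff_left hl0, Nat.modEq_zero_iff_dvd]
  simp only [hdvd]
  rw [← Nat.count_eq_card_filter_range, Nat.count_modEq_card _ hd0]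
  simp [hd0]

theorem expTwoPiI_mul_div_eq_one_iff {N : ℕ} (hN : N ≠ 0) (j : ℤ) (B : ℕ) :
    expTwoPiI (j * ((B : ℚ) / N)) = 1 ↔ (N : ℤ) ∣ j * B := by
  have hN' : (N : ℚ) ≠ 0 := Nat.cast_ne_zero.2 hN
  rw [expTwoPiI_eq_one_iff]
  refine exists_congr fun n => ?_
  rw [← mul_div_assoc, eq_div_iff hN', mul_comm (n : ℚ), eq_comm]
  norm_cast

theorem coeff_monodromy_sub_self (j : ℤ) (γ : HahnSeries ℚ ℂ) (q : ℚ) :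
    (monodromy j γ - γ).coeff q = (expTwoPiI (j * q) - 1) * γ.coeff q := by
  rw [HahnSeries.coeff_sub, coeff_monodromy, sub_one_mul]

theorem orderTop_monodromy_sub_monodromy (i j : ℤ) (γ : HahnSeries ℚ ℂ) :
    (monodromy i γ - monodromy j γ).orderTop = (monodromy (i - j) γ - γ).orderTop := by
  rw [← orderTop_monodromy j (monodromy (i - j) γ - γ), map_sub, ← monodromy_add, add_sub_cancel]

/-- The analogue, for a fractional power series `γ` with `N` conjugates, of a root of an
irreducible Weierstrass polynomial of degree `N` with Puiseux characteristic `(b 0, …, b g)`. -/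
structure IsBranch (N : ℕ) (γ : HahnSeries ℚ ℂ) (g : ℕ) (b : ℕ → ℕ) : Prop where
  hasPeriod : HasPeriod γ N
  orderTop_pos : 0 < γ.orderTop
  zero : b 0 = N
  strictMono : StrictMonoOn b (Set.Icc 1 g)
  contact (j : ℤ) : monodromy j γ ≠ γ → ∃ i ∈ Set.Icc 1 g,
    (monodromy j γ - γ).orderTop = (((b i : ℚ) / N : ℚ) : WithTop ℚ)
  exists_contact : ∀ i ∈ Set.Icc 1 g, ∃ j : ℤ,
    (monodromy j γ - γ).orderTop = (((b i : ℚ) / N : ℚ) : WithTop ℚ)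

theorem mem_roots_of_mem_zer_toSeries {P : Cx[X]} (hP : P ≠ 0) {α : HahnSeries ℚ ℂ}
    (hα : α ∈ Zer (toSeries P)) : α ∈ (P.map toHahn).roots :=
  (mem_roots (map_toHahn_ne_zero hP)).2 ((mem_zer_toSeries_iff hP).1 hα).1

theorem IsWeierstrass.mem_zer_iff_mem_roots {f : Cx[X]} (hW : IsWeierstrass f)
    {α : HahnSeries ℚ ℂ} : α ∈ Zer (toSeries f) ↔ α ∈ (f.map toHahn).roots := by
  rw [mem_zer_toSeries_iff hW.1.ne_zero, mem_roots (map_toHahn_ne_zero hW.1.ne_zero), IsRoot.def]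
  exact and_iff_left_of_imp hW.orderTop_pos

theorem exists_isBranch {f : Cx[X]} (hW : IsWeierstrass f) (hf : Irreducible f) {g : ℕ}
    {b : ℕ → ℕ} (hb : IsPuiseuxCharacteristic f g b) :
    ∃ γ : HahnSeries ℚ ℂ, IsBranch f.natDegree γ g b ∧
      (f.map toHahn).roots = conjugates f.natDegree γ := by
  obtain ⟨γ, hpos, hper, hroots⟩ := exists_roots_eq_conjugates hW hf
  have hzer (α : HahnSeries ℚ ℂ) : α ∈ Zer (toSeries f) ↔ ∃ j : ℤ, monodromy j γ = α := by
    rw [hW.mem_zer_iff_mem_roots, hroots, hper.mem_conjugates]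
  refine ⟨γ, ⟨hper, hpos, hb.zero, hb.strictMono, fun j hj => ?_, fun i hi => ?_⟩, hroots⟩
  · obtain ⟨i, hi, h⟩ := hb.contacts.subset
      ⟨_, (hzer _).2 ⟨j, rfl⟩, γ, (hzer _).2 ⟨0, monodromy_zero γ⟩, hj, rfl⟩
    exact ⟨i, hi, hb.zero ▸ h.symm⟩
  · obtain ⟨γ₁, h₁, γ₂, h₂, -, h⟩ := hb.contacts.superset ⟨i, hi, rfl⟩
    obtain ⟨i₁, rfl⟩ := (hzer _).1 h₁
    obtain ⟨i₂, rfl⟩ := (hzer _).1 h₂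
    refine ⟨i₁ - i₂, ?_⟩
    rw [← orderTop_monodromy_sub_monodromy, ← hb.zero]
    exact h.symm

/-- The height `h` lies in the `i`-th of the intervals into which the characteristic exponents
cut the line: `b i / N < h ≤ b (i + 1) / N`, where `b 0 / N` is read as `-∞` and
`b (g + 1) / N` as `+∞`. -/
structure InCharInterval (N g : ℕ) (b : ℕ → ℕ) (i : ℕ) (h : ℚ) : Prop where
  le : i ≤ g
  lt : 1 ≤ i → (b i : ℚ) / N < h
  le_succ : i < g → h ≤ (b (i + 1) : ℚ) / N

namespace IsBranch

variable {N : ℕ} {γ : HahnSeries ℚ ℂ} {g : ℕ} {b : ℕ → ℕ}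

theorem pos (hB : IsBranch N γ g b) : 0 < N := hB.hasPeriod.pos

theorem coeff_ne_zero (hB : IsBranch N γ g b) {i : ℕ} (hi : i ∈ Set.Icc 1 g) :
    γ.coeff ((b i : ℚ) / N) ≠ 0 := by
  obtain ⟨j, hj⟩ := hB.exists_contact i hi
  have := coeff_orderTop_ne hj
  rw [coeff_monodromy_sub_self] at this
  exact right_ne_zero_of_mul this

theorem coeff_monodromy_sub_self_eq_zero_iff (hB : IsBranch N γ g b) {i : ℕ}
    (hi : i ∈ Set.Icc 1 g) (j : ℤ) :
    (monodromy j γ - γ).coeff ((b i : ℚ) / N) = 0 ↔ (N : ℤ) ∣ j * b i := by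
  rw [coeff_monodromy_sub_self, mul_eq_zero, or_iff_left (hB.coeff_ne_zero hi),
    sub_eq_zero, expTwoPiI_mul_div_eq_one_iff hB.pos.ne']

theorem height_pos (hB : IsBranch N γ g b) {i : ℕ} (hi : i ∈ Set.Icc 1 g) :
    0 < (b i : ℚ) / N := by
  by_contra! h
  exact hB.coeff_ne_zero hi
    (coeff_eq_zero_of_lt_orderTop ((WithTop.coe_le_coe.2 h).trans_lt hB.orderTop_pos))

theorem height_lt_height (hB : IsBranch N γ g b) {s t : ℕ} (hs : 1 ≤ s) (hst : s < t)
    (ht : t ≤ g) : (b s : ℚ) / N < (b t : ℚ) / N := by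
  have hN : (0 : ℚ) < N := Nat.cast_pos.2 hB.pos
  have : (b s : ℚ) < b t := by
    exact_mod_cast hB.strictMono ⟨hs, by omega⟩ ⟨by omega, ht⟩ hst
  gcongr

theorem height_le_height (hB : IsBranch N γ g b) {s t : ℕ} (hs : 1 ≤ s) (hst : s ≤ t)
    (ht : t ≤ g) : (b s : ℚ) / N ≤ (b t : ℚ) / N := by
  rcases hst.eq_or_lt with rfl | hlt
  · exact le_rfl
  · exact (hB.height_lt_height hs hlt ht).le

theorem inCharInterval_succ (hB : IsBranch N γ g b) {i : ℕ} (hi : i < g) :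
    InCharInterval N g b i ((b (i + 1) : ℚ) / N) :=
  ⟨hi.le, fun h1 => hB.height_lt_height h1 (Nat.lt_succ_self i) hi, fun _ => le_rfl⟩

theorem charGcd_dvd_degree (hB : IsBranch N γ g b) (i : ℕ) : charGcd b i ∣ N :=
  hB.zero ▸ charGcd_dvd b (Nat.zero_le i)

theorem charGcd_pos (hB : IsBranch N γ g b) (i : ℕ) : 0 < charGcd b i :=
  Nat.pos_of_dvd_of_pos (hB.charGcd_dvd_degree i) hB.pos

theorem le_orderTop_monodromy_sub_iff (hB : IsBranch N γ g b) {i : ℕ} {h : ℚ}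
    (hi : InCharInterval N g b i h) (j : ℤ) :
    (h : WithTop ℚ) ≤ (monodromy j γ - γ).orderTop ↔ (N : ℤ) ∣ j * charGcd b i := by
  rw [dvd_mul_charGcd_iff]
  constructor
  · intro hle t ht
    rcases Nat.eq_zero_or_pos t with rfl | ht0
    · exact hB.zero ▸ dvd_mul_left _ _
    have hlt : (b t : ℚ) / N < h :=
      (hB.height_le_height ht0 ht hi.le).trans_lt (hi.lt (ht0.trans_le ht))
    exact (hB.coeff_monodromy_sub_self_eq_zero_iff ⟨ht0, ht.trans hi.le⟩ j).1
      (coe_le_orderTop_iff.1 hle _ hlt)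
  · intro hdvd
    by_cases hj : monodromy j γ = γ
    · simp only [hj, sub_self, orderTop_zero, le_top]
    obtain ⟨t, ht, hto⟩ := hB.contact j hj
    have hit : i < t := by
      by_contra! hle
      exact coeff_orderTop_ne hto
        ((hB.coeff_monodromy_sub_self_eq_zero_iff ht j).2 (hdvd t hle))
    rw [hto, WithTop.coe_le_coe]
    exact (hi.le_succ (hit.trans_le ht.2)).trans
      (hB.height_le_height (Nat.le_add_left 1 i) hit ht.2)

theorem charGcd_last (hB : IsBranch N γ g b) : charGcd b g = 1 := by
  obtain ⟨d, hd⟩ := hB.charGcd_dvd_degree g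
  have hfix : monodromy (d : ℤ) γ = γ := by
    by_contra hne
    obtain ⟨i, hi, ho⟩ := hB.contact d hne
    refine coeff_orderTop_ne ho ((hB.coeff_monodromy_sub_self_eq_zero_iff hi d).2 ?_)
    refine (dvd_mul_charGcd_iff b N d g).1 ?_ i hi.2
    exact_mod_cast (hd.trans (mul_comm _ _)).dvd
  have hNd : charGcd b g * d ∣ 1 * d := by
    rw [← hd, one_mul]
    exact_mod_cast (hB.hasPeriod.monodromy_eq_self_iff d).1 hfix
  have hd0 : 0 < d := Nat.pos_of_mul_pos_left (hd ▸ hB.pos)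
  exact Nat.dvd_one.1 (Nat.dvd_of_mul_dvd_mul_right hd0 hNd)

theorem charGcd_succ_ne (hB : IsBranch N γ g b) {i : ℕ} (hi : i < g) :
    charGcd b (i + 1) ≠ charGcd b i := by
  intro heq
  obtain ⟨j, hj⟩ := hB.exists_contact (i + 1) ⟨by omega, hi⟩
  have hdvd := (hB.le_orderTop_monodromy_sub_iff (hB.inCharInterval_succ hi) j).1 hj.ge
  rw [← heq, dvd_mul_charGcd_iff] at hdvd
  exact coeff_orderTop_ne hj
    ((hB.coeff_monodromy_sub_self_eq_zero_iff ⟨by omega, hi⟩ j).2 (hdvd (i + 1) le_rfl))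

end IsBranch

/-! ## Counting roots near the branch -/

theorem card_filter_eq_sum_map_ite {α : Type*} (s : Multiset α) (p : α → Prop) [DecidablePred p] :
    (s.filter p).card = (s.map fun a => if p a then 1 else 0).sum := by
  induction s using Multiset.induction_on with
  | empty => rfl
  | cons a s ih =>
    rw [Multiset.map_cons, Multiset.sum_cons, ← ih, Multiset.filter_cons, Multiset.card_add]
    split_ifs <;> simp

section BallCount

variable {Γ R : Type*} [LinearOrder Γ] [CommRing R]

theorem le_orderTop_sub_trans {a b c : HahnSeries Γ R} {h : WithTop Γ}
    (hab : h ≤ (a - b).orderTop) (hbc : h ≤ (b - c).orderTop) : h ≤ (a - c).orderTop := by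
  rw [← sub_add_sub_cancel a b c]
  exact (le_min hab hbc).trans min_orderTop_le_orderTop_add

theorem le_orderTop_sub_congr {a b c : HahnSeries Γ R} {h : WithTop Γ}
    (hab : h ≤ (a - b).orderTop) : h ≤ (a - c).orderTop ↔ h ≤ (b - c).orderTop :=
  ⟨le_orderTop_sub_trans (orderTop_sub_comm a b ▸ hab), le_orderTop_sub_trans hab⟩

theorem ballCount_congr (s : Multiset (HahnSeries Γ R)) {a b : HahnSeries Γ R} {h : Γ}
    (hab : (h : WithTop Γ) ≤ (a - b).orderTop) : ballCount s a h = ballCount s b h := by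
  unfold ballCount
  congr 1
  refine Multiset.filter_congr fun x _ => ?_
  rw [orderTop_sub_comm x a, orderTop_sub_comm x b, le_orderTop_sub_congr hab]

theorem ballCount_eq_sum (s : Multiset (HahnSeries Γ R)) (lam : HahnSeries Γ R) (h : Γ) :
    ballCount s lam h =
      (s.map fun a => if (h : WithTop Γ) ≤ (a - lam).orderTop then 1 else 0).sum :=
  card_filter_eq_sum_map_ite s _

theorem sum_map_ballCount_comm (s t : Multiset (HahnSeries Γ R)) (h : Γ) :
    (t.map fun c => ballCount s c h).sum = (s.map fun a => ballCount t a h).sum := by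
  simp only [ballCount_eq_sum]
  rw [Multiset.sum_map_sum_map]
  simp only [orderTop_sub_comm]

end BallCount

section Conjugation

theorem map_monodromy_eq_self {s : Multiset (HahnSeries ℚ ℂ)} (hs : s.map (monodromy 1) = s)
    (j : ℤ) : s.map (monodromy j) = s := by
  have hadd (i j : ℤ) : s.map (monodromy (i + j)) = (s.map (monodromy j)).map (monodromy i) := by
    simp only [Multiset.map_map, Function.comp_apply, monodromy_add]
  have hzero : s.map (monodromy 0) = s := by
    simp only [monodromy_zero, Multiset.map_id']
  have hneg : s.map (monodromy (-1)) = s := by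
    conv_lhs => rw [← hs]
    rw [← hadd, neg_add_cancel, hzero]
  induction j with
  | zero => exact hzero
  | succ j ih => rw [hadd, hs, ih]
  | pred j ih => rw [sub_eq_add_neg, hadd, hneg, ih]

theorem ballCount_monodromy {s : Multiset (HahnSeries ℚ ℂ)} (hs : s.map (monodromy 1) = s)
    (j : ℤ) (γ : HahnSeries ℚ ℂ) (h : ℚ) :
    ballCount s (monodromy j γ) h = ballCount s γ h := by
  conv_lhs => rw [← map_monodromy_eq_self hs j]
  simp only [ballCount_eq_sum, Multiset.map_map, Function.comp_apply, ← map_sub,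
    orderTop_monodromy]

/-- The contact of `α` with some conjugate of `γ` is at least `h`. -/
def IsNear (γ : HahnSeries ℚ ℂ) (h : ℚ) (α : HahnSeries ℚ ℂ) : Prop :=
  ∃ j : ℤ, (h : WithTop ℚ) ≤ (α - monodromy j γ).orderTop

theorem IsNear.mono {γ : HahnSeries ℚ ℂ} {h h' : ℚ} {α : HahnSeries ℚ ℂ} (hh : h' ≤ h)
    (hα : IsNear γ h α) : IsNear γ h' α :=
  hα.imp fun _ hj => (WithTop.coe_le_coe.2 hh).trans hj

theorem isNear_monodromy_iff {γ : HahnSeries ℚ ℂ} {h : ℚ} {α : HahnSeries ℚ ℂ} (i : ℤ) :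
    IsNear γ h (monodromy i α) ↔ IsNear γ h α := by
  refine ((Equiv.addLeft i).exists_congr fun j => ?_).symm
  rw [Equiv.coe_addLeft, monodromy_add, ← map_sub, orderTop_monodromy]

theorem IsBranch.ballCount_conjugates_self {N : ℕ} {γ : HahnSeries ℚ ℂ} {g : ℕ} {b : ℕ → ℕ}
    (hB : IsBranch N γ g b) {i : ℕ} {h : ℚ} (hi : InCharInterval N g b i h) :
    ballCount (conjugates N γ) γ h = charGcd b i := by
  rw [← card_filter_range_dvd_mul hB.pos (hB.charGcd_dvd_degree i), ballCount, conjugates,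
    Multiset.filter_map, Multiset.card_map, Finset.card_def, Finset.filter_val, Finset.range_val]
  congr 1
  refine Multiset.filter_congr fun j _ => ?_
  rw [Function.comp_apply, hB.le_orderTop_monodromy_sub_iff hi]
  norm_cast

open Classical in
theorem IsBranch.ballCount_conjugates {N : ℕ} {γ : HahnSeries ℚ ℂ} {g : ℕ} {b : ℕ → ℕ}
    (hB : IsBranch N γ g b) {i : ℕ} {h : ℚ} (hi : InCharInterval N g b i h)
    (α : HahnSeries ℚ ℂ) :
    ballCount (conjugates N γ) α h = if IsNear γ h α then charGcd b i else 0 := by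
  split_ifs with hα
  · obtain ⟨j, hj⟩ := hα
    rw [ballCount_congr _ hj, ballCount_monodromy (hB.hasPeriod.map_monodromy_conjugates 1),
      hB.ballCount_conjugates_self hi]
  · rw [ballCount, Multiset.card_eq_zero, Multiset.filter_eq_nil]
    rintro c hc hle
    obtain ⟨j, rfl⟩ := hB.hasPeriod.mem_conjugates.1 hc
    exact hα ⟨j, orderTop_sub_comm α _ ▸ hle⟩

open Classical in
/-- Double counting of the pairs of a conjugate of `γ` and a member of `s` at contact at least
`h`. -/
theorem IsBranch.mul_ballCount {N : ℕ} {γ : HahnSeries ℚ ℂ} {g : ℕ} {b : ℕ → ℕ}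
    (hB : IsBranch N γ g b) {i : ℕ} {h : ℚ} (hi : InCharInterval N g b i h)
    {s : Multiset (HahnSeries ℚ ℂ)} (hs : s.map (monodromy 1) = s) :
    N * ballCount s γ h = charGcd b i * (s.filter (IsNear γ h)).card := by
  have hconj : ((conjugates N γ).map fun c => ballCount s c h).sum = N * ballCount s γ h := by
    have hconst : ∀ c ∈ conjugates N γ, ballCount s c h = ballCount s γ h := fun c hc => by
      obtain ⟨j, rfl⟩ := hB.hasPeriod.mem_conjugates.1 hc
      exact ballCount_monodromy hs j γ h
    rw [Multiset.map_congr rfl hconst, Multiset.map_const', Multiset.sum_replicate,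
      card_conjugates, smul_eq_mul]
  rw [← hconj, sum_map_ballCount_comm, card_filter_eq_sum_map_ite,
    ← Multiset.sum_map_mul_left]
  simp only [hB.ballCount_conjugates hi, mul_ite, mul_one, mul_zero]

theorem splits_of_map_monodromy {Q : (HahnSeries ℚ ℂ)[X]} (hQ : Q.map (monodromy 1) = Q) :
    Q.Splits :=
  (splits_of_coeff_mem_puiseuxField fun i => mem_puiseuxField.2
    ⟨1, monodromy_eq_self_iff_mem_rangeS.1 (by
      conv_rhs => rw [← hQ]
      rw [coeff_map]
      rfl)⟩).1

theorem roots_map_monodromy {Q : (HahnSeries ℚ ℂ)[X]} (hQ : Q.map (monodromy 1) = Q) :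
    Q.roots.map (monodromy 1) = Q.roots := by
  conv_rhs => rw [← hQ]
  exact ((splits_of_map_monodromy hQ).roots_map (monodromy 1)).symm

end Conjugation

/-! ## Approximate roots -/

section ApproximateRoot

variable {A : Type*} [CommRing A] {p : ℕ} {f h k : A[X]}

theorem IsApproximateRoot.mul_natDegree [Nontrivial A] (hh : IsApproximateRoot p f h)
    (hf : f.Monic) : p * h.natDegree = f.natDegree := by
  have hlt : (f - h ^ p).degree < f.degree := by
    rw [degree_eq_natDegree hf.ne_zero]
    exact hh.2.trans_le (by exact_mod_cast Nat.sub_le _ _)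
  rw [← hh.1.natDegree_pow, ← natDegree_eq_of_degree_eq (degree_sub_eq_left_of_degree_lt hlt),
    sub_sub_cancel]

theorem IsApproximateRoot.map {B : Type*} [CommRing B] [Nontrivial B] (φ : A →+* B)
    (hh : IsApproximateRoot p f h) (hf : f.Monic) :
    IsApproximateRoot p (f.map φ) (h.map φ) := by
  refine ⟨hh.1.map φ, ?_⟩
  rw [hf.natDegree_map, ← Polynomial.map_pow, ← Polynomial.map_sub]
  exact degree_map_le.trans_lt hh.2

theorem coeff_geom_sum_of_monic {d : ℕ} (hh : h.Monic) (hk : k.Monic) (hhd : h.natDegree = d)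
    (hkd : k.natDegree = d) (p : ℕ) :
    (∑ i ∈ Finset.range p, h ^ i * k ^ (p - 1 - i)).coeff ((p - 1) * d) = p := by
  have hterm : ∀ i ∈ Finset.range p, (h ^ i * k ^ (p - 1 - i)).coeff ((p - 1) * d) = 1 :=
    fun i hi => by
    have hdeg : (h ^ i * k ^ (p - 1 - i)).natDegree = (p - 1) * d := by
      rw [(hh.pow i).natDegree_mul (hk.pow _), hh.natDegree_pow, hk.natDegree_pow, hhd, hkd,
        ← add_mul, Nat.add_sub_cancel' (Nat.le_sub_one_of_lt (Finset.mem_range.1 hi))]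
    rw [← hdeg]
    exact (hh.pow i).mul (hk.pow _)
  rw [finsetSum_coeff, Finset.sum_congr rfl hterm, Finset.sum_const, Finset.card_range,
    nsmul_one]

theorem IsApproximateRoot.unique [IsDomain A] (hh : IsApproximateRoot p f h)
    (hk : IsApproximateRoot p f k) (hf : f.Monic) (hp : (p : A) ≠ 0) : h = k := by
  have hp0 : p ≠ 0 := by
    rintro rfl
    exact hp Nat.cast_zero
  have hdeg : k.natDegree = h.natDegree :=
    Nat.eq_of_mul_eq_mul_left (Nat.pos_of_ne_zero hp0)
      ((hk.mul_natDegree hf).trans (hh.mul_natDegree hf).symm)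
  have hpd : f.natDegree - f.natDegree / p = (p - 1) * h.natDegree := by
    rw [← hh.mul_natDegree hf, Nat.mul_div_cancel_left _ (Nat.pos_of_ne_zero hp0), Nat.sub_one_mul]
  by_contra hne
  have hlt : (h ^ p - k ^ p).degree < (((p - 1) * h.natDegree : ℕ) : WithBot ℕ) := by
    rw [← sub_sub_sub_cancel_left (k ^ p) (h ^ p) f, ← hpd]
    exact (degree_sub_le _ _).trans_lt (max_lt hk.2 hh.2)
  have hle : (((p - 1) * h.natDegree : ℕ) : WithBot ℕ) ≤
      (∑ i ∈ Finset.range p, h ^ i * k ^ (p - 1 - i)).degree := by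
    refine le_degree_of_ne_zero ?_
    rwa [coeff_geom_sum_of_monic hh.1 hk.1 rfl hdeg]
  rw [← geom_sum₂_mul, degree_mul] at hlt
  exact hlt.not_ge
    (hle.trans (le_add_of_nonneg_right (zero_le_degree_iff.2 (sub_ne_zero.2 hne))))

theorem natDegree_add_pow_sub_le {q u : A[X]} {d e : ℕ} (hq : q.natDegree ≤ d)
    (hu : u.natDegree ≤ e) (hed : e ≤ d) (m : ℕ) :
    ((q + u) ^ (m + 2) - q ^ (m + 2) - ((m + 2 : ℕ) : A[X]) * q ^ (m + 1) * u).natDegree ≤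
      m * d + 2 * e := by
  have hexp : (q + u) ^ (m + 2) - q ^ (m + 2) - ((m + 2 : ℕ) : A[X]) * q ^ (m + 1) * u =
      ∑ i ∈ Finset.range (m + 1), u ^ (i + 2) * q ^ (m - i) * ((m + 2).choose (i + 2) : A[X]) := by
    rw [add_comm q, add_pow, Finset.sum_range_succ', Finset.sum_range_succ']
    simp only [Nat.choose_zero_right, Nat.choose_one_right, zero_add, pow_zero, pow_one, one_mul,
      Nat.cast_one, mul_one, Nat.sub_zero, add_assoc, Nat.reduceAdd, Nat.add_sub_add_right,
      show m + 2 - 1 = m + 1 from rfl]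
    ring
  rw [hexp]
  refine natDegree_sum_le_of_forall_le _ _ fun i hi => ?_
  rw [Finset.mem_range_succ_iff] at hi
  obtain ⟨j, rfl⟩ := Nat.exists_eq_add_of_le hi
  rw [Nat.add_sub_cancel_left]
  calc _ ≤ (i + 2) * e + j * d + 0 := natDegree_mul_le_of_le (natDegree_mul_le_of_le
        (natDegree_pow_le_of_le _ hu) (natDegree_pow_le_of_le _ hq)) (natDegree_natCast _).le
    _ ≤ (i + j) * d + 2 * e := by nlinarith

end ApproximateRoot

section NewtonStep

variable {K : Type*} [Field K] {p : ℕ} {f q : K[X]}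

/-- One step of Newton's method for the equation `q ^ p = f`, with the error `f - q ^ p` divided by
`q ^ (p - 1)` with remainder. -/
def newtonStep (p : ℕ) (f q : K[X]) : K[X] :=
  q + C (p : K)⁻¹ * ((f - q ^ p) /ₘ q ^ (p - 1))

theorem degree_divByMonic_pow_lt (hf : f.Monic) (hq : q.Monic)
    (hd : f.natDegree = p * q.natDegree) :
    ((f - q ^ p) /ₘ q ^ (p - 1)).degree < q.degree := by
  have hqp := hq.pow p
  have hfq : f.degree = (q ^ p).degree := by
    rw [degree_eq_natDegree hf.ne_zero, degree_eq_natDegree hqp.ne_zero, hq.natDegree_pow, hd]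
  have hlt := degree_sub_lt_left hfq hf.ne_zero (hf.leadingCoeff.trans hqp.leadingCoeff.symm)
  by_cases hE : f - q ^ p = 0
  · rw [hE, zero_divByMonic, degree_zero, bot_lt_iff_ne_bot]
    exact degree_ne_bot.2 hq.ne_zero
  rw [degree_eq_natDegree hE, degree_eq_natDegree hf.ne_zero, Nat.cast_lt, hd] at hlt
  refine degree_le_natDegree.trans_lt ?_
  rw [natDegree_divByMonic _ (hq.pow _), hq.natDegree_pow, degree_eq_natDegree hq.ne_zero,
    Nat.cast_lt]
  have hp : p - 1 + 1 = p := Nat.sub_add_cancel (Nat.pos_of_ne_zero fun h => by simp [h] at hlt)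
  have hsucc : p * q.natDegree = (p - 1) * q.natDegree + q.natDegree := by
    rw [← Nat.succ_mul, Nat.succ_eq_add_one, hp]
  have : 0 < q.natDegree := Nat.pos_of_ne_zero fun h => by simp [h] at hlt
  omega

theorem sub_newtonStep_pow (hp : (p : K) ≠ 0) :
    f - newtonStep p f q ^ p = (f - q ^ p) %ₘ q ^ (p - 1) -
      (newtonStep p f q ^ p - q ^ p - (p : K[X]) * q ^ (p - 1) * (newtonStep p f q - q)) := by
  have hcorr : (p : K[X]) * (newtonStep p f q - q) = (f - q ^ p) /ₘ q ^ (p - 1) := by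
    rw [newtonStep, add_sub_cancel_left, ← C_eq_natCast, ← mul_assoc, ← C_mul, mul_inv_cancel₀ hp,
      C_1, one_mul]
  linear_combination -q ^ (p - 1) * hcorr - modByMonic_add_div (f - q ^ p) (q ^ (p - 1))

theorem degree_sub_newtonStep_pow_lt [CharZero K] (hp : 2 ≤ p) (hf : f.Monic) (hq : q.Monic)
    (hd : f.natDegree = p * q.natDegree) (hE : (q ^ (p - 1)).degree ≤ (f - q ^ p).degree) :
    (f - newtonStep p f q ^ p).degree < (f - q ^ p).degree := by
  obtain ⟨m, rfl⟩ := Nat.exists_eq_add_of_le' hp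
  have hp0 : ((m + 2 : ℕ) : K) ≠ 0 := Nat.cast_ne_zero.2 (by omega)
  have hD : (q ^ (m + 1)).Monic := hq.pow _
  have hE0 : f - q ^ (m + 2) ≠ 0 := by
    intro h
    rw [h, degree_zero, le_bot_iff, degree_eq_bot] at hE
    exact hD.ne_zero hE
  have hr0 : (f - q ^ (m + 2)) /ₘ q ^ (m + 1) ≠ 0 := by
    rw [Ne, divByMonic_eq_zero_iff hD]
    exact hE.not_gt
  have hrd : ((f - q ^ (m + 2)) /ₘ q ^ (m + 1)).natDegree < q.natDegree :=
    natDegree_lt_natDegree hr0 (degree_divByMonic_pow_lt hf hq hd)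
  have hr := natDegree_divByMonic (f - q ^ (m + 2)) hD
  have hle : (q ^ (m + 1)).natDegree ≤ (f - q ^ (m + 2)).natDegree := natDegree_le_natDegree hE
  rw [hq.natDegree_pow] at hr hle
  have hud : (newtonStep (m + 2) f q - q).natDegree =
      ((f - q ^ (m + 2)) /ₘ q ^ (m + 1)).natDegree := by
    rw [newtonStep, add_sub_cancel_left]
    exact natDegree_C_mul (inv_ne_zero hp0)
  rw [sub_newtonStep_pow hp0]
  refine (degree_sub_le _ _).trans_lt (max_lt ((degree_modByMonic_lt _ hD).trans_le hE) ?_)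
  refine degree_le_natDegree.trans_lt ?_
  rw [degree_eq_natDegree hE0, Nat.cast_lt]
  have hbound := natDegree_add_pow_sub_le le_rfl hud.le hrd.le m
  rw [add_sub_cancel] at hbound
  have hsucc : (m + 1) * q.natDegree = m * q.natDegree + q.natDegree := Nat.succ_mul _ _
  refine hbound.trans_lt ?_
  omega

end NewtonStep

/-! ## Initial forms of approximate roots -/

theorem HasInit.exists_degree_le {Γ R : Type*} [AddCommMonoid Γ] [LinearOrder Γ]
    [IsOrderedCancelAddMonoid Γ] [CommRing R] {P : (HahnSeries Γ R)[X]} {A B : Γ} {F : R[X]}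
    (hP : HasInit P A F) (hBA : B ≤ A) :
    ∃ G : R[X], HasInit P B G ∧ G.degree ≤ F.degree := by
  rcases hBA.eq_or_lt with rfl | hlt
  · exact ⟨F, hP, le_rfl⟩
  · exact ⟨0, hP.of_lt hlt, degree_zero.trans_le bot_le⟩

/-- A condition ensuring that the ball of radius `H` about `lam` has at least `d` conjugates: among
the roots of a polynomial with coefficients in `ℂ((x))`, at most one in `d` lies in the ball. -/
def HasConjugateBalls (lam : HahnSeries ℚ ℂ) (H : ℚ) (d : ℕ) : Prop :=
  ∀ Q : (HahnSeries ℚ ℂ)[X], Q.map (monodromy 1) = Q → d * ballCount Q.roots lam H ≤ Q.natDegree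

theorem HasConjugateBalls.degree_lt {lam : HahnSeries ℚ ℂ} {H A : ℚ} {d m : ℕ}
    (hball : HasConjugateBalls lam H d) {Q : (HahnSeries ℚ ℂ)[X]} {F : ℂ[X]}
    (hQ : Q.map (monodromy 1) = Q) (hI : HasInit (Q.comp (ballVar lam H)) A F)
    (hlt : Q.degree < ((m * d : ℕ) : WithBot ℕ)) : F.degree < (m : WithBot ℕ) := by
  by_cases hF : F = 0
  · rw [hF, degree_zero]
    exact WithBot.bot_lt_coe m
  have hQ0 : Q ≠ 0 := by
    rintro rfl
    rw [zero_comp] at hI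
    exact hF (hI.unique (HasInit.zero A))
  have hle := hball Q hQ
  rw [← natDegree_eq_ballCount (splits_of_map_monodromy hQ) hF hI, mul_comm] at hle
  rw [degree_eq_natDegree hQ0, Nat.cast_lt] at hlt
  rw [degree_eq_natDegree hF, Nat.cast_lt]
  exact Nat.lt_of_mul_lt_mul_right (hle.trans_lt hlt)

/-- `q` is monic of degree `d` with coefficients in `ℂ((x))`, and `x^B (c z)` is its initial form
on the ball of radius `H` about `lam`. The approximate roots of the branch turn out to be of this
kind. -/
structure IsAdapted (lam : HahnSeries ℚ ℂ) (H : ℚ) (d : ℕ) (B : ℚ) (c : ℂ)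
    (q : (HahnSeries ℚ ℂ)[X]) : Prop where
  monic : q.Monic
  natDegree : q.natDegree = d
  map_monodromy : q.map (monodromy 1) = q
  init : HasInit (q.comp (ballVar lam H)) B (C c * X)

namespace IsAdapted

variable {lam : HahnSeries ℚ ℂ} {H B : ℚ} {d p : ℕ} {c : ℂ} {f q : (HahnSeries ℚ ℂ)[X]} {F : ℂ[X]}

/-- If the initial form of the quotient came from a smaller weight, it would be a constant times
`z ^ m` in the initial form of the remainder, whose degree is too small for that. -/
theorem hasInit_divByMonic (hq : IsAdapted lam H d B c q) (hc : c ≠ 0)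
    (hball : HasConjugateBalls lam H d) {E : (HahnSeries ℚ ℂ)[X]} (hE : E.map (monodromy 1) = E)
    {m : ℕ} (hEI : HasInit (E.comp (ballVar lam H)) (B + m • B) F)
    (hF : F.degree < (m : WithBot ℕ)) (hr : (E /ₘ q ^ m).degree < (d : WithBot ℕ)) :
    HasInit ((E /ₘ q ^ m).comp (ballVar lam H)) B 0 := by
  have hD : (q ^ m).Monic := hq.monic.pow m
  have hDd : (q ^ m).degree = ((m * d : ℕ) : WithBot ℕ) := by
    rw [degree_eq_natDegree hD.ne_zero, hq.monic.natDegree_pow, hq.natDegree]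
  have hDt : (q ^ m).map (monodromy 1) = q ^ m := by rw [Polynomial.map_pow, hq.map_monodromy]
  have hrt : (E /ₘ q ^ m).map (monodromy 1) = E /ₘ q ^ m := by rw [map_divByMonic _ hD, hE, hDt]
  have hst : (E %ₘ q ^ m).map (monodromy 1) = E %ₘ q ^ m := by rw [map_modByMonic _ hD, hE, hDt]
  by_cases hr0 : E /ₘ q ^ m = 0
  · rw [hr0, zero_comp]
    exact HasInit.zero B
  obtain ⟨ρ, R, hR0, -, hRI⟩ := exists_hasInit_of_splits (splits_of_map_monodromy hrt) hr0 lam H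
  rcases lt_or_ge B ρ with hlt | hle
  · exact hRI.of_lt hlt
  exfalso
  obtain ⟨G, hGI, hGF⟩ := hEI.exists_degree_le (add_le_add_left hle (m • B))
  have hsI : HasInit ((E %ₘ q ^ m).comp (ballVar lam H)) (ρ + m • B) (G - R * (C c * X) ^ m) := by
    have hmod : E %ₘ q ^ m = E - (E /ₘ q ^ m) * q ^ m := by
      linear_combination modByMonic_add_div E (q ^ m)
    have hqm := hRI.mul (hq.init.pow m)
    have hcomp : (E %ₘ q ^ m).comp (ballVar lam H) = E.comp (ballVar lam H) -
        (E /ₘ q ^ m).comp (ballVar lam H) * q.comp (ballVar lam H) ^ m := by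
      rw [hmod, sub_comp, Polynomial.mul_comp, pow_comp]
    rw [hcomp]
    exact hGI.sub hqm
  have hRd : R.degree < ((1 : ℕ) : WithBot ℕ) := hball.degree_lt hrt hRI (by rwa [one_mul])
  have hlead : (R * (C c * X) ^ m).degree = (m : WithBot ℕ) := by
    have hR : R.degree = 0 := by
      rw [degree_eq_natDegree hR0, Nat.cast_lt, Nat.lt_one_iff] at hRd
      rw [degree_eq_natDegree hR0, hRd, Nat.cast_zero]
    rw [degree_mul, degree_pow, degree_C_mul hc, degree_X, hR, zero_add, nsmul_one]
  have hslt := hball.degree_lt hst hsI (hDd ▸ degree_modByMonic_lt E hD)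
  rw [degree_sub_eq_right_of_degree_lt (hlead ▸ hGF.trans_lt hF), hlead] at hslt
  exact hslt.false

theorem newtonStep (hq : IsAdapted lam H d B c q) (hc : c ≠ 0) (hball : HasConjugateBalls lam H d)
    (hp : p ≠ 0) (hf : f.Monic) (hfd : f.natDegree = p * d) (hft : f.map (monodromy 1) = f)
    (hfI : HasInit (f.comp (ballVar lam H)) (p • B) F)
    (hF : (F - (C c * X) ^ p).degree < ((p - 1 : ℕ) : WithBot ℕ)) :
    IsAdapted lam H d B c (newtonStep p f q) := by
  have hD : (q ^ (p - 1)).Monic := hq.monic.pow _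
  have hEt : (f - q ^ p).map (monodromy 1) = f - q ^ p := by
    rw [Polynomial.map_sub, Polynomial.map_pow, hft, hq.map_monodromy]
  have hrq := degree_divByMonic_pow_lt hf hq.monic (hq.natDegree.symm ▸ hfd)
  have hEI : HasInit ((f - q ^ p).comp (ballVar lam H)) (B + (p - 1) • B)
      (F - (C c * X) ^ p) := by
    rw [← succ_nsmul', Nat.sub_add_cancel (Nat.pos_of_ne_zero hp), sub_comp, pow_comp]
    exact hfI.sub (hq.init.pow p)
  have hrI := hq.hasInit_divByMonic hc hball hEt hEI hF
    (by rwa [degree_eq_natDegree hq.monic.ne_zero, hq.natDegree] at hrq)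
  have huI : HasInit ((C (p : HahnSeries ℚ ℂ)⁻¹ *
      ((f - q ^ p) /ₘ q ^ (p - 1))).comp (ballVar lam H)) B 0 := by
    have hpc : (p : HahnSeries ℚ ℂ)⁻¹ = HahnSeries.C (p : ℂ)⁻¹ := by rw [map_inv₀, map_natCast]
    have h0 : ((0 : ℚ) : WithTop ℚ) ≤ ((p : HahnSeries ℚ ℂ)⁻¹).orderTop :=
      hpc ▸ orderTop_single_le
    rw [Polynomial.mul_comp, C_comp]
    simpa only [zero_add, mul_zero] using (HasInit.const h0).mul hrI
  have huq : (C (p : HahnSeries ℚ ℂ)⁻¹ * ((f - q ^ p) /ₘ q ^ (p - 1))).degree < q.degree :=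
    (degree_C_mul (inv_ne_zero (Nat.cast_ne_zero.2 hp))).trans_lt hrq
  refine ⟨hq.monic.add_of_left huq, ?_, ?_, ?_⟩
  · rw [PlaneBranch.newtonStep, natDegree_add_eq_left_of_degree_lt huq, hq.natDegree]
  · rw [PlaneBranch.newtonStep, Polynomial.map_add, Polynomial.map_mul, Polynomial.map_C,
      map_divByMonic _ hD, hEt, Polynomial.map_pow, hq.map_monodromy, map_inv₀, map_natCast]
  · rw [PlaneBranch.newtonStep, add_comp]
    simpa only [add_zero] using hq.init.add huI

theorem exists_isApproximateRoot (hq : IsAdapted lam H d B c q) (hc : c ≠ 0)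
    (hball : HasConjugateBalls lam H d)
    (hp : 2 ≤ p) (hf : f.Monic) (hfd : f.natDegree = p * d) (hft : f.map (monodromy 1) = f)
    (hfI : HasInit (f.comp (ballVar lam H)) (p • B) F)
    (hF : (F - (C c * X) ^ p).degree < ((p - 1 : ℕ) : WithBot ℕ)) :
    ∃ q', IsAdapted lam H d B c q' ∧ IsApproximateRoot p f q' := by
  induction hn : (f - q ^ p).degree using WellFoundedLT.induction generalizing q with
  | ind n ih =>
    by_cases hE : (q ^ (p - 1)).degree ≤ (f - q ^ p).degree
    · refine ih _ (hn ▸ ?_) (hq.newtonStep hc hball (by omega) hf hfd hft hfI hF) rfl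
      exact degree_sub_newtonStep_pow_lt hp hf hq.monic (hq.natDegree.symm ▸ hfd) hE
    · refine ⟨q, hq, hq.monic, ?_⟩
      rw [hfd, Nat.mul_div_cancel_left _ (by omega), ← Nat.sub_one_mul]
      rwa [not_le, degree_eq_natDegree (hq.monic.pow _).ne_zero, hq.monic.natDegree_pow,
        hq.natDegree] at hE

end IsAdapted

/-! ## The branch cut off before a characteristic exponent -/

theorem prod_range_mul {M : Type*} [CommMonoid M] (F : ℕ → M) (d p : ℕ) :
    ∏ i ∈ Finset.range (d * p), F i =
      ∏ t ∈ Finset.range p, ∏ j ∈ Finset.range d, F (d * t + j) := by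
  induction p with
  | zero => rw [mul_zero, Finset.prod_range_zero, Finset.prod_range_zero]
  | succ p ih => rw [mul_add, mul_one, Finset.prod_range_add, ih, Finset.prod_range_succ]

theorem HasInit.X_sub_C_congr {Γ R : Type*} [AddCommGroup Γ] [LinearOrder Γ]
    [IsOrderedAddMonoid Γ] [CommRing R] {lam u v : HahnSeries Γ R} {H o : Γ} {F : R[X]}
    (hv : HasInit ((X - C v).comp (ballVar lam H)) o F) (ho : o < H)
    (huv : (H : WithTop Γ) ≤ (u - v).orderTop) :
    HasInit ((X - C u).comp (ballVar lam H)) o F := by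
  have hcomp : (X - C u).comp (ballVar lam H) =
      (X - C v).comp (ballVar lam H) - C (u - v) := by
    simp only [sub_comp, X_comp, C_comp, C_sub]
    ring
  rw [hcomp, ← sub_zero F]
  exact hv.sub ((HasInit.const huv).of_lt ho)

theorem prod_X_sub_C_conjugates (N : ℕ) (γ : HahnSeries ℚ ℂ) :
    ((conjugates N γ).map fun α => X - C α).prod =
      ∏ j ∈ Finset.range N, (X - C (monodromy (j : ℤ) γ)) := by
  rw [conjugates, Multiset.map_map]
  rfl

theorem HasPeriod.map_monodromy_prod_X_sub_C {γ : HahnSeries ℚ ℂ} {N : ℕ} (hγ : HasPeriod γ N) :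
    ((conjugates N γ).map fun α => X - C α).prod.map (monodromy 1) =
      ((conjugates N γ).map fun α => X - C α).prod := by
  conv_rhs => rw [← hγ.map_monodromy_conjugates 1, Multiset.map_map]
  rw [Polynomial.map_multiset_prod, Multiset.map_map]
  simp only [Function.comp_def, Polynomial.map_sub, map_X, Polynomial.map_C]

section FarConjugates

variable {lam : HahnSeries ℚ ℂ} {H : ℚ} {d : ℕ}

theorem exists_hasInit_X_sub_C_monodromy (hpos : 0 < lam.orderTop) {j : ℤ}
    (hj : (monodromy j lam - lam).orderTop < H) :
    ∃ (o : ℚ) (c : ℂ), 0 < o ∧ o < H ∧ c ≠ 0 ∧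
      HasInit ((X - C (monodromy j lam)).comp (ballVar lam H)) o (C c) := by
  obtain ⟨o, ho⟩ := WithTop.ne_top_iff_exists.1 (ne_top_of_lt hj)
  rw [← ho, WithTop.coe_lt_coe] at hj
  have hne := coeff_orderTop_ne ho.symm
  refine ⟨o, _, ?_, hj, ?_, hasInit_X_sub_C_of_lt ho.symm hj⟩
  · rw [coeff_monodromy_sub_self] at hne
    have hle := orderTop_le_of_coeff_ne_zero (right_ne_zero_of_mul hne)
    exact WithTop.coe_pos.1 (hpos.trans_le hle)
  · rwa [← neg_sub, HahnSeries.coeff_neg, neg_ne_zero]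

/-- Only the factor with `j = 0` sees the ball; each of the others is dominated by a constant that
depends on `u j` only through its terms of degree `< H`. -/
theorem exists_hasInit_prod_X_sub_C (hd : 0 < d) (hH : 0 < H) (hpos : 0 < lam.orderTop)
    (hfar : ∀ j : ℤ, (H : WithTop ℚ) ≤ (monodromy j lam - lam).orderTop → (d : ℤ) ∣ j) :
    ∃ (B : ℚ) (c : ℂ), 0 < B ∧ c ≠ 0 ∧ ∀ u : ℕ → HahnSeries ℚ ℂ,
      (∀ j : ℕ, (H : WithTop ℚ) ≤ (u j - monodromy j lam).orderTop) →
        HasInit ((∏ j ∈ Finset.range d, (X - C (u j))).comp (ballVar lam H)) B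
          (C c * (X - C ((u 0 - lam).coeff H))) := by
  obtain ⟨e, rfl⟩ := Nat.exists_eq_add_one_of_ne_zero hd.ne'
  have hfactor : ∀ j ∈ Finset.range e, ∃ (o : ℚ) (c : ℂ), 0 < o ∧ o < H ∧ c ≠ 0 ∧
      HasInit ((X - C (monodromy ((j + 1 : ℕ) : ℤ) lam)).comp (ballVar lam H)) o (C c) := by
    refine fun j hj => exists_hasInit_X_sub_C_monodromy hpos (lt_of_not_ge fun hle => ?_)
    have hdvd := Nat.le_of_dvd j.succ_pos (Int.natCast_dvd_natCast.1 (hfar _ hle))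
    rw [Finset.mem_range] at hj
    omega
  choose! o c ho hoH hc hI using hfactor
  refine ⟨∑ j ∈ Finset.range e, o j + H, ∏ j ∈ Finset.range e, c j,
    add_pos_of_nonneg_of_pos (Finset.sum_nonneg fun j hj => (ho j hj).le) hH,
    Finset.prod_ne_zero_iff.2 hc, fun u hu => ?_⟩
  rw [Finset.prod_range_succ', Polynomial.mul_comp, prod_comp, map_prod]
  have hu0 := hu 0
  rw [Nat.cast_zero, monodromy_zero] at hu0
  exact (HasInit.prod _ fun j hj => (hI j hj).X_sub_C_congr (hoH j hj) (hu (j + 1))).mul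
    (hasInit_X_sub_C_of_le hu0)

theorem HasPeriod.exists_isAdapted (hd : HasPeriod lam d) (hH : 0 < H) (hpos : 0 < lam.orderTop)
    (hfar : ∀ j : ℤ, (H : WithTop ℚ) ≤ (monodromy j lam - lam).orderTop → (d : ℤ) ∣ j) :
    ∃ (B : ℚ) (c : ℂ) (q : (HahnSeries ℚ ℂ)[X]), 0 < B ∧ c ≠ 0 ∧ IsAdapted lam H d B c q ∧
      ∀ u : ℕ → HahnSeries ℚ ℂ, (∀ j : ℕ, (H : WithTop ℚ) ≤ (u j - monodromy j lam).orderTop) →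
        HasInit ((∏ j ∈ Finset.range d, (X - C (u j))).comp (ballVar lam H)) B
          (C c * (X - C ((u 0 - lam).coeff H))) := by
  obtain ⟨B, c, hB, hc, hI⟩ := exists_hasInit_prod_X_sub_C hd.pos hH hpos hfar
  refine ⟨B, c, _, hB, hc, ⟨monic_multisetProd_X_sub_C _, ?_, hd.map_monodromy_prod_X_sub_C, ?_⟩,
    hI⟩
  · rw [natDegree_multiset_prod_X_sub_C_eq_card, card_conjugates]
  · have hinit := hI (fun j => monodromy j lam) fun j => by
      rw [sub_self, orderTop_zero]
      exact le_top
    rwa [Nat.cast_zero, monodromy_zero, sub_self, HahnSeries.coeff_zero, C_0, sub_zero,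
      ← prod_X_sub_C_conjugates] at hinit

end FarConjugates

theorem orderTop_le_orderTop_truncLT {Γ R : Type*} [LinearOrder Γ] [Zero R] (x : HahnSeries Γ R)
    (H : Γ) : x.orderTop ≤ (truncLT H x).orderTop := by
  by_cases htop : (truncLT H x).orderTop = ⊤
  · exact htop ▸ le_top
  obtain ⟨o, ho⟩ := WithTop.ne_top_iff_exists.1 htop
  have hne := coeff_orderTop_ne ho.symm
  rw [HahnSeries.coeff_truncLT] at hne
  exact ho ▸ orderTop_le_of_coeff_ne_zero fun h => hne (by rw [h, ite_self])

theorem le_orderTop_sub_truncLT {Γ R : Type*} [LinearOrder Γ] [AddGroup R] (x : HahnSeries Γ R)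
    (H : Γ) : (H : WithTop Γ) ≤ (x - truncLT H x).orderTop :=
  coe_le_orderTop_iff.2 fun q hq => by
    rw [HahnSeries.coeff_sub, coeff_truncLT_of_lt hq, sub_self]

section Truncation

variable {γ : HahnSeries ℚ ℂ} {H : ℚ}

theorem le_orderTop_monodromy_truncLT_sub_iff (j : ℤ) :
    (H : WithTop ℚ) ≤ (monodromy j (truncLT H γ) - truncLT H γ).orderTop ↔
      (H : WithTop ℚ) ≤ (monodromy j γ - γ).orderTop := by
  rw [coe_le_orderTop_iff, coe_le_orderTop_iff]
  refine forall₂_congr fun q hq => ?_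
  rw [coeff_monodromy_sub_self, coeff_monodromy_sub_self, coeff_truncLT_of_lt hq]

theorem monodromy_truncLT_eq_self_iff (j : ℤ) :
    monodromy j (truncLT H γ) = truncLT H γ ↔ (H : WithTop ℚ) ≤ (monodromy j γ - γ).orderTop := by
  rw [← le_orderTop_monodromy_truncLT_sub_iff]
  refine ⟨fun h => by rw [h, sub_self, orderTop_zero]; exact le_top, fun h => ?_⟩
  rw [← sub_eq_zero]
  ext q
  rcases lt_or_ge q H with hq | hq
  · exact coe_le_orderTop_iff.1 h q hq
  · rw [coeff_monodromy_sub_self, coeff_truncLT_of_le hq, mul_zero, HahnSeries.coeff_zero]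

theorem le_orderTop_monodromy_sub_monodromy_truncLT {m : ℤ}
    (hm : (H : WithTop ℚ) ≤ (monodromy m γ - γ).orderTop) (j : ℤ) :
    (H : WithTop ℚ) ≤ (monodromy (m + j) γ - monodromy j (truncLT H γ)).orderTop := by
  rw [add_comm m, monodromy_add, ← map_sub, orderTop_monodromy]
  exact le_orderTop_sub_trans hm (le_orderTop_sub_truncLT γ H)

end Truncation

theorem charQuot_mul_charGcd (b : ℕ → ℕ) (i : ℕ) :
    charQuot b (i + 1) * charGcd b (i + 1) = charGcd b i := by
  rw [charQuot, Nat.add_sub_cancel]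
  exact Nat.div_mul_cancel (Finset.dvd_gcd fun t ht =>
    charGcd_dvd b (Finset.mem_range.1 ht).le)

namespace IsBranch

variable {N : ℕ} {γ : HahnSeries ℚ ℂ} {g : ℕ} {b : ℕ → ℕ}

theorem charQuot_pos (hB : IsBranch N γ g b) (i : ℕ) : 0 < charQuot b (i + 1) :=
  Nat.pos_of_mul_pos_right (charQuot_mul_charGcd b i ▸ hB.charGcd_pos i)

theorem two_le_charQuot (hB : IsBranch N γ g b) {i : ℕ} (hi : i < g) : 2 ≤ charQuot b (i + 1) := by
  refine (Nat.succ_le_of_lt (hB.charQuot_pos i)).lt_of_ne fun h => hB.charGcd_succ_ne hi ?_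
  rw [← charQuot_mul_charGcd b i, ← h, Nat.succ_eq_add_one, zero_add, one_mul]

theorem div_charGcd_mul (hB : IsBranch N γ g b) (i : ℕ) : N / charGcd b i * charGcd b i = N :=
  Nat.div_mul_cancel (hB.charGcd_dvd_degree i)

theorem div_charGcd_pos (hB : IsBranch N γ g b) (i : ℕ) : 0 < N / charGcd b i :=
  Nat.div_pos (Nat.le_of_dvd hB.pos (hB.charGcd_dvd_degree i)) (hB.charGcd_pos i)

theorem le_orderTop_monodromy_sub_iff_div_dvd (hB : IsBranch N γ g b) {i : ℕ} {h : ℚ}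
    (hi : InCharInterval N g b i h) (j : ℤ) :
    (h : WithTop ℚ) ≤ (monodromy j γ - γ).orderTop ↔ ((N / charGcd b i : ℕ) : ℤ) ∣ j := by
  have hl : (charGcd b i : ℤ) ≠ 0 := Nat.cast_ne_zero.2 (hB.charGcd_pos i).ne'
  rw [hB.le_orderTop_monodromy_sub_iff hi]
  conv_lhs => rw [← hB.div_charGcd_mul i, Nat.cast_mul]
  exact mul_dvd_mul_iff_right hl

theorem dvd_mul_height_iff (hB : IsBranch N γ g b) (i j : ℕ) :
    N ∣ N / charGcd b i * j * b (i + 1) ↔ charQuot b (i + 1) ∣ j := by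
  have hN := hB.div_charGcd_mul i
  have hd := hB.div_charGcd_pos i
  set d := N / charGcd b i
  have hlast : N ∣ d * j * b (i + 1) ↔ N ∣ d * j * charGcd b (i + 1) := by
    have hiff := dvd_mul_charGcd_iff b N ((d * j : ℕ) : ℤ) (i + 1)
    simp only [← Nat.cast_mul, Int.natCast_dvd_natCast] at hiff
    rw [hiff]
    refine ⟨fun h t ht => ?_, fun h => h _ le_rfl⟩
    rcases Nat.le_succ_iff.1 ht with ht | rfl
    · rw [mul_right_comm, ← hN]
      exact (mul_dvd_mul_left d (charGcd_dvd b ht)).mul_right j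
    · exact h
  rw [hlast, ← hN, ← charQuot_mul_charGcd b i, mul_assoc, Nat.mul_dvd_mul_iff_left hd,
    Nat.mul_dvd_mul_iff_right (hB.charGcd_pos (i + 1))]

theorem isPrimitiveRoot_expTwoPiI (hB : IsBranch N γ g b) (i : ℕ) :
    IsPrimitiveRoot (expTwoPiI ((N / charGcd b i : ℕ) * ((b (i + 1) : ℚ) / N)))
      (charQuot b (i + 1)) := by
  have hpow (j : ℕ) : expTwoPiI ((N / charGcd b i : ℕ) * ((b (i + 1) : ℚ) / N)) ^ j = 1 ↔
      charQuot b (i + 1) ∣ j := by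
    have hexp : (j : ℚ) * ((N / charGcd b i : ℕ) * ((b (i + 1) : ℚ) / N)) =
        ((N / charGcd b i * j : ℕ) : ℤ) * ((b (i + 1) : ℚ) / N) := by
      rw [Int.cast_natCast, Nat.cast_mul]
      ring
    rw [← AddChar.map_nsmul_eq_pow, nsmul_eq_mul, hexp, expTwoPiI_mul_div_eq_one_iff hB.pos.ne',
      ← Nat.cast_mul, Int.natCast_dvd_natCast, hB.dvd_mul_height_iff]
  exact ⟨(hpow _).2 dvd_rfl, fun l hl => (hpow l).1 hl⟩

theorem prod_X_sub_C_pow (hB : IsBranch N γ g b) (i : ℕ) (a : ℂ) :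
    ∏ t ∈ Finset.range (charGcd b i), (X - C (expTwoPiI ((N / charGcd b i : ℕ) *
      ((b (i + 1) : ℚ) / N)) ^ t * a)) =
      (X ^ charQuot b (i + 1) - C (a ^ charQuot b (i + 1))) ^ charGcd b (i + 1) := by
  have hω := hB.isPrimitiveRoot_expTwoPiI i
  rw [X_pow_sub_C_eq_prod hω (hB.charQuot_pos i) rfl]
  conv_lhs => rw [← congrArg Finset.range (charQuot_mul_charGcd b i), prod_range_mul]
  simp only [_root_.pow_add, pow_mul, hω.pow_eq_one, one_pow, one_mul, Finset.prod_const,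
    Finset.card_range]

theorem hasPeriod_truncLT (hB : IsBranch N γ g b) {i : ℕ} {h : ℚ}
    (hi : InCharInterval N g b i h) : HasPeriod (truncLT h γ) (N / charGcd b i) where
  pos := hB.div_charGcd_pos i
  monodromy_eq_self_iff j := by
    rw [monodromy_truncLT_eq_self_iff, hB.le_orderTop_monodromy_sub_iff_div_dvd hi]

/-- The conjugates of the branch fall into blocks of `N / charGcd b k` consecutive ones, each of
which looks from the ball like the set of conjugates of the truncation. -/
theorem exists_isAdapted (hB : IsBranch N γ g b) {k : ℕ} (hk : k < g) :
    ∃ (B : ℚ) (c : ℂ) (q : (HahnSeries ℚ ℂ)[X]), 0 < B ∧ c ≠ 0 ∧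
      IsAdapted (truncLT ((b (k + 1) : ℚ) / N) γ) ((b (k + 1) : ℚ) / N) (N / charGcd b k) B c q ∧
      HasInit (((conjugates N γ).map fun α => X - C α).prod.comp
          (ballVar (truncLT ((b (k + 1) : ℚ) / N) γ) ((b (k + 1) : ℚ) / N))) (charGcd b k • B)
        (C (c ^ charGcd b k) * (X ^ charQuot b (k + 1) -
          C (γ.coeff ((b (k + 1) : ℚ) / N) ^ charQuot b (k + 1))) ^ charGcd b (k + 1)) := by
  have hi := hB.inCharInterval_succ hk
  have hHpos := hB.height_pos (i := k + 1) ⟨Nat.le_add_left 1 k, hk⟩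
  have hprod := hB.prod_X_sub_C_pow k (γ.coeff ((b (k + 1) : ℚ) / N))
  have hfactor := prod_X_sub_C_conjugates (N / charGcd b k * charGcd b k) γ
  rw [prod_range_mul, hB.div_charGcd_mul] at hfactor
  have hper := hB.hasPeriod_truncLT hi
  have hdvd := hB.le_orderTop_monodromy_sub_iff_div_dvd hi
  set H : ℚ := (b (k + 1) : ℚ) / N
  set d := N / charGcd b k
  have hpos := hB.orderTop_pos.trans_le (orderTop_le_orderTop_truncLT γ H)
  obtain ⟨B, c, q, hB0, hc, hq, hI⟩ := hper.exists_isAdapted hHpos hpos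
    fun j => by rw [le_orderTop_monodromy_truncLT_sub_iff]; exact (hdvd j).1
  refine ⟨B, c, q, hB0, hc, hq, ?_⟩
  have hblock : ∀ t ∈ Finset.range (charGcd b k),
      HasInit ((∏ j ∈ Finset.range d,
        (X - C (monodromy ((d * t + j : ℕ) : ℤ) γ))).comp (ballVar (truncLT H γ) H)) B
        (C c * (X - C (expTwoPiI (d * H) ^ t * γ.coeff H))) := by
    intro t _
    have hdt : (d : ℤ) ∣ ((d * t : ℕ) : ℤ) := ⟨t, Nat.cast_mul d t⟩
    have hinit := hI (fun j => monodromy ((d * t + j : ℕ) : ℤ) γ) fun j => by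
      rw [Nat.cast_add]
      exact le_orderTop_monodromy_sub_monodromy_truncLT ((hdvd _).2 hdt) j
    rwa [HahnSeries.coeff_sub, coeff_truncLT_of_le le_rfl, sub_zero, add_zero, coeff_monodromy,
      Int.cast_natCast, Nat.cast_mul, mul_comm (d : ℚ), mul_assoc, ← nsmul_eq_mul,
      AddChar.map_nsmul_eq_pow] at hinit
  have hall := HasInit.prod _ hblock
  rwa [Finset.sum_const, Finset.card_range, Finset.prod_mul_distrib, hprod, Finset.prod_const,
    Finset.card_range, ← C_pow, ← prod_comp, ← hfactor] at hall

end IsBranch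

/-! ## The jacobian with an approximate root -/

theorem HasInit.recenter {Γ R : Type*} [AddCommGroup Γ] [LinearOrder Γ] [IsOrderedAddMonoid Γ]
    [CommRing R] {P : (HahnSeries Γ R)[X]} {lam u : HahnSeries Γ R} {H h A : Γ} {F : R[X]}
    (hP : HasInit (P.comp (ballVar lam H)) A F) (hu : (H : WithTop Γ) ≤ (u - lam).orderTop)
    (hh : H < h) :
    HasInit (P.comp (ballVar u h)) A (C (F.eval ((u - lam).coeff H))) := by
  have hconst : HasInit (C (single (-H) 1 * (u - lam))) 0 (C ((u - lam).coeff H)) := by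
    rw [C_mul]
    simpa only [neg_add_cancel, one_mul] using (HasInit.C_single (-H)).mul (HasInit.const hu)
  have hvar : HasInit (C (single (h - H) (1 : R)) * X) 0 0 :=
    ((HasInit.C_single (h - H)).mul HasInit.var).of_lt (by rwa [add_zero, sub_pos])
  have hcomp : (ballVar lam H).comp (C (single (-H) 1 * (u - lam)) + C (single (h - H) 1) * X) =
      ballVar u h := by
    simp only [ballVar, add_comp, Polynomial.mul_comp, C_comp, X_comp]
    rw [mul_add, ← C_mul, ← mul_assoc, ← mul_assoc, ← C_mul, single_mul_single, single_mul_single,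
      add_neg_cancel, mul_one, single_zero_one, one_mul, add_sub_cancel, C_sub]
    ring
  have hI := hP.comp (hconst.add hvar)
  rwa [comp_assoc, hcomp, add_zero, comp_C] at hI

theorem degree_X_pow_sub_C_pow_sub_X_pow_lt {R : Type*} [CommRing R] [Nontrivial R] (e : R)
    {n m : ℕ} (hn : 2 ≤ n) (hm : 0 < m) :
    ((X ^ n - C e) ^ m - X ^ (n * m) : R[X]).degree < ((n * m - 1 : ℕ) : WithBot ℕ) := by
  have hlt : ((X - C e) ^ m - X ^ m : R[X]).natDegree < m := by
    have hX := (isMonicOfDegree_X_sub_one e).pow m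
    rw [one_mul] at hX
    exact hX.natDegree_sub_lt hm.ne' (isMonicOfDegree_X_pow R m)
  have hexp : ((X ^ n - C e) ^ m - X ^ (n * m) : R[X]) = expand R n ((X - C e) ^ m - X ^ m) := by
    simp only [map_sub, map_pow, expand_X, expand_C, pow_mul]
  rw [hexp]
  refine degree_le_natDegree.trans_lt (WithBot.coe_lt_coe.2 ?_)
  rw [natDegree_expand]
  obtain ⟨l, rfl⟩ := Nat.exists_eq_succ_of_ne_zero hm.ne'
  calc _ ≤ l * n := Nat.mul_le_mul_right n (Nat.lt_succ_iff.1 hlt)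
    _ < n * (l + 1) - 1 := by rw [mul_comm, mul_add]; omega

theorem mul_derivative_pow_sub_mul_derivative {R : Type*} [CommRing R] (B c u e : R) {n : ℕ}
    (hn : 0 < n) (m : ℕ) :
    C B * (C c * X * derivative (C u * (X ^ n - C e) ^ (m + 1))) -
        C ((n * (m + 1) : ℕ) * B) * (C u * (X ^ n - C e) ^ (m + 1) * derivative (C c * X)) =
      C (B * c * u * (n * (m + 1) : ℕ) * e) * (X ^ n - C e) ^ m := by
  have hX : (X : R[X]) * X ^ (n - 1) = X ^ n := mul_pow_sub_one hn.ne' X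
  simp only [derivative_mul, derivative_C, zero_mul, zero_add, derivative_pow, derivative_sub,
    derivative_X, mul_one, sub_zero, C_mul, C_eq_natCast, Nat.add_sub_cancel, Nat.cast_add,
    Nat.cast_one, Nat.cast_mul, C_add, C_1]
  rw [pow_succ (X ^ n - C e) m]
  linear_combination (C B * C c * C u * ((m : R[X]) + 1) * (X ^ n - C e) ^ m * (n : R[X])) * hX

theorem natDegree_eq_of_roots_eq_conjugates {N : ℕ} {γ : HahnSeries ℚ ℂ} {f : Cx[X]}
    (hf : f.Monic) (hroots : (f.map toHahn).roots = conjugates N γ) : f.natDegree = N := by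
  rw [← hf.natDegree_map toHahn,
    (splits_of_map_monodromy (map_monodromy_map_toHahn 1 f)).natDegree_eq_card_roots, hroots,
    card_conjugates]

theorem map_toHahn_eq_prod_of_roots_eq_conjugates {N : ℕ} {γ : HahnSeries ℚ ℂ} {f : Cx[X]}
    (hf : f.Monic) (hroots : (f.map toHahn).roots = conjugates N γ) :
    f.map toHahn = ((conjugates N γ).map fun α => X - C α).prod := by
  rw [← hroots]
  exact (splits_of_map_monodromy (map_monodromy_map_toHahn 1 f)).eq_prod_roots_of_monic
    (hf.map toHahn)

namespace IsBranch

variable {N : ℕ} {γ : HahnSeries ℚ ℂ} {g : ℕ} {b : ℕ → ℕ}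

open Classical in
theorem card_filter_isNear (hB : IsBranch N γ g b) {i : ℕ} {h : ℚ} (hi : InCharInterval N g b i h)
    {s : Multiset (HahnSeries ℚ ℂ)} (hs : s.map (monodromy 1) = s) :
    (s.filter (IsNear γ h)).card = N / charGcd b i * ballCount s γ h := by
  refine Nat.eq_of_mul_eq_mul_left (hB.charGcd_pos i) ?_
  rw [← hB.mul_ballCount hi hs, ← mul_assoc, mul_comm (charGcd b i), hB.div_charGcd_mul]

theorem hasConjugateBalls (hB : IsBranch N γ g b) {k : ℕ} (hk : k < g) :
    HasConjugateBalls (truncLT ((b (k + 1) : ℚ) / N) γ) ((b (k + 1) : ℚ) / N)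
      (N / charGcd b k) := by
  classical
  intro Q hQ
  rw [← ballCount_congr _ (le_orderTop_sub_truncLT γ _),
    ← hB.card_filter_isNear (hB.inCharInterval_succ hk) (roots_map_monodromy hQ)]
  exact (Multiset.card_le_card (Multiset.filter_le _ _)).trans (card_roots' Q)

variable {k : ℕ} {f fk : Cx[X]}

theorem exists_hasInit_approximateRoot (hB : IsBranch N γ g b) (hk : k < g) (hf : f.Monic)
    (hroots : (f.map toHahn).roots = conjugates N γ)
    (hfk : IsApproximateRoot (charGcd b k) f fk) :
    ∃ (B : ℚ) (c : ℂ), 0 < B ∧ c ≠ 0 ∧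
      HasInit ((fk.map toHahn).comp
          (ballVar (truncLT ((b (k + 1) : ℚ) / N) γ) ((b (k + 1) : ℚ) / N))) B (C c * X) ∧
      HasInit ((f.map toHahn).comp
          (ballVar (truncLT ((b (k + 1) : ℚ) / N) γ) ((b (k + 1) : ℚ) / N))) (charGcd b k • B)
        (C (c ^ charGcd b k) * (X ^ charQuot b (k + 1) -
          C (γ.coeff ((b (k + 1) : ℚ) / N) ^ charQuot b (k + 1))) ^ charGcd b (k + 1)) := by
  obtain ⟨B, c, q, hB0, hc, hq, hfI⟩ := hB.exists_isAdapted hk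
  rw [← map_toHahn_eq_prod_of_roots_eq_conjugates hf hroots] at hfI
  have hn := hB.two_le_charQuot hk
  have hl := hB.charGcd_pos (k + 1)
  have hp : 2 ≤ charGcd b k := by
    rw [← charQuot_mul_charGcd]
    exact hn.trans (Nat.le_mul_of_pos_right _ hl)
  have hdeg : (f.map toHahn).natDegree = charGcd b k * (N / charGcd b k) := by
    rw [hf.natDegree_map, natDegree_eq_of_roots_eq_conjugates hf hroots, mul_comm,
      hB.div_charGcd_mul]
  have hlt : (C (c ^ charGcd b k) * (X ^ charQuot b (k + 1) -
      C (γ.coeff ((b (k + 1) : ℚ) / N) ^ charQuot b (k + 1))) ^ charGcd b (k + 1) -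
        (C c * X) ^ charGcd b k).degree < ((charGcd b k - 1 : ℕ) : WithBot ℕ) := by
    rw [mul_pow, ← C_pow, ← mul_sub, degree_C_mul (pow_ne_zero _ hc),
      ← charQuot_mul_charGcd b k]
    exact degree_X_pow_sub_C_pow_sub_X_pow_lt _ hn hl
  obtain ⟨q', hq', happ⟩ := hq.exists_isApproximateRoot hc (hB.hasConjugateBalls hk) hp
    (hf.map toHahn) hdeg (map_monodromy_map_toHahn 1 f) hfI hlt
  refine ⟨B, c, hB0, hc, ?_, hfI⟩
  rw [(hfk.map toHahn hf).unique happ (hf.map toHahn)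
    (Nat.cast_ne_zero.2 (hB.charGcd_pos k).ne')]
  exact hq'.init

theorem exists_hasInit_jacPoly (hB : IsBranch N γ g b) (hk : k < g) (hf : f.Monic)
    (hroots : (f.map toHahn).roots = conjugates N γ)
    (hfk : IsApproximateRoot (charGcd b k) f fk) :
    ∃ (A : ℚ) (c : ℂ), c ≠ 0 ∧ HasInit (((jacPoly fk f).map toHahn).comp
        (ballVar (truncLT ((b (k + 1) : ℚ) / N) γ) ((b (k + 1) : ℚ) / N))) A
      (C c * (X ^ charQuot b (k + 1) -
        C (γ.coeff ((b (k + 1) : ℚ) / N) ^ charQuot b (k + 1))) ^ (charGcd b (k + 1) - 1)) := by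
  obtain ⟨B, c, hB0, hc, hkI, hfI⟩ := hB.exists_hasInit_approximateRoot hk hf hroots hfk
  have hJ := HasInit.jac (C_single_one_mul_map_jacPoly fk f) hkI hfI
  have hn := hB.charQuot_pos k
  have hpn := charQuot_mul_charGcd b k
  have hp := hB.charGcd_pos k
  obtain ⟨m, hm⟩ := Nat.exists_eq_succ_of_ne_zero (hB.charGcd_pos (k + 1)).ne'
  have ha : γ.coeff ((b (k + 1) : ℚ) / N) ≠ 0 := hB.coeff_ne_zero ⟨Nat.le_add_left 1 k, hk⟩
  rw [hm] at hpn hJ ⊢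
  rw [nsmul_eq_mul, Rat.cast_mul, Rat.cast_natCast, ← hpn,
    mul_derivative_pow_sub_mul_derivative _ _ _ _ hn] at hJ
  refine ⟨_, _, ?_, hJ⟩
  simp only [ne_eq, mul_eq_zero, not_or]
  exact ⟨⟨⟨⟨Rat.cast_ne_zero.2 hB0.ne', hc⟩, pow_ne_zero _ hc⟩, Nat.cast_ne_zero.2 (hpn ▸ hp.ne')⟩,
    pow_ne_zero _ ha⟩

theorem jacPoly_ne_zero (hB : IsBranch N γ g b) (hk : k < g) (hf : f.Monic)
    (hroots : (f.map toHahn).roots = conjugates N γ)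
    (hfk : IsApproximateRoot (charGcd b k) f fk) : jacPoly fk f ≠ 0 := by
  obtain ⟨A, c, hc, hJ⟩ := hB.exists_hasInit_jacPoly hk hf hroots hfk
  intro h0
  rw [h0, Polynomial.map_zero, zero_comp] at hJ
  exact mul_ne_zero (C_ne_zero.2 hc)
    (pow_ne_zero _ (X_pow_sub_C_ne_zero (hB.charQuot_pos k) _)) (hJ.unique (HasInit.zero A))

theorem ballCount_roots_jacPoly (hB : IsBranch N γ g b) (hk : k < g) (hf : f.Monic)
    (hroots : (f.map toHahn).roots = conjugates N γ)
    (hfk : IsApproximateRoot (charGcd b k) f fk) :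
    ballCount ((jacPoly fk f).map toHahn).roots γ ((b (k + 1) : ℚ) / N) =
      charQuot b (k + 1) * (charGcd b (k + 1) - 1) := by
  obtain ⟨A, c, hc, hJ⟩ := hB.exists_hasInit_jacPoly hk hf hroots hfk
  have hne := X_pow_sub_C_ne_zero (hB.charQuot_pos k)
    (γ.coeff ((b (k + 1) : ℚ) / N) ^ charQuot b (k + 1))
  rw [ballCount_congr _ (le_orderTop_sub_truncLT γ _),
    ← natDegree_eq_ballCount (splits_of_map_monodromy (map_monodromy_map_toHahn 1 _))
      (mul_ne_zero (C_ne_zero.2 hc) (pow_ne_zero _ hne)) hJ, natDegree_C_mul hc, natDegree_pow,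
    natDegree_X_pow_sub_C, mul_comm]

theorem ballCount_roots_jacPoly_of_lt (hB : IsBranch N γ g b) (hf : f.Monic)
    (hroots : (f.map toHahn).roots = conjugates N γ)
    (hfk : IsApproximateRoot (charGcd b k) f fk) {i : ℕ} {h : ℚ} (hki : k < i)
    (hi : InCharInterval N g b i h) :
    ballCount ((jacPoly fk f).map toHahn).roots γ h = charGcd b i - 1 := by
  have hk : k < g := hki.trans_le hi.le
  obtain ⟨B, c, hB0, hc, hkI, -⟩ := hB.exists_hasInit_approximateRoot hk hf hroots hfk
  have ha : γ.coeff ((b (k + 1) : ℚ) / N) ≠ 0 := hB.coeff_ne_zero ⟨Nat.le_add_left 1 k, hk⟩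
  have hh : (b (k + 1) : ℚ) / N < h :=
    (hB.height_le_height (Nat.le_add_left 1 k) hki hi.le).trans_lt (hi.lt (by omega))
  have hkI' := hkI.recenter (le_orderTop_sub_truncLT γ _) hh
  rw [HahnSeries.coeff_sub, coeff_truncLT_of_le le_rfl, sub_zero, eval_mul, eval_C, eval_X] at hkI'
  obtain ⟨A, F, -, hFd, hFI⟩ := exists_hasInit_of_splits
    (splits_of_map_monodromy (map_monodromy_map_toHahn 1 f)) (hf.map toHahn).ne_zero γ h
  rw [hroots, hB.ballCount_conjugates_self hi] at hFd
  have hJ := HasInit.jac (C_single_one_mul_map_jacPoly fk f) hkI' hFI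
  rw [derivative_C, mul_zero, mul_zero, sub_zero, ← mul_assoc, ← C_mul] at hJ
  have hc' : (B * (c * γ.coeff ((b (k + 1) : ℚ) / N)) : ℂ) ≠ 0 :=
    mul_ne_zero (Rat.cast_ne_zero.2 hB0.ne') (mul_ne_zero hc ha)
  have hF' : derivative F ≠ 0 := fun h0 =>
    (hB.charGcd_pos i).ne' (hFd ▸ derivative_eq_zero.1 h0)
  rw [← natDegree_eq_ballCount (splits_of_map_monodromy (map_monodromy_map_toHahn 1 _))
    (mul_ne_zero (C_ne_zero.2 hc') hF') hJ, natDegree_C_mul hc', natDegree_derivative, hFd]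

end IsBranch

/-! ## Contacts of the roots of the jacobian with the branch -/

open Classical in
theorem sum_filter_eq_filter_exists {ι α : Type*} (t : Finset ι) (p : ι → α → Prop)
    {s : Multiset α} (hp : ∀ a ∈ s, ∀ i ∈ t, ∀ j ∈ t, p i a → p j a → i = j) :
    ∑ i ∈ t, s.filter (p i) = s.filter fun a => ∃ i ∈ t, p i a := by
  induction t using Finset.induction_on with
  | empty => simp only [Finset.sum_empty, Finset.notMem_empty, false_and, exists_false,
      Multiset.filter_false]
  | insert i t hi ih =>
    have hdisjoint : s.filter (fun a => p i a ∧ ∃ j ∈ t, p j a) = 0 :=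
      Multiset.filter_eq_nil.2 fun a ha ⟨hia, j, hj, hja⟩ => hi <| by
        rwa [hp a ha i (t.mem_insert_self i) j (Finset.mem_insert_of_mem hj) hia hja]
    have hp' : ∀ a ∈ s, ∀ j ∈ t, ∀ l ∈ t, p j a → p l a → j = l := fun a ha j hj l hl =>
      hp a ha j (Finset.mem_insert_of_mem hj) l (Finset.mem_insert_of_mem hl)
    rw [Finset.sum_insert hi, ih hp', Multiset.filter_add_filter, hdisjoint, add_zero]
    simp only [Finset.exists_mem_insert]

/-- The maximal contact of `α` with a conjugate of `γ` is `h`. -/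
def HasContact (γ : HahnSeries ℚ ℂ) (h : ℚ) (α : HahnSeries ℚ ℂ) : Prop :=
  IsNear γ h α ∧ ∀ h' > h, ¬ IsNear γ h' α

theorem HasContact.unique {γ : HahnSeries ℚ ℂ} {h h' : ℚ} {α : HahnSeries ℚ ℂ}
    (hα : HasContact γ h α) (hα' : HasContact γ h' α) : h = h' :=
  le_antisymm (le_of_not_gt fun hlt => hα'.2 h hlt hα.1)
    (le_of_not_gt fun hlt => hα.2 h' hlt hα'.1)

theorem hasContact_monodromy_iff {γ : HahnSeries ℚ ℂ} {h : ℚ} {α : HahnSeries ℚ ℂ} (i : ℤ) :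
    HasContact γ h (monodromy i α) ↔ HasContact γ h α := by
  simp only [HasContact, isNear_monodromy_iff]

open Classical in
theorem isNear_iff_of_card_eq {γ : HahnSeries ℚ ℂ} {h h' : ℚ} (hh : h ≤ h')
    {s : Multiset (HahnSeries ℚ ℂ)}
    (hs : (s.filter (IsNear γ h)).card = (s.filter (IsNear γ h')).card) {α : HahnSeries ℚ ℂ}
    (hα : α ∈ s) : IsNear γ h α ↔ IsNear γ h' α := by
  have hle : s.filter (IsNear γ h') ≤ s.filter (IsNear γ h) :=
    Multiset.monotone_filter_right s fun _ => IsNear.mono hh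
  have heq := congrArg (α ∈ ·) (Multiset.eq_of_le_of_card_le hle hs.le)
  simpa only [Multiset.mem_filter, hα, true_and, eq_iff_iff, iff_comm] using heq

/-- A height in the `i`-th interval of `InCharInterval`: its right end point, if there is one. -/
def nextHeight (N g : ℕ) (b : ℕ → ℕ) (i : ℕ) : ℚ :=
  if i < g then (b (i + 1) : ℚ) / N else (b i : ℚ) / N + 1

theorem nextHeight_of_lt {N g : ℕ} {b : ℕ → ℕ} {i : ℕ} (hi : i < g) :
    nextHeight N g b i = (b (i + 1) : ℚ) / N := if_pos hi

open Classical in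
/-- The multiset `s` has as many members near the branch `γ`, at every height from `b (k + 1) / N`
on, as the jacobian of `f` and its `k`-th approximate root has roots. -/
structure HasPolarCounts (N : ℕ) (γ : HahnSeries ℚ ℂ) (g : ℕ) (b : ℕ → ℕ) (k : ℕ)
    (s : Multiset (HahnSeries ℚ ℂ)) : Prop where
  card_first : (s.filter (IsNear γ ((b (k + 1) : ℚ) / N))).card =
    N / charGcd b (k + 1) * (charGcd b (k + 1) - 1)
  card_of_lt {i : ℕ} {h : ℚ} : k < i → InCharInterval N g b i h →
    (s.filter (IsNear γ h)).card = N / charGcd b i * (charGcd b i - 1)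

namespace IsBranch

variable {N : ℕ} {γ : HahnSeries ℚ ℂ} {g : ℕ} {b : ℕ → ℕ}

theorem inCharInterval_nextHeight (hB : IsBranch N γ g b) {i : ℕ} (hi : i ≤ g) :
    InCharInterval N g b i (nextHeight N g b i) where
  le := hi
  lt hi1 := by
    unfold nextHeight
    split_ifs with hig
    · exact hB.height_lt_height hi1 i.lt_succ_self hig
    · exact lt_add_one _
  le_succ hig := (nextHeight_of_lt hig).le

theorem div_charGcd_succ (hB : IsBranch N γ g b) (i : ℕ) :
    N / charGcd b (i + 1) = N / charGcd b i * charQuot b (i + 1) := by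
  refine Nat.div_eq_of_eq_mul_left (hB.charGcd_pos (i + 1)) ?_
  rw [mul_assoc, charQuot_mul_charGcd, hB.div_charGcd_mul]

theorem prod_charQuot (hB : IsBranch N γ g b) (i : ℕ) :
    ∏ j ∈ Finset.Icc 1 i, charQuot b j = N / charGcd b i := by
  induction i with
  | zero =>
    rw [charGcd, zero_add, Finset.range_one, Finset.gcd_singleton, normalize_eq, hB.zero,
      Nat.div_self hB.pos]
    rfl
  | succ i ih => rw [Finset.prod_Icc_succ_top (Nat.le_add_left 1 i), ih, hB.div_charGcd_succ]

theorem hasPolarCounts (hB : IsBranch N γ g b) {k : ℕ} (hk : k < g) {f fk : Cx[X]}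
    (hf : f.Monic) (hroots : (f.map toHahn).roots = conjugates N γ)
    (hfk : IsApproximateRoot (charGcd b k) f fk) :
    HasPolarCounts N γ g b k ((jacPoly fk f).map toHahn).roots where
  card_first := by
    rw [hB.card_filter_isNear (hB.inCharInterval_succ hk)
      (roots_map_monodromy (map_monodromy_map_toHahn 1 _)),
      hB.ballCount_roots_jacPoly hk hf hroots hfk, hB.div_charGcd_succ, mul_assoc]
  card_of_lt hki hi := by
    rw [hB.card_filter_isNear hi (roots_map_monodromy (map_monodromy_map_toHahn 1 _)),
      hB.ballCount_roots_jacPoly_of_lt hf hroots hfk hki hi]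

section

variable {k : ℕ} {s : Multiset (HahnSeries ℚ ℂ)} {α : HahnSeries ℚ ℂ}

theorem isNear_first_iff (hB : IsBranch N γ g b) (hs : HasPolarCounts N γ g b k s) (hk : k < g)
    (hα : α ∈ s) :
    IsNear γ ((b (k + 1) : ℚ) / N) α ↔ IsNear γ (nextHeight N g b (k + 1)) α := by
  have hi := hB.inCharInterval_nextHeight hk
  exact isNear_iff_of_card_eq (hi.lt (Nat.le_add_left 1 k)).le
    (hs.card_first.trans (hs.card_of_lt k.lt_succ_self hi).symm) hα

theorem not_isNear_last (hB : IsBranch N γ g b) (hs : HasPolarCounts N γ g b k s) (hk : k < g)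
    (hα : α ∈ s) : ¬ IsNear γ (nextHeight N g b g) α := by
  classical
  have hcard := hs.card_of_lt hk (hB.inCharInterval_nextHeight le_rfl)
  rw [hB.charGcd_last, Nat.sub_self, mul_zero, Multiset.card_eq_zero,
    Multiset.filter_eq_nil] at hcard
  exact hcard α hα

theorem hasContact_iff (hB : IsBranch N γ g b) (hs : HasPolarCounts N γ g b k s) {i : ℕ}
    (hki : k < i) (hi : i ≤ g) (hα : α ∈ s) :
    HasContact γ ((b i : ℚ) / N) α ↔
      IsNear γ ((b i : ℚ) / N) α ∧ ¬ IsNear γ (nextHeight N g b i) α := by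
  have hnext := hB.inCharInterval_nextHeight hi
  have hlt := hnext.lt (Nat.one_le_of_lt hki)
  refine and_congr_right fun _ => ⟨fun hfar => hfar _ hlt, fun hfar h hh hnear => hfar ?_⟩
  have hmin : InCharInterval N g b i (min h (nextHeight N g b i)) :=
    ⟨hi, fun _ => lt_min hh hlt, fun hig => (min_le_right _ _).trans (hnext.le_succ hig)⟩
  exact (isNear_iff_of_card_eq (min_le_right _ _)
    ((hs.card_of_lt hki hmin).trans (hs.card_of_lt hki hnext).symm) hα).1
    (hnear.mono (min_le_left _ _))

theorem exists_hasContact (hB : IsBranch N γ g b) (hs : HasPolarCounts N γ g b k s) (hk : k < g)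
    (hα : α ∈ s) (hnear : IsNear γ ((b (k + 1) : ℚ) / N) α) :
    ∃ i ∈ Finset.Icc (k + 2) g, HasContact γ ((b i : ℚ) / N) α := by
  by_contra! hno
  have hnext (i : ℕ) (hi : k + 1 ≤ i) : i ≤ g → IsNear γ (nextHeight N g b i) α := by
    induction i, hi using Nat.le_induction with
    | base => exact fun _ => (hB.isNear_first_iff hs hk hα).1 hnear
    | succ i hi ih =>
      intro hig
      by_contra hfar
      have hsucc := ih (Nat.le_of_succ_le hig)
      rw [nextHeight_of_lt hig] at hsucc
      exact hno (i + 1) (Finset.mem_Icc.2 ⟨Nat.succ_le_succ hi, hig⟩)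
        ((hB.hasContact_iff hs (Nat.lt_succ_of_lt hi) hig hα).2 ⟨hsucc, hfar⟩)
  exact hB.not_isNear_last hs hk hα (hnext g hk le_rfl)

theorem isNear_first_iff_exists_hasContact (hB : IsBranch N γ g b)
    (hs : HasPolarCounts N γ g b k s) (hk : k < g) (hα : α ∈ s) :
    IsNear γ ((b (k + 1) : ℚ) / N) α ↔
      ∃ i ∈ Finset.Icc (k + 2) g, HasContact γ ((b i : ℚ) / N) α := by
  refine ⟨hB.exists_hasContact hs hk hα, fun ⟨i, hi, hc⟩ => hc.1.mono ?_⟩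
  rw [Finset.mem_Icc] at hi
  exact hB.height_le_height (Nat.le_add_left 1 k) (by omega) hi.2

open Classical in
theorem card_filter_hasContact (hB : IsBranch N γ g b) (hs : HasPolarCounts N γ g b k s) {i : ℕ}
    (hi : i ∈ Finset.Icc (k + 2) g) :
    (s.filter (HasContact γ ((b i : ℚ) / N))).card =
      (∏ j ∈ Finset.Icc 1 (i - 1), charQuot b j) * (charQuot b i - 1) := by
  rw [Finset.mem_Icc] at hi
  obtain ⟨t, rfl⟩ := Nat.exists_eq_add_of_le' (show 1 ≤ i by omega)
  have hnext := hB.inCharInterval_nextHeight hi.2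
  have hle := (hnext.lt (Nat.le_add_left 1 t)).le
  have hcontact : s.filter (HasContact γ ((b (t + 1) : ℚ) / N)) =
      (s.filter (IsNear γ ((b (t + 1) : ℚ) / N))).filter
        fun α => ¬ IsNear γ (nextHeight N g b (t + 1)) α := by
    rw [Multiset.filter_filter]
    exact Multiset.filter_congr fun α hα => by
      rw [hB.hasContact_iff hs (by omega) hi.2 hα, and_comm]
  have hnear : (s.filter (IsNear γ ((b (t + 1) : ℚ) / N))).filter
      (IsNear γ (nextHeight N g b (t + 1))) = s.filter (IsNear γ (nextHeight N g b (t + 1))) := by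
    rw [Multiset.filter_filter]
    exact Multiset.filter_congr fun α _ => and_iff_left_of_imp (IsNear.mono hle)
  have hadd := congrArg Multiset.card (Multiset.filter_add_not
    (IsNear γ (nextHeight N g b (t + 1))) (s.filter (IsNear γ ((b (t + 1) : ℚ) / N))))
  rw [Multiset.card_add, hnear, ← hcontact, hs.card_of_lt (by omega) hnext,
    hs.card_of_lt (by omega) (hB.inCharInterval_succ hi.2), hB.div_charGcd_succ] at hadd
  obtain ⟨l, hl : _ = l + 1⟩ := Nat.exists_eq_add_of_le' (hB.charGcd_pos (t + 1))
  obtain ⟨n, hn : _ = n + 1⟩ := Nat.exists_eq_add_of_le' (hB.charQuot_pos t)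
  have hmul : charGcd b t - 1 = (n + 1) * l + n := by
    rw [← charQuot_mul_charGcd b t, hl, hn, mul_add_one, ← add_assoc, Nat.add_sub_cancel]
  rw [hmul, hl, hn, Nat.add_sub_cancel, mul_add (N / charGcd b t) _ n, ← mul_assoc] at hadd
  rw [Nat.add_sub_cancel, hB.prod_charQuot, hn, Nat.add_sub_cancel]
  exact Nat.add_left_cancel hadd

open Classical in
theorem sum_filter_hasContact (hB : IsBranch N γ g b) (hs : HasPolarCounts N γ g b k s)
    (hk : k < g) :
    ∑ i ∈ Finset.Icc (k + 2) g, s.filter (HasContact γ ((b i : ℚ) / N)) =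
      s.filter (IsNear γ ((b (k + 1) : ℚ) / N)) := by
  have hinj : ∀ α ∈ s, ∀ i ∈ Finset.Icc (k + 2) g, ∀ j ∈ Finset.Icc (k + 2) g,
      HasContact γ ((b i : ℚ) / N) α → HasContact γ ((b j : ℚ) / N) α → i = j := by
    intro α _ i hi j hj hαi hαj
    rw [Finset.mem_Icc] at hi hj
    have heq := hαi.unique hαj
    rcases lt_trichotomy i j with hlt | rfl | hlt
    · exact absurd heq (hB.height_lt_height (by omega) hlt hj.2).ne
    · rfl
    · exact absurd heq (hB.height_lt_height (by omega) hlt hi.2).ne'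
  rw [sum_filter_eq_filter_exists _ _ hinj]
  exact Multiset.filter_congr fun α hα =>
    (hB.isNear_first_iff_exists_hasContact hs hk hα).symm

end

end IsBranch

/-! ## The factors of the jacobian -/

section Contact

variable {F : MvPowerSeries (Fin 2) ℂ} {γ α : HahnSeries ℚ ℂ} {N : ℕ} {h : ℚ}

theorem exists_isContact (hfin : (Zer F).Finite) (hne : (Zer F).Nonempty)
    (α : HahnSeries ℚ ℂ) : ∃ c : WithTop ℚ, IsContact α F c := by
  obtain ⟨β, hβ, hmax⟩ := Set.exists_max_image _ (contactOrder α) hfin hne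
  exact ⟨_, ⟨β, hβ, rfl⟩, Set.forall_mem_image.2 hmax⟩

theorem HasContact.isContact (hγ : HasPeriod γ N) (hF : ∀ β, β ∈ Zer F ↔ β ∈ conjugates N γ)
    (hα : HasContact γ h α) : IsContact α F (h : WithTop ℚ) := by
  have hle (j : ℤ) : (α - monodromy j γ).orderTop ≤ h :=
    WithTop.le_of_forall_lt_iff_le.1 fun q hq => le_of_not_gt fun hlt =>
      hα.2 q (WithTop.coe_lt_coe.1 hq) ⟨j, hlt.le⟩
  obtain ⟨j, hj⟩ := hα.1
  refine ⟨⟨monodromy j γ, (hF _).2 (hγ.mem_conjugates.2 ⟨j, rfl⟩), (hle j).antisymm hj⟩, ?_⟩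
  rintro _ ⟨β, hβ, rfl⟩
  obtain ⟨i, rfl⟩ := hγ.mem_conjugates.1 ((hF β).1 hβ)
  exact hle i

theorem exists_isContact_lt (hγ : HasPeriod γ N) (hF : ∀ β, β ∈ Zer F ↔ β ∈ conjugates N γ)
    (hα : ¬ IsNear γ h α) : ∃ c : WithTop ℚ, IsContact α F c ∧ c < (h : WithTop ℚ) := by
  have hfin : (Zer F).Finite :=
    (conjugates N γ).finite_toSet.subset fun β hβ => (hF β).1 hβ
  have hne : (Zer F).Nonempty := ⟨γ, (hF γ).2 (hγ.mem_conjugates.2 ⟨0, monodromy_zero γ⟩)⟩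
  obtain ⟨c, hc⟩ := exists_isContact hfin hne α
  refine ⟨c, hc, lt_of_not_ge fun hle => hα ?_⟩
  obtain ⟨β, hβ, rfl⟩ := hc.1
  obtain ⟨j, rfl⟩ := hγ.mem_conjugates.1 ((hF β).1 hβ)
  exact ⟨j, hle⟩

end Contact

section Factors

theorem IsNear.orderTop_pos {γ : HahnSeries ℚ ℂ} (hγ : 0 < γ.orderTop) {h : ℚ} (hh : 0 < h)
    {α : HahnSeries ℚ ℂ} (hα : IsNear γ h α) : 0 < α.orderTop := by
  obtain ⟨j, hj⟩ := hα
  rw [← sub_add_cancel α (monodromy j γ)]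
  refine (lt_min ((WithTop.coe_pos.2 hh).trans_le hj) ?_).trans_le min_orderTop_le_orderTop_add
  rwa [orderTop_monodromy]

open Classical in
theorem map_monodromy_filter {s : Multiset (HahnSeries ℚ ℂ)} (hs : s.map (monodromy 1) = s)
    {p : HahnSeries ℚ ℂ → Prop} (hp : ∀ α, p (monodromy 1 α) ↔ p α) :
    (s.filter p).map (monodromy 1) = s.filter p := by
  conv_rhs => rw [← hs, Multiset.filter_map]
  simp only [Function.comp_def, hp]

open Classical in
theorem exists_isWeierstrass_roots_eq_filter_hasContact {γ : HahnSeries ℚ ℂ}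
    (hγ : 0 < γ.orderTop) {J : Cx[X]} (hJ : J ≠ 0) {h : ℚ} (hh : 0 < h) :
    ∃ Q : Cx[X], IsWeierstrass Q ∧
      (Q.map toHahn).roots = (J.map toHahn).roots.filter (HasContact γ h) := by
  have hroot : ∀ α ∈ (J.map toHahn).roots.filter (HasContact γ h),
      (J.map toHahn).eval α = 0 ∧ 0 < α.orderTop := fun α hα => by
    obtain ⟨hαJ, hαγ⟩ := Multiset.mem_filter.1 hα
    exact ⟨(mem_roots'.1 hαJ).2, hαγ.1.orderTop_pos hγ hh⟩
  obtain ⟨Q, hQ, hmap⟩ := exists_isWeierstrass_of_roots hJ hroot (map_monodromy_filter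
    (roots_map_monodromy (map_monodromy_map_toHahn 1 J)) fun _ => hasContact_monodromy_iff 1)
  exact ⟨Q, hQ, by rw [hmap, roots_multiset_prod_X_sub_C]⟩

theorem natDegree_eq_card_roots_map_toHahn {Q : Cx[X]} (hQ : Q.Monic) :
    Q.natDegree = (Q.map toHahn).roots.card := by
  rw [← hQ.natDegree_map toHahn]
  exact (splits_of_map_monodromy (map_monodromy_map_toHahn 1 Q)).natDegree_eq_card_roots

theorem exists_eq_mul_of_roots_le {Q J : Cx[X]} (hQ : Q.Monic) (hJ : J ≠ 0)
    (hle : (Q.map toHahn).roots ≤ (J.map toHahn).roots) :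
    ∃ R, J = R * Q ∧
      (R.map toHahn).roots + (Q.map toHahn).roots = (J.map toHahn).roots := by
  have hsplits := splits_of_map_monodromy (map_monodromy_map_toHahn 1 Q)
  obtain ⟨R, rfl⟩ : Q ∣ J := by
    rw [← map_dvd_map toHahn toHahn_injective hQ,
      hsplits.eq_prod_roots_of_monic (hQ.map toHahn)]
    exact (Multiset.prod_X_sub_C_dvd_iff_le_roots (map_toHahn_ne_zero hJ) _).2 hle
  refine ⟨R, mul_comm Q R, ?_⟩
  have hne := map_toHahn_ne_zero hJ
  rw [Polynomial.map_mul] at hne ⊢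
  rw [roots_mul hne, add_comm]

theorem roots_map_toHahn_prod {ι : Type*} (t : Finset ι) {Q : ι → Cx[X]}
    (hQ : ∀ i ∈ t, (Q i).Monic) :
    ((∏ i ∈ t, Q i).map toHahn).roots = ∑ i ∈ t, ((Q i).map toHahn).roots := by
  rw [Polynomial.map_prod, roots_prod _ _ (Finset.prod_ne_zero_iff.2 fun i hi =>
    ((hQ i hi).map toHahn).ne_zero)]
  rfl

theorem IsBranch.exists_prod_eq {N : ℕ} {γ : HahnSeries ℚ ℂ} {g : ℕ} {b : ℕ → ℕ}
    (hB : IsBranch N γ g b) {k : ℕ} (hk : k < g) {J : Cx[X]} (hJ : J ≠ 0)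
    (hs : HasPolarCounts N γ g b k (J.map toHahn).roots) :
    ∃ Q : ℕ → Cx[X], J = ∏ i ∈ Finset.Icc (k + 1) g, Q i ∧
      (∀ α ∈ ((Q (k + 1)).map toHahn).roots, ¬ IsNear γ ((b (k + 1) : ℚ) / N) α) ∧
      ∀ i ∈ Finset.Icc (k + 2) g, IsWeierstrass (Q i) ∧
        (∀ α ∈ ((Q i).map toHahn).roots, HasContact γ ((b i : ℚ) / N) α) ∧
        (Q i).natDegree = (∏ j ∈ Finset.Icc 1 (i - 1), charQuot b j) * (charQuot b i - 1) := by
  classical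
  have hheight : ∀ i ∈ Finset.Icc (k + 2) g, 0 < (b i : ℚ) / N := fun i hi => by
    rw [Finset.mem_Icc] at hi
    exact hB.height_pos ⟨by omega, hi.2⟩
  choose! Q hQW hQ using fun i hi =>
    exists_isWeierstrass_roots_eq_filter_hasContact hB.orderTop_pos hJ (hheight i hi)
  have hprod : ((∏ i ∈ Finset.Icc (k + 2) g, Q i).map toHahn).roots =
      (J.map toHahn).roots.filter (IsNear γ ((b (k + 1) : ℚ) / N)) := by
    rw [roots_map_toHahn_prod _ fun i hi => (hQW i hi).1, Finset.sum_congr rfl hQ,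
      hB.sum_filter_hasContact hs hk]
  obtain ⟨R, hR, hRroots⟩ := exists_eq_mul_of_roots_le
    (monic_prod_of_monic _ _ fun i hi => (hQW i hi).1) hJ (hprod ▸ Multiset.filter_le _ _)
  have hfar : (R.map toHahn).roots =
      (J.map toHahn).roots.filter fun α => ¬ IsNear γ ((b (k + 1) : ℚ) / N) α :=
    add_right_cancel (hRroots.trans (by rw [hprod, add_comm, Multiset.filter_add_not]))
  have hupdate : ∀ i ∈ Finset.Icc (k + 2) g, Function.update Q (k + 1) R i = Q i := fun i hi =>
    Function.update_of_ne (by rw [Finset.mem_Icc] at hi; omega) _ _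
  refine ⟨Function.update Q (k + 1) R, ?_, ?_, fun i hi => ?_⟩
  · have hnotMem : k + 1 ∉ Finset.Icc (k + 2) g := fun hmem =>
      (Finset.mem_Icc.1 hmem).1.not_gt k.succ.lt_succ_self
    have hIcc : Finset.Icc (k + 1) g = insert (k + 1) (Finset.Icc (k + 2) g) :=
      (Finset.insert_Icc_add_one_left_eq_Icc hk).symm
    rw [hIcc, Finset.prod_insert hnotMem, Function.update_self, Finset.prod_congr rfl hupdate, hR]
  · rw [Function.update_self, hfar]
    exact fun α hα => (Multiset.mem_filter.1 hα).2
  · rw [hupdate i hi, natDegree_eq_card_roots_map_toHahn (hQW i hi).1, hQ i hi]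
    exact ⟨hQW i hi, fun α hα => (Multiset.mem_filter.1 hα).2,
      hB.card_filter_hasContact hs hi⟩

end Factors

end

end PlaneBranch

open PlaneBranch in
theorem mainTheorem1 (f : Polynomial Cx) (hW : IsWeierstrass f) (hf : Irreducible f)
    (g : ℕ) (b : ℕ → ℕ) (hb : IsPuiseuxCharacteristic f g b)
    (k : ℕ) (hk : k < g) (fk : Polynomial Cx) (hfk : IsApproximateRoot (charGcd b k) f fk) :
    ∃ Γ : ℕ → Cxy,
      jac (toSeries fk) (toSeries f) = Cxy.incl (∏ i ∈ Finset.Icc (k + 1) g, Γ i) ∧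
      IsRelPrime xVar (∏ i ∈ Finset.Icc (k + 2) g, Γ i) ∧
      (∀ α ∈ Zer (Cxy.incl (Γ (k + 1))), ∃ c : WithTop ℚ,
        IsContact α (toSeries f) c ∧ c < (((b (k + 1) : ℚ) / (b 0 : ℚ) : ℚ) : WithTop ℚ)) ∧
      (∀ i ∈ Finset.Icc (k + 2) g, ∀ α ∈ Zer (Cxy.incl (Γ i)),
        IsContact α (toSeries f) (((b i : ℚ) / (b 0 : ℚ) : ℚ) : WithTop ℚ)) ∧
      (∀ i ∈ Finset.Icc (k + 2) g,
        interMult (Γ i) xVar =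
          (((∏ j ∈ Finset.Icc 1 (i - 1), charQuot b j) * (charQuot b i - 1) : ℕ) : ℕ∞)) := by
  obtain ⟨γ, hB, hroots⟩ := exists_isBranch hW hf hb
  have hzer (α : HahnSeries ℚ ℂ) : α ∈ Zer (toSeries f) ↔ α ∈ conjugates f.natDegree γ := by
    rw [hW.mem_zer_iff_mem_roots, hroots]
  have hJ : jacPoly fk f ≠ 0 := hB.jacPoly_ne_zero hk hW.1 hroots hfk
  obtain ⟨Q, hprod, hfar, hQ⟩ :=
    hB.exists_prod_eq hk hJ (hB.hasPolarCounts hk hW.1 hroots hfk)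
  have hQ1 : Q (k + 1) ≠ 0 :=
    Finset.prod_ne_zero_iff.1 (hprod ▸ hJ) _ (Finset.left_mem_Icc.2 hk)
  rw [hb.zero]
  refine ⟨fun i => toCxy (Q i), ?_, ?_, fun α hα => ?_, fun i hi α hα => ?_, fun i hi => ?_⟩
  · rw [jac_toSeries, ← map_prod, ← hprod, incl_toCxy]
  · rw [← map_prod]
    exact isRelPrime_xVar_toCxy (Polynomial.monic_prod_of_monic _ _ fun i hi => (hQ i hi).1.1)
  · exact exists_isContact_lt hB.hasPeriod hzer (hfar α (mem_roots_of_mem_zer_toSeries hQ1 hα))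
  · exact ((hQ i hi).2.1 α (mem_roots_of_mem_zer_toSeries (hQ i hi).1.1.ne_zero hα)).isContact
      hB.hasPeriod hzer
  · rw [interMult_toCxy_xVar (hQ i hi).1, (hQ i hi).2.2]
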